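/- Let $\Omega=(0,1)$, $T>0$, $Q_T=\Omega\times(0,T)$. Let $H^1_{(0)}(\Omega)=\{z\in H^1(\Omega): z(0)=0\}$ with the norm $\|z\|_{H^1_{(0)}(\Omega)}=\|\partial_x z\|_{L^2(\Omega)}$, and let $H^{-1}_{(0)}(\Omega)$ be its dual space, with $L^2(\Omega)\subset H^{-1}_{(0)}(\Omega)$ through $\langle w,z\rangle=\int_\Omega wz\,dx$. Let $A\in L^\infty(Q_T)$, $B\in L^1(0,T;L^2(\Omega))$, $v\in L^2(0,T)$ and $(u_0,u_1)\in H^1_{(0)}(\Omega)\times L^2(\Omega)$, and consider $$\partial_{tt}y-\partial_{xx}y+Ay=B \text{ in } Q_T,\qquad y(0,\cdot)=0,\ \partial_x y(1,\cdot)=v \text{ in } (0,T),\qquad (y(\cdot,0),\partial_t y(\cdot,0))=(u_0,u_1) \text{ in } \Omega. \tag{1}$$ A weak solution of (1) is a function $y\in L^2(0,T;H^1_{(0)}(\Omega))\cap H^1(0,T;L^2(\Omega))\cap W^{2,1}(0,T;H^{-1}_{(0)}(\Omega))$ such that, for a.e. $t\in(0,T)$ and all $z\in H^1_{(0)}(\Omega)$,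 $$\langle\partial_{tt}y(\cdot,t),z\rangle_{H^{-1}_{(0)}(\Omega),H^1_{(0)}(\Omega)}-v(t)z(1)+\int_\Omega\partial_x y\,\partial_x z\,dx+\int_\Omega Ayz\,dx=\int_\Omega Bz\,dx,$$ and $y(\cdot,0)=u_0$, $\partial_t y(\cdot,0)=u_1$ (as values at $0$ of the continuous representatives of $y$ in $L^2(\Omega)$ and of $\partial_t y$ in $H^{-1}_{(0)}(\Omega)$). **Theorem.** Equation (1) has a unique weak solution $y$. It satisfies $y\in C^0([0,T];H^1_{(0)}(\Omega))\cap C^1([0,T];L^2(\Omega))$, and, if moreover $B\in L^2(0,T;L^2(\Omega))$, then $y\in H^2(0,T;H^{-1}_{(0)}(\Omega))$. There is a constant $C=C(T)>0$, depending only on $T$ (in particular not on $A$, $B$, $v$, $u_0$, $u_1$), such that for every $t\in[0,T]$ $$\|y(\cdot,t)\|_{H^1_{(0)}(\Omega)}+\|\partial_t y(\cdot,t)\|_{L^2(\Omega)}\le Ce^{C\sqrt{\|A\|_{L^\infty(Q_T)}}}\Big(\|(u_0,u_1)\|_{H^1_{(0)}(\Omega)\times L^2(\Omega)}+\|B\|_{L^1(0,t;L^2(\Omega))}+\|v\|_{L^2(0,t)}\Big).$$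 Moreover $y(1,\cdot)\in H^1(0,T)$, and for every $t\in[0,T]$ $$\|\partial_t y(1,\cdot)\|_{L^2(0,t)}\le Ce^{C\sqrt{\|A\|_{L^\infty(Q_T)}}}\Big(\|(u_0,u_1)\|_{H^1_{(0)}(\Omega)\times L^2(\Omega)}+\|B\|_{L^1(0,t;L^2(\Omega))}+\|v\|_{L^2(0,t)}\Big).$$ -/

import Mathlib

open MeasureTheory Set
open scoped ENNReal ContDiff

noncomputable section

namespace Wave1D

/-- Lebesgue measure on the open interval `(a, b)`. -/
abbrev leb (a b : ℝ) : Measure ℝ := volume.restrict (Ioo a b)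

/-- `g` is the weak (distributional) derivative of `f` on `(a, b)`. It is used for functions that
are integrable on `(a, b)` with values in a Banach space `E`. -/
def IsWeakDeriv {E : Type*} [NormedAddCommGroup E] [NormedSpace ℝ E] (a b : ℝ) (f g : ℝ → E) :
    Prop :=
  ∀ φ : ℝ → ℝ, ContDiff ℝ ∞ φ → HasCompactSupport φ → tsupport φ ⊆ Ioo a b →
    ∫ s, deriv φ s • f s ∂(leb a b) = -∫ s, φ s • g s ∂(leb a b)

/-- `f` has a representative that is continuous on `[a, b]` and takes the value `e` at `c`. -/
def HasValueAt {E : Type*} [TopologicalSpace E] (a b : ℝ) (f : ℝ → E) (c : ℝ) (e : E) : Prop :=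
  ∃ r : ℝ → E, ContinuousOn r (Icc a b) ∧ f =ᵐ[leb a b] r ∧ r c = e

/-- The norm of `f` in `L^p(a, b; E)`. -/
def lpNorm {E : Type*} [NormedAddCommGroup E] (p : ℝ≥0∞) (a b : ℝ) (f : ℝ → E) : ℝ :=
  (eLpNorm f p (leb a b)).toReal

/-- `L²(Ω)`, where `Ω = (0, 1)`. -/
abbrev L2 : Type := Lp ℝ 2 (leb 0 1)

lemma L2.integrable (f : L2) : Integrable (f : ℝ → ℝ) (leb 0 1) :=
  (Lp.memLp f).integrable (by norm_num)

lemma test_smul_integrable (f : L2) {φ : ℝ → ℝ} (hφ : Continuous φ) (hc : HasCompactSupport φ) :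
    Integrable (fun s => φ s • (f : ℝ → ℝ) s) (leb 0 1) := by
  obtain ⟨C, hC⟩ := hc.exists_bound_of_continuous hφ
  exact (L2.integrable f).bdd_mul hφ.aestronglyMeasurable (Filter.Eventually.of_forall hC)

/-- The graph of `∂ₓ` on `H¹_{(0)}(Ω)`: the pairs `(z, z')` in `L²(Ω) × L²(Ω)` such that `z'` is the
weak derivative of `z` and `z(0) = 0`. -/
def h1ZeroGraph : Submodule ℝ (L2 × L2) where
  carrier := {p | IsWeakDeriv 0 1 (p.1 : ℝ → ℝ) (p.2 : ℝ → ℝ) ∧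
    HasValueAt 0 1 (p.1 : ℝ → ℝ) 0 0}
  zero_mem' := by
    refine ⟨fun φ _ _ _ => ?_, fun _ => 0, continuousOn_const, Lp.coeFn_zero _ _ _, rfl⟩
    have h : ((0 : L2 × L2).1 : ℝ → ℝ) =ᵐ[leb 0 1] 0 := Lp.coeFn_zero _ _ _
    have h' : ((0 : L2 × L2).2 : ℝ → ℝ) =ᵐ[leb 0 1] 0 := Lp.coeFn_zero _ _ _
    rw [integral_eq_zero_of_ae, integral_eq_zero_of_ae, neg_zero]
    · filter_upwards [h'] with s hs
      simp only [hs, Pi.zero_apply, smul_zero]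
    · filter_upwards [h] with s hs
      simp only [hs, Pi.zero_apply, smul_zero]
  add_mem' := by
    rintro p q ⟨hp, r, hr, hpr, hr0⟩ ⟨hq, r', hr', hqr, hr0'⟩
    refine ⟨fun φ h1 h2 h3 => ?_, r + r', hr.add hr',
      (Lp.coeFn_add p.1 q.1).trans (hpr.add hqr), by simp [hr0, hr0']⟩
    have hd : Continuous (deriv φ) := h1.continuous_deriv (by simp)
    have e1 : ∫ s, deriv φ s • ((p + q).1 : ℝ → ℝ) s ∂(leb 0 1)
        = ∫ s, (deriv φ s • (p.1 : ℝ → ℝ) s + deriv φ s • (q.1 : ℝ → ℝ) s) ∂(leb 0 1) := by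
      refine integral_congr_ae ?_
      filter_upwards [Lp.coeFn_add p.1 q.1] with s hs
      rw [Prod.fst_add, hs, Pi.add_apply, smul_add]
    have e2 : ∫ s, φ s • ((p + q).2 : ℝ → ℝ) s ∂(leb 0 1)
        = ∫ s, (φ s • (p.2 : ℝ → ℝ) s + φ s • (q.2 : ℝ → ℝ) s) ∂(leb 0 1) := by
      refine integral_congr_ae ?_
      filter_upwards [Lp.coeFn_add p.2 q.2] with s hs
      rw [Prod.snd_add, hs, Pi.add_apply, smul_add]
    rw [e1, e2, integral_add (test_smul_integrable _ hd h2.deriv)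
      (test_smul_integrable _ hd h2.deriv), integral_add
      (test_smul_integrable _ h1.continuous h2) (test_smul_integrable _ h1.continuous h2),
      hp φ h1 h2 h3, hq φ h1 h2 h3]
    ring
  smul_mem' := by
    rintro c p ⟨hp, r, hr, hpr, hr0⟩
    refine ⟨fun φ h1 h2 h3 => ?_, c • r, hr.const_smul c,
      (Lp.coeFn_smul c p.1).trans (hpr.const_smul c), by simp [hr0]⟩
    have e1 : ∫ s, deriv φ s • ((c • p).1 : ℝ → ℝ) s ∂(leb 0 1)
        = ∫ s, c • (deriv φ s • (p.1 : ℝ → ℝ) s) ∂(leb 0 1) := by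
      refine integral_congr_ae ?_
      filter_upwards [Lp.coeFn_smul c p.1] with s hs
      rw [Prod.smul_fst, hs, Pi.smul_apply, smul_comm]
    have e2 : ∫ s, φ s • ((c • p).2 : ℝ → ℝ) s ∂(leb 0 1)
        = ∫ s, c • (φ s • (p.2 : ℝ → ℝ) s) ∂(leb 0 1) := by
      refine integral_congr_ae ?_
      filter_upwards [Lp.coeFn_smul c p.2] with s hs
      rw [Prod.smul_snd, hs, Pi.smul_apply, smul_comm]
    rw [e1, e2, integral_smul, integral_smul, hp φ h1 h2 h3, smul_neg]

/-- The Hilbert space `H¹_{(0)}(Ω) = {z ∈ H¹(Ω) : z(0) = 0}`. An element carries its weak derivative,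
which is determined by it. -/
def H1Zero : Type := h1ZeroGraph

namespace H1Zero

instance : AddCommGroup H1Zero := inferInstanceAs (AddCommGroup h1ZeroGraph)

instance : Module ℝ H1Zero := inferInstanceAs (Module ℝ h1ZeroGraph)

/-- The inclusion `H¹_{(0)}(Ω) → L²(Ω)`. -/
def toL2 : H1Zero →ₗ[ℝ] L2 := (LinearMap.fst ℝ L2 L2) ∘ₗ h1ZeroGraph.subtype

/-- The weak derivative `∂ₓ : H¹_{(0)}(Ω) → L²(Ω)`. -/
def dx : H1Zero →ₗ[ℝ] L2 := (LinearMap.snd ℝ L2 L2) ∘ₗ h1ZeroGraph.subtype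

/-- The representative of `z` that is continuous on `[0, 1]`; only its values on `[0, 1]` matter, and
these are determined by `z`. -/
def rep (z : H1Zero) : ℝ → ℝ := Classical.choose (show h1ZeroGraph from z).2.2

lemma isWeakDeriv (z : H1Zero) : IsWeakDeriv 0 1 (toL2 z : ℝ → ℝ) (dx z : ℝ → ℝ) :=
  (show h1ZeroGraph from z).2.1

lemma continuousOn_rep (z : H1Zero) : ContinuousOn z.rep (Icc 0 1) :=
  (Classical.choose_spec (show h1ZeroGraph from z).2.2).1

lemma toL2_ae_eq_rep (z : H1Zero) : (toL2 z : ℝ → ℝ) =ᵐ[leb 0 1] z.rep :=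
  (Classical.choose_spec (show h1ZeroGraph from z).2.2).2.1

lemma rep_zero (z : H1Zero) : z.rep 0 = 0 :=
  (Classical.choose_spec (show h1ZeroGraph from z).2.2).2.2

/-- `z(x) = ∫₀ˣ z'`. -/
lemma rep_eq_integral (z : H1Zero) {x : ℝ} (hx : x ∈ Icc (0 : ℝ) 1) :
    z.rep x = ∫ s in (0 : ℝ)..x, (dx z : ℝ → ℝ) s := by
  set g : ℝ → ℝ := (dx z : ℝ → ℝ) with hg
  have hgi : IntervalIntegrable g volume 0 1 := by
    rw [intervalIntegrable_iff_integrableOn_Ioo_of_le zero_le_one]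
    exact L2.integrable (dx z)
  set G : ℝ → ℝ := fun x => ∫ s in (0 : ℝ)..x, g s with hG
  have hGac : AbsolutelyContinuousOnInterval G 0 1 :=
    hgi.absolutelyContinuousOnInterval_intervalIntegral (by simp)
  have hGc : ContinuousOn G (Icc 0 1) := by
    simpa [uIcc_of_le (zero_le_one : (0 : ℝ) ≤ 1)] using hGac.continuousOn
  set h : ℝ → ℝ := fun x => z.rep x - G x with hh
  have hhc : ContinuousOn h (Icc 0 1) := (continuousOn_rep z).sub hGc
  have hhi : Integrable h (leb 0 1) :=
    (hhc.integrableOn_compact isCompact_Icc).mono_set Ioo_subset_Icc_self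
  have conv (F : ℝ → ℝ) : ∫ s in (0 : ℝ)..1, F s = ∫ s, F s ∂(leb 0 1) := by
    rw [intervalIntegral.integral_of_le zero_le_one, integral_Ioc_eq_integral_Ioo]
  have tint {F φ : ℝ → ℝ} (hF : Integrable F (leb 0 1)) (hφ : Continuous φ)
      (hc : HasCompactSupport φ) : Integrable (fun s => φ s * F s) (leb 0 1) := by
    obtain ⟨C, hC⟩ := hc.exists_bound_of_continuous hφ
    exact hF.bdd_mul hφ.aestronglyMeasurable (Filter.Eventually.of_forall hC)
  have key : ∀ φ : ℝ → ℝ, ContDiff ℝ ∞ φ → HasCompactSupport φ → tsupport φ ⊆ Ioo 0 1 →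
      ∫ s, deriv φ s * h s ∂(leb 0 1) = 0 := by
    intro φ h1 h2 h3
    have hd : Continuous (deriv φ) := h1.continuous_deriv (by simp)
    have φ0 : φ 0 = 0 := by
      by_contra hne
      exact absurd (h3 (subset_tsupport φ hne)).1 (lt_irrefl _)
    have φ1 : φ 1 = 0 := by
      by_contra hne
      exact absurd (h3 (subset_tsupport φ hne)).2 (lt_irrefl _)
    have hφac : AbsolutelyContinuousOnInterval φ 0 1 :=
      (h1.of_le (by simp)).contDiffOn.absolutelyContinuousOnInterval
    have ibp := hφac.integral_mul_deriv_eq_deriv_mul hGac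
    rw [φ0, φ1] at ibp
    have e : ∫ s in (0 : ℝ)..1, φ s * deriv G s = ∫ s in (0 : ℝ)..1, φ s * g s := by
      refine intervalIntegral.integral_congr_ae ?_
      filter_upwards [hgi.ae_hasDerivAt_integral] with s hs hs'
      rw [(hs (uIoc_subset_uIcc hs') 0 (by simp)).deriv]
    rw [e, conv, conv] at ibp
    have w := isWeakDeriv z φ h1 h2 h3
    have w' : ∫ s, deriv φ s • (toL2 z : ℝ → ℝ) s ∂(leb 0 1)
        = ∫ s, deriv φ s * z.rep s ∂(leb 0 1) := by
      refine integral_congr_ae ?_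
      filter_upwards [toL2_ae_eq_rep z] with s hs
      rw [hs, smul_eq_mul]
    rw [w'] at w
    simp only [smul_eq_mul] at w
    have hri : Integrable z.rep (leb 0 1) :=
      ((continuousOn_rep z).integrableOn_compact isCompact_Icc).mono_set Ioo_subset_Icc_self
    have hGi : Integrable G (leb 0 1) :=
      (hGc.integrableOn_compact isCompact_Icc).mono_set Ioo_subset_Icc_self
    simp only [hh, mul_sub]
    rw [integral_sub (tint hri hd h2.deriv) (tint hGi hd h2.deriv), w]
    linarith
  -- a fixed test function of integral one
  let ψb : ContDiffBump (1 / 2 : ℝ) := ⟨1 / 8, 1 / 4, by norm_num, by norm_num⟩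
  set ψ : ℝ → ℝ := ψb.normed volume with hψ
  have ψs : ContDiff ℝ ∞ ψ := ψb.contDiff_normed
  have ψc : HasCompactSupport ψ := ψb.hasCompactSupport_normed
  have ψt : tsupport ψ ⊆ Ioo 0 1 := by
    rw [hψ, ψb.tsupport_normed_eq, Real.closedBall_eq_Icc]
    intro s hs
    have h1 : (1 / 2 : ℝ) - 1 / 4 ≤ s := hs.1
    have h2 : s ≤ (1 / 2 : ℝ) + 1 / 4 := hs.2
    constructor <;> linarith
  have ψi : ∫ s, ψ s = 1 := ψb.integral_normed
  set K : ℝ := ∫ s, ψ s * h s ∂(leb 0 1) with hK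
  have hae : ∀ᵐ s, s ∈ Ioo (0 : ℝ) 1 → h s - K = 0 := by
    refine isOpen_Ioo.ae_eq_zero_of_integral_contDiff_smul_eq_zero ?_ ?_
    · exact IntegrableOn.locallyIntegrableOn (hhi.sub (integrable_const K))
    intro η ηs ηc ηt
    set c : ℝ := ∫ s, η s with hc
    set θ : ℝ → ℝ := fun s => η s - c * ψ s with hθ
    have θs : ContDiff ℝ ∞ θ := ηs.sub (contDiff_const.mul ψs)
    have θcont : Continuous θ := θs.continuous
    have θc : HasCompactSupport θ := ηc.sub (ψc.mul_left)
    have θt : tsupport θ ⊆ Ioo 0 1 := by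
      refine (tsupport_sub η (fun s => c * ψ s)).trans (union_subset ηt ?_)
      exact (tsupport_mul_subset_right (f := fun _ => c) (g := ψ)).trans ψt
    have suppint {F : ℝ → ℝ} (hF : tsupport F ⊆ Ioo 0 1) (k : ℝ → ℝ) :
        ∫ s, F s * k s = ∫ s, F s * k s ∂(leb 0 1) := by
      symm
      refine setIntegral_eq_integral_of_forall_compl_eq_zero fun s hs => ?_
      rw [image_eq_zero_of_notMem_tsupport (fun hh => hs (hF hh)), zero_mul]
    have θi : ∫ s, θ s = 0 := by
      rw [hθ, integral_sub (ηs.continuous.integrable_of_hasCompactSupport ηc)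
        ((ψs.continuous.integrable_of_hasCompactSupport ψc).const_mul c), integral_const_mul, ψi]
      simp [hc]
    -- the support of `θ` lies in some `[p, q]` inside `(0, 1)`
    obtain ⟨p, q, hp, hq, hpq⟩ : ∃ p q : ℝ, 0 < p ∧ q < 1 ∧ tsupport θ ⊆ Icc p q := by
      rcases (tsupport θ).eq_empty_or_nonempty with he | hne
      · exact ⟨1 / 2, 1 / 2, by norm_num, by norm_num, by rw [he]; exact empty_subset _⟩
      · obtain ⟨p, hp, hp'⟩ := IsCompact.exists_isLeast θc hne
        obtain ⟨q, hq, hq'⟩ := IsCompact.exists_isGreatest θc hne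
        exact ⟨p, q, (θt hp).1, (θt hq).2, fun s hs => ⟨hp' hs, hq' hs⟩⟩
    have θz {s : ℝ} (hs : s ∉ Icc p q) : θ s = 0 :=
      image_eq_zero_of_notMem_tsupport fun hh => hs (hpq hh)
    set φ : ℝ → ℝ := fun x => ∫ s in (0 : ℝ)..x, θ s with hφ
    have φd : ∀ x, HasDerivAt φ (θ x) x := fun x =>
      intervalIntegral.integral_hasDerivAt_right (θcont.intervalIntegrable _ _)
        θcont.aestronglyMeasurable.stronglyMeasurableAtFilter θcont.continuousAt
    have φd' : deriv φ = θ := funext fun x => (φd x).deriv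
    have φs : ContDiff ℝ ∞ φ := by
      rw [contDiff_infty_iff_deriv, φd']
      exact ⟨fun x => (φd x).differentiableAt, θs⟩
    have φz : ∀ x, x ∉ Icc p q → φ x = 0 := by
      intro x hx
      by_cases hxp : x < p
      · rw [hφ]
        refine intervalIntegral.integral_zero_ae (Filter.Eventually.of_forall fun s hs => θz ?_)
        intro hs'
        rcases mem_uIoc.mp hs with h | h
        · linarith [h.2, hs'.1]
        · linarith [h.2, hs'.1]
      · have hxq : q < x := by
          by_contra hc
          exact hx ⟨not_lt.mp hxp, not_lt.mp hc⟩
        by_cases hx0 : 0 ≤ x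
        · rw [hφ]
          simp only
          rw [intervalIntegral.integral_of_le hx0]
          refine Eq.trans ?_ θi
          refine setIntegral_eq_integral_of_forall_compl_eq_zero fun s hs => θz fun hs' => hs ?_
          exact ⟨hp.trans_le hs'.1, hs'.2.trans hxq.le⟩
        · exact absurd hp (by linarith [not_lt.mp hxp])
    have φt : tsupport φ ⊆ Icc p q := by
      refine closure_minimal (fun x hx => ?_) isClosed_Icc
      by_contra hn
      exact hx (φz x hn)
    have φc : HasCompactSupport φ := isCompact_Icc.of_isClosed_subset (isClosed_tsupport φ) φt
    have r1 := key φ φs φc (φt.trans fun s hs => ⟨hp.trans_le hs.1, hs.2.trans_lt hq⟩)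
    rw [φd'] at r1
    have r2 : ∫ s, θ s * h s ∂(leb 0 1) = (∫ s, η s * h s ∂(leb 0 1)) - c * K := by
      rw [hK, ← integral_const_mul, ← integral_sub (tint hhi ηs.continuous ηc)
        ((tint hhi ψs.continuous ψc).const_mul c)]
      refine integral_congr_ae (Filter.Eventually.of_forall fun s => ?_)
      simp only [hθ]
      ring
    have r3 : c = ∫ s, η s * 1 ∂(leb 0 1) := by
      rw [← suppint ηt (fun _ => 1)]
      simp [hc]
    simp only [smul_eq_mul]
    rw [suppint ηt (fun s => h s - K)]
    have r4 : ∫ s, η s * (h s - K) ∂(leb 0 1) = (∫ s, η s * h s ∂(leb 0 1)) - c * K := by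
      rw [r3, ← integral_mul_const, ← integral_sub (tint hhi ηs.continuous ηc)]
      · refine integral_congr_ae (Filter.Eventually.of_forall fun s => ?_)
        simp only
        ring
      · exact (tint (integrable_const (1 : ℝ)) ηs.continuous ηc).mul_const K
    rw [r4, ← r2, r1]
  have heq : EqOn h (fun _ => K) (Icc 0 1) := by
    refine Measure.eqOn_Icc_of_ae_eq volume zero_ne_one ?_ hhc continuousOn_const
    rw [Filter.EventuallyEq, ← restrict_Ioo_eq_restrict_Icc, ae_restrict_iff' measurableSet_Ioo]
    filter_upwards [hae] with s hs hs'
    exact sub_eq_zero.mp (hs hs')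
  have h0 : h 0 = 0 := by simp [hh, hG, rep_zero]
  have hK0 : K = 0 := by rw [← h0]; exact (heq (by simp)).symm
  have := heq hx
  simp only [hh, hK0] at this
  linarith

lemma norm_toL2_le (z : H1Zero) : ‖toL2 z‖ ≤ ‖dx z‖ := by
  have hb : ∀ᵐ x ∂(leb 0 1), ‖(toL2 z : ℝ → ℝ) x‖ ≤ ‖dx z‖ := by
    filter_upwards [toL2_ae_eq_rep z, ae_restrict_mem measurableSet_Ioo] with x hx hx'
    rw [hx, rep_eq_integral z (Ioo_subset_Icc_self hx'),
      intervalIntegral.integral_of_le hx'.1.le]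
    have hi := L2.integrable (dx z)
    calc ‖∫ s in Ioc 0 x, (dx z : ℝ → ℝ) s‖
        ≤ ∫ s in Ioc 0 x, ‖(dx z : ℝ → ℝ) s‖ := norm_integral_le_integral_norm _
      _ ≤ ∫ s, ‖(dx z : ℝ → ℝ) s‖ ∂(leb 0 1) :=
          setIntegral_mono_set hi.norm (Filter.Eventually.of_forall fun s => norm_nonneg _)
            (Filter.Eventually.of_forall fun s hs => ⟨hs.1, hs.2.trans_lt hx'.2⟩)
      _ = (eLpNorm (dx z : ℝ → ℝ) 1 (leb 0 1)).toReal := by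
          rw [integral_norm_eq_lintegral_enorm hi.1, eLpNorm_one_eq_lintegral_enorm]
      _ ≤ (eLpNorm (dx z : ℝ → ℝ) 2 (leb 0 1)).toReal := by
          have : IsProbabilityMeasure (leb 0 1) := ⟨by simp [leb]⟩
          exact ENNReal.toReal_mono (Lp.memLp (dx z)).2.ne
            (eLpNorm_le_eLpNorm_of_exponent_le (by norm_num) hi.1)
      _ = ‖dx z‖ := (Lp.norm_def _).symm
  have := Lp.norm_le_of_ae_bound (norm_nonneg (dx z)) hb
  simpa [measureUnivNNReal, leb] using this

lemma dx_injective : Function.Injective dx := by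
  rw [← LinearMap.ker_eq_bot, LinearMap.ker_eq_bot']
  intro z hz
  have h := norm_toL2_le z
  rw [hz, norm_zero, norm_le_zero_iff] at h
  exact Subtype.ext (Prod.ext h hz)

/-- The norm `‖z‖ = ‖∂ₓ z‖_{L²(Ω)}`. -/
instance : NormedAddCommGroup H1Zero := NormedAddCommGroup.induced H1Zero L2 dx dx_injective

/-- The inner product `⟨z, w⟩ = ∫ ∂ₓ z ∂ₓ w`. -/
instance : InnerProductSpace ℝ H1Zero where
  toNormedSpace := NormedSpace.induced ℝ H1Zero L2 dx
  inner z w := inner ℝ (dx z) (dx w)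
  norm_sq_eq_re_inner z := norm_sq_eq_re_inner (𝕜 := ℝ) (dx z)
  conj_inner_symm z w := inner_conj_symm (𝕜 := ℝ) (dx z) (dx w)
  add_left z w u := by rw [map_add, inner_add_left]
  smul_left z w c := by rw [map_smul, inner_smul_left]

lemma norm_eq (z : H1Zero) : ‖z‖ = ‖dx z‖ := rfl

end H1Zero

/-- `H^{-1}_{(0)}(Ω)`, the dual space of `H¹_{(0)}(Ω)`. -/
abbrev Hm1 : Type := StrongDual ℝ H1Zero

/-- The inclusion `L²(Ω) → H^{-1}_{(0)}(Ω)`, `w ↦ (z ↦ ∫ w z)`. -/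
def toHm1 (w : L2) : Hm1 :=
  LinearMap.mkContinuous
    { toFun := fun z => inner ℝ w (H1Zero.toL2 z)
      map_add' := fun z z' => by rw [map_add, inner_add_right]
      map_smul' := fun c z => by rw [map_smul, inner_smul_right]; rfl } ‖w‖
    fun z => (norm_inner_le_norm w (H1Zero.toL2 z)).trans
      (mul_le_mul_of_nonneg_left (H1Zero.norm_toL2_le z) (norm_nonneg w))

/-- The space-time cylinder `Q_T = Ω × (0, T)`, with points written `(x, t)`. -/
def cylinder (T : ℝ) : Set (ℝ × ℝ) := Ioo 0 1 ×ˢ Ioo 0 T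

/-- The norm of `A` in `L^∞(Q_T)`. -/
def supNorm (T : ℝ) (A : ℝ × ℝ → ℝ) : ℝ :=
  (eLpNorm A ∞ (volume.restrict (cylinder T))).toReal

/-- `y ∈ L²(0,T; H¹_{(0)}(Ω)) ∩ H¹(0,T; L²(Ω)) ∩ W^{2,q}(0,T; H^{-1}_{(0)}(Ω))` is a weak solution of
`∂ₜₜ y - ∂ₓₓ y + A y = B` in `Q_T`, `y(0,·) = 0`, `∂ₓ y(1,·) = v` in `(0,T)`,
`(y(·,0), ∂ₜ y(·,0)) = (u₀, u₁)` in `Ω`. Here `yt` and `ytt` are `∂ₜ y` and `∂ₜₜ y`. -/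
def IsWeakSolution (q : ℝ≥0∞) (T : ℝ) (A : ℝ × ℝ → ℝ) (B : ℝ → L2) (v : ℝ → ℝ)
    (u₀ : H1Zero) (u₁ : L2) (y : ℝ → H1Zero) : Prop :=
  ∃ (yt : ℝ → L2) (ytt : ℝ → Hm1),
    MemLp y 2 (leb 0 T) ∧ MemLp yt 2 (leb 0 T) ∧ MemLp ytt q (leb 0 T) ∧
    IsWeakDeriv 0 T (fun t => (y t).toL2) yt ∧
    IsWeakDeriv 0 T (fun t => toHm1 (yt t)) ytt ∧
    (∀ᵐ t ∂(leb 0 T), ∀ z : H1Zero,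
      ytt t z - v t * z.rep 1 + inner ℝ (y t).dx z.dx
        + ∫ x in Ioo (0 : ℝ) 1, A (x, t) * (y t).toL2 x * z.toL2 x
      = inner ℝ (B t) z.toL2) ∧
    HasValueAt 0 T (fun t => (y t).toL2) 0 u₀.toL2 ∧
    HasValueAt 0 T (fun t => toHm1 (yt t)) 0 (toHm1 u₁)

/-- The bound
`C e^{C √‖A‖_∞} (‖(u₀, u₁)‖_{H¹_{(0)} × L²} + ‖B‖_{L¹(0,t; L²)} + ‖v‖_{L²(0,t)})`. -/
def dataBound (C T : ℝ) (A : ℝ × ℝ → ℝ) (B : ℝ → L2) (v : ℝ → ℝ) (u₀ : H1Zero) (u₁ : L2)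
    (t : ℝ) : ℝ :=
  C * Real.exp (C * √(supNorm T A)) *
    (√(‖u₀‖ ^ 2 + ‖u₁‖ ^ 2) + lpNorm 1 0 t B + lpNorm 2 0 t v)

end Wave1D
end

/-!
A solution of the free wave equation with `y(0, ·) = 0` is encoded by a single profile `h ∈ L²(ℝ)`:
`∂ₓ y(x, t) = (h(t + x) + h(t - x)) / 2` and `∂ₜ y(x, t) = (h(t + x) - h(t - x)) / 2`. The Neumann
condition at `x = 1` becomes the recursion `h(t + 1) + h(t - 1) = 2 v(t)`, which is solved on
`(0, 2N)` by an alternating sum of `N + 1` translates. A right-hand side `F` is a superposition of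
profiles released at the times `s`, each carrying the velocity `F(s)` (Duhamel), and the potential
is absorbed by solving the Volterra equation `F = B - A y`.

Since `∂ₜ y` and `∂ₓ y` at time `t` are bounded by the norm of `h` on `(-∞, t + 1)`, substituting
`y(t) = u₀ + ∫₀ᵗ ∂ₜ y` into this norm gives a double integral inequality with kernel `‖A‖`, hence
growth `exp (c √‖A‖ t)` rather than `exp (c ‖A‖ t)`. The trace is read off from
`∂ₜ y(1, t) = v(t) - h(t - 1)`. For uniqueness, the equation of the difference `y` of two
solutions is integrated once in time and tested with `y` itself, because `∂ₜ y` is not an admissible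
test function.
-/

noncomputable section

namespace Wave1D

section Interval

variable {E : Type*} [NormedAddCommGroup E] {a b : ℝ}

lemma intervalIntegrable_of_leb {g : ℝ → E} (hg : Integrable g (leb a b)) {c d : ℝ}
    (hac : a ≤ c) (hcd : c ≤ d) (hdb : d ≤ b) : IntervalIntegrable g volume c d := by
  rw [intervalIntegrable_iff_integrableOn_Ioo_of_le hcd]
  exact IntegrableOn.mono_set hg (Ioo_subset_Ioo hac hdb)

lemma integrable_leb_of_continuousOn {F : ℝ → E} (hF : ContinuousOn F (Icc a b)) :
    Integrable F (leb a b) :=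
  (hF.integrableOn_compact isCompact_Icc).mono_set Ioo_subset_Icc_self

variable [NormedSpace ℝ E]

lemma intervalIntegral_eq_integral_leb (hab : a ≤ b) (F : ℝ → E) :
    ∫ s in a..b, F s = ∫ s, F s ∂(leb a b) := by
  rw [intervalIntegral.integral_of_le hab, integral_Ioc_eq_integral_Ioo]

lemma continuousOn_primitive {g : ℝ → E} (hab : a ≤ b) (hg : Integrable g (leb a b)) :
    ContinuousOn (fun t => ∫ s in a..t, g s) (Icc a b) := by
  have := intervalIntegral.continuousOn_primitive_interval'
    (intervalIntegrable_of_leb hg le_rfl hab le_rfl) left_mem_uIcc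
  rwa [uIcc_of_le hab] at this

end Interval

/-- A test function on the open interval `(a, b)`: an element `φ` of `C_c^∞(a, b)`, extended by zero
to the whole line. These are the functions against which `IsWeakDeriv` is tested. -/
structure IsTestFunction (a b : ℝ) (φ : ℝ → ℝ) : Prop where
  contDiff : ContDiff ℝ ∞ φ
  hasCompactSupport : HasCompactSupport φ
  tsupport_subset : tsupport φ ⊆ Ioo a b

namespace IsTestFunction

variable {E : Type*} [NormedAddCommGroup E] [NormedSpace ℝ E] {a b : ℝ} {φ ψ : ℝ → ℝ}

lemma eq_zero_of_notMem (hφ : IsTestFunction a b φ) {x : ℝ} (hx : x ∉ Ioo a b) : φ x = 0 :=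
  image_eq_zero_of_notMem_tsupport fun h => hx (hφ.tsupport_subset h)

lemma apply_left (hφ : IsTestFunction a b φ) : φ a = 0 := hφ.eq_zero_of_notMem (by simp)

lemma apply_right (hφ : IsTestFunction a b φ) : φ b = 0 := hφ.eq_zero_of_notMem (by simp)

protected lemma deriv (hφ : IsTestFunction a b φ) : IsTestFunction a b (deriv φ) where
  contDiff := (contDiff_infty_iff_deriv.1 hφ.contDiff).2
  hasCompactSupport := hφ.hasCompactSupport.deriv
  tsupport_subset := (tsupport_deriv_subset (𝕜 := ℝ)).trans hφ.tsupport_subset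

lemma sub_const_mul (hφ : IsTestFunction a b φ) (hψ : IsTestFunction a b ψ) (c : ℝ) :
    IsTestFunction a b fun s => φ s - c * ψ s where
  contDiff := hφ.contDiff.sub (contDiff_const.mul hψ.contDiff)
  hasCompactSupport := hφ.hasCompactSupport.sub hψ.hasCompactSupport.mul_left
  tsupport_subset := (tsupport_sub φ fun s => c * ψ s).trans <| union_subset hφ.tsupport_subset <|
    (tsupport_mul_subset_right (f := fun _ => c) (g := ψ)).trans hψ.tsupport_subset

lemma integrable (hφ : IsTestFunction a b φ) : Integrable φ :=
  hφ.contDiff.continuous.integrable_of_hasCompactSupport hφ.hasCompactSupport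

lemma integrable_smul (hφ : IsTestFunction a b φ) {F : ℝ → E} (hF : Integrable F (leb a b)) :
    Integrable (fun s => φ s • F s) (leb a b) := by
  obtain ⟨C, hC⟩ := hφ.hasCompactSupport.exists_bound_of_continuous hφ.contDiff.continuous
  exact hF.bdd_smul C hφ.contDiff.continuous.aestronglyMeasurable (.of_forall hC)

lemma integral_smul_leb (hφ : IsTestFunction a b φ) (F : ℝ → E) :
    ∫ s, φ s • F s ∂(leb a b) = ∫ s, φ s • F s :=
  setIntegral_eq_integral_of_forall_compl_eq_zero fun s hs => by
    rw [hφ.eq_zero_of_notMem hs, zero_smul]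

lemma exists_tsupport_subset_Icc (hφ : IsTestFunction a b φ) (hab : a < b) :
    ∃ p q : ℝ, a < p ∧ q < b ∧ tsupport φ ⊆ Icc p q := by
  rcases (tsupport φ).eq_empty_or_nonempty with hempty | hne
  · exact ⟨(a + b) / 2, (a + b) / 2, by linarith, by linarith, hempty ▸ empty_subset _⟩
  · obtain ⟨p, hp, hp'⟩ := IsCompact.exists_isLeast hφ.hasCompactSupport hne
    obtain ⟨q, hq, hq'⟩ := IsCompact.exists_isGreatest hφ.hasCompactSupport hne
    exact ⟨p, q, (hφ.tsupport_subset hp).1, (hφ.tsupport_subset hq).2,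
      fun s hs => ⟨hp' hs, hq' hs⟩⟩

end IsTestFunction

lemma primitive_eq_zero_of_notMem_Icc {θ : ℝ → ℝ} {a p q x : ℝ} (hap : a < p)
    (hθ : Function.support θ ⊆ Icc p q) (hint : ∫ s, θ s = 0) (hx : x ∉ Icc p q) :
    ∫ s in a..x, θ s = 0 := by
  rcases lt_or_ge x p with hxp | hpx
  · refine intervalIntegral.integral_zero_ae (.of_forall fun s hs => ?_)
    refine Function.notMem_support.1 fun hs' => (hθ hs').1.not_gt ?_
    exact (mem_uIoc.1 hs).elim (fun h => h.2.trans_lt hxp) fun h => h.2.trans_lt hap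
  · have hqx : q < x := not_le.1 fun h => hx ⟨hpx, h⟩
    rw [intervalIntegral.integral_eq_integral_of_support_subset, hint]
    exact hθ.trans fun s hs => ⟨hap.trans_le hs.1, hs.2.trans hqx.le⟩

namespace IsTestFunction

variable {E : Type*} [NormedAddCommGroup E] [NormedSpace ℝ E] {a b : ℝ} {φ ψ : ℝ → ℝ}

lemma exists_deriv_eq (hφ : IsTestFunction a b φ) (hab : a < b) (hint : ∫ s, φ s = 0) :
    ∃ Φ : ℝ → ℝ, IsTestFunction a b Φ ∧ deriv Φ = φ := by
  obtain ⟨p, q, hap, hqb, hpq⟩ := hφ.exists_tsupport_subset_Icc hab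
  have hcont : Continuous φ := hφ.contDiff.continuous
  set Φ : ℝ → ℝ := fun x => ∫ s in a..x, φ s
  have hderiv (x : ℝ) : HasDerivAt Φ (φ x) x :=
    intervalIntegral.integral_hasDerivAt_right (hcont.intervalIntegrable _ _)
      hcont.aestronglyMeasurable.stronglyMeasurableAtFilter hcont.continuousAt
  have hΦ : deriv Φ = φ := funext fun x => (hderiv x).deriv
  have hsupp : tsupport Φ ⊆ Icc p q :=
    closure_minimal (fun x hx => not_not.1 fun hn => hx <|
      primitive_eq_zero_of_notMem_Icc hap ((subset_tsupport φ).trans hpq) hint hn) isClosed_Icc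
  refine ⟨Φ, ⟨?_, isCompact_Icc.of_isClosed_subset (isClosed_tsupport Φ) hsupp,
    hsupp.trans fun s hs => ⟨hap.trans_le hs.1, hs.2.trans_lt hqb⟩⟩, hΦ⟩
  rw [contDiff_infty_iff_deriv, hΦ]
  exact ⟨fun x => (hderiv x).differentiableAt, hφ.contDiff⟩

lemma exists_integral_eq_one (hab : a < b) : ∃ ψ : ℝ → ℝ, IsTestFunction a b ψ ∧ ∫ s, ψ s = 1 := by
  let bump : ContDiffBump ((a + b) / 2 : ℝ) :=
    ⟨(b - a) / 8, (b - a) / 4, by linarith, by linarith⟩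
  refine ⟨bump.normed volume, ⟨bump.contDiff_normed, bump.hasCompactSupport_normed, ?_⟩,
    bump.integral_normed⟩
  rw [bump.tsupport_normed_eq, Real.closedBall_eq_Icc]
  rintro s ⟨hl, hr⟩
  change (a + b) / 2 - (b - a) / 4 ≤ s at hl
  change s ≤ (a + b) / 2 + (b - a) / 4 at hr
  constructor <;> linarith

lemma integral_deriv_mul_primitive (hφ : IsTestFunction a b φ) (hab : a ≤ b) {g : ℝ → ℝ}
    (hg : Integrable g (leb a b)) :
    ∫ s, deriv φ s * (∫ r in a..s, g r) ∂(leb a b) = -∫ s, φ s * g s ∂(leb a b) := by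
  have hgi := intervalIntegrable_of_leb hg le_rfl hab le_rfl
  have hφ_ac : AbsolutelyContinuousOnInterval φ a b :=
    (hφ.contDiff.of_le (by simp)).contDiffOn.absolutelyContinuousOnInterval
  have hG_ac : AbsolutelyContinuousOnInterval (fun x => ∫ s in a..x, g s) a b :=
    hgi.absolutelyContinuousOnInterval_intervalIntegral left_mem_uIcc
  have by_parts := hφ_ac.integral_mul_deriv_eq_deriv_mul hG_ac
  have hderiv : ∫ s in a..b, φ s * deriv (fun x => ∫ s in a..x, g s) s
      = ∫ s in a..b, φ s * g s := by
    refine intervalIntegral.integral_congr_ae ?_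
    filter_upwards [hgi.ae_hasDerivAt_integral] with s hs hs'
    rw [(hs (uIoc_subset_uIcc hs') a (by simp)).deriv]
  rw [hφ.apply_left, hφ.apply_right, hderiv] at by_parts
  rw [← intervalIntegral_eq_integral_leb hab, ← intervalIntegral_eq_integral_leb hab]
  linarith

lemma integral_deriv_smul_primitive [CompleteSpace E] (hφ : IsTestFunction a b φ) (hab : a ≤ b)
    {g : ℝ → E} (hg : Integrable g (leb a b)) :
    ∫ s, deriv φ s • (∫ r in a..s, g r) ∂(leb a b) = -∫ s, φ s • g s ∂(leb a b) := by
  refine (SeparatingDual.eq_iff_forall_dual_eq (R := ℝ)).2 fun ℓ => ?_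
  have hG := integrable_leb_of_continuousOn (continuousOn_primitive hab hg)
  rw [map_neg, ← ℓ.integral_comp_comm (hφ.integrable_smul hg),
    ← ℓ.integral_comp_comm (hφ.deriv.integrable_smul hG)]
  simp only [map_smul, smul_eq_mul]
  rw [← hφ.integral_deriv_mul_primitive hab (ℓ.integrable_comp hg)]
  refine integral_congr_ae ?_
  filter_upwards [ae_restrict_mem measurableSet_Ioo] with s hs
  rw [← ℓ.intervalIntegral_comp_comm (intervalIntegrable_of_leb hg le_rfl hs.1.le hs.2.le)]

lemma integral_deriv_smul_const [CompleteSpace E] (hφ : IsTestFunction a b φ) (hab : a ≤ b)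
    (c : E) : ∫ s, deriv φ s • c ∂(leb a b) = 0 := by
  rw [integral_smul_const, ← intervalIntegral_eq_integral_leb hab,
    intervalIntegral.integral_deriv_eq_sub (fun x _ => hφ.contDiff.differentiable (by simp) x)
      (hφ.deriv.contDiff.continuous.intervalIntegrable _ _),
    hφ.apply_left, hφ.apply_right, sub_self, zero_smul]

end IsTestFunction

section WeakDeriv

variable {E : Type*} [NormedAddCommGroup E] [NormedSpace ℝ E] {a b : ℝ} {f f' g g' : ℝ → E}

lemma isWeakDeriv_iff : IsWeakDeriv a b f g ↔ ∀ φ : ℝ → ℝ, IsTestFunction a b φ →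
    ∫ s, deriv φ s • f s ∂(leb a b) = -∫ s, φ s • g s ∂(leb a b) :=
  ⟨fun h φ hφ => h φ hφ.1 hφ.2 hφ.3, fun h φ h₁ h₂ h₃ => h φ ⟨h₁, h₂, h₃⟩⟩

lemma IsWeakDeriv.congr (h : IsWeakDeriv a b f g) (hf : f =ᵐ[leb a b] f')
    (hg : g =ᵐ[leb a b] g') : IsWeakDeriv a b f' g' := by
  intro φ h₁ h₂ h₃
  have hf' : (fun s => deriv φ s • f s) =ᵐ[leb a b] fun s => deriv φ s • f' s :=
    hf.mono fun s hs => by simp only [hs]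
  have hg' : (fun s => φ s • g s) =ᵐ[leb a b] fun s => φ s • g' s :=
    hg.mono fun s hs => by simp only [hs]
  rw [← integral_congr_ae hf', ← integral_congr_ae hg', h φ h₁ h₂ h₃]

lemma IsWeakDeriv.sub (h : IsWeakDeriv a b f g) (h' : IsWeakDeriv a b f' g')
    (hf : Integrable f (leb a b)) (hf' : Integrable f' (leb a b)) (hg : Integrable g (leb a b))
    (hg' : Integrable g' (leb a b)) : IsWeakDeriv a b (f - f') (g - g') := by
  refine isWeakDeriv_iff.2 fun φ hφ => ?_
  simp only [Pi.sub_apply, smul_sub]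
  rw [integral_sub (hφ.deriv.integrable_smul hf) (hφ.deriv.integrable_smul hf'),
    integral_sub (hφ.integrable_smul hg) (hφ.integrable_smul hg'), isWeakDeriv_iff.1 h φ hφ,
    isWeakDeriv_iff.1 h' φ hφ]
  abel

-- The test function `φ - (∫ φ) ψ` has integral zero, hence is the derivative of a test function.
lemma IsWeakDeriv.integral_smul_eq (hf : Integrable f (leb a b)) (h : IsWeakDeriv a b f 0)
    (hab : a < b) {φ ψ : ℝ → ℝ} (hφ : IsTestFunction a b φ) (hψ : IsTestFunction a b ψ)
    (hψ_int : ∫ s, ψ s = 1) :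
    ∫ s, φ s • f s ∂(leb a b) = (∫ s, φ s) • ∫ s, ψ s • f s ∂(leb a b) := by
  have hint : ∫ s, (φ s - (∫ r, φ r) * ψ s) = 0 := by
    rw [integral_sub hφ.integrable (hψ.integrable.const_mul _), integral_const_mul, hψ_int,
      mul_one, sub_self]
  obtain ⟨Φ, hΦ, hderiv⟩ := (hφ.sub_const_mul hψ _).exists_deriv_eq hab hint
  have hzero := isWeakDeriv_iff.1 h Φ hΦ
  simp only [hderiv, sub_smul, mul_smul, Pi.zero_apply, smul_zero, integral_zero,
    neg_zero] at hzero
  rwa [integral_sub (hφ.integrable_smul hf) ((hψ.integrable_smul hf).fun_smul _), integral_smul,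
    sub_eq_zero] at hzero

variable [CompleteSpace E]

lemma isWeakDeriv_primitive (hab : a ≤ b) (hg : Integrable g (leb a b)) (c : E) :
    IsWeakDeriv a b (fun t => c + ∫ s in a..t, g s) g := by
  refine isWeakDeriv_iff.2 fun φ hφ => ?_
  have hG := integrable_leb_of_continuousOn (continuousOn_primitive hab hg)
  simp only [smul_add]
  rw [integral_add (hφ.deriv.integrable_smul (integrable_const c)) (hφ.deriv.integrable_smul hG),
    hφ.integral_deriv_smul_const hab, zero_add, hφ.integral_deriv_smul_primitive hab hg]

lemma IsWeakDeriv.ae_eq_const (hf : Integrable f (leb a b)) (h : IsWeakDeriv a b f 0)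
    (hab : a < b) : ∃ K : E, f =ᵐ[leb a b] fun _ => K := by
  obtain ⟨ψ, hψ, hψ_int⟩ := IsTestFunction.exists_integral_eq_one hab
  set K : E := ∫ s, ψ s • f s ∂(leb a b)
  refine ⟨K, ?_⟩
  have hae : ∀ᵐ s, s ∈ Ioo a b → f s - K = 0 := by
    refine isOpen_Ioo.ae_eq_zero_of_integral_contDiff_smul_eq_zero
      (IntegrableOn.locallyIntegrableOn (hf.sub (integrable_const K))) fun φ h₁ h₂ h₃ => ?_
    have hφ : IsTestFunction a b φ := ⟨h₁, h₂, h₃⟩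
    have hφK : ∫ s, φ s • K ∂(leb a b) = (∫ s, φ s) • K := by
      rw [hφ.integral_smul_leb, integral_smul_const]
    rw [← hφ.integral_smul_leb]
    simp only [smul_sub]
    rw [integral_sub (hφ.integrable_smul hf) (hφ.integrable_smul (integrable_const K)), hφK,
      h.integral_smul_eq hf hab hφ hψ hψ_int, sub_self]
  rw [Filter.EventuallyEq, ae_restrict_iff' measurableSet_Ioo]
  filter_upwards [hae] with s hs hmem
  exact sub_eq_zero.1 (hs hmem)

lemma IsWeakDeriv.ae_eq_primitive (h : IsWeakDeriv a b f g) (hab : a < b)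
    (hf : Integrable f (leb a b)) (hg : Integrable g (leb a b)) {e : E}
    (he : HasValueAt a b f a e) : f =ᵐ[leb a b] fun t => e + ∫ s in a..t, g s := by
  obtain ⟨r, hr, hfr, rfl⟩ := he
  have hG := continuousOn_primitive hab.le hg
  have hF : Integrable (fun t => r a + ∫ s in a..t, g s) (leb a b) :=
    (integrable_const _).add (integrable_leb_of_continuousOn hG)
  have hzero := h.sub (isWeakDeriv_primitive hab.le hg (r a)) hf hF hg hg
  rw [sub_self] at hzero
  obtain ⟨K, hK⟩ := hzero.ae_eq_const (hf.sub hF) hab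
  have hrK : EqOn r (fun t => K + (r a + ∫ s in a..t, g s)) (Icc a b) := by
    refine Measure.eqOn_Icc_of_ae_eq volume hab.ne ?_ hr
      (continuousOn_const.add (continuousOn_const.add hG))
    rw [← restrict_Ioo_eq_restrict_Icc]
    filter_upwards [hfr, hK] with t ht htK
    rw [← ht, ← htK, Pi.sub_apply, sub_add_cancel]
  have hK0 : K = 0 := by simpa using hrK (left_mem_Icc.2 hab.le)
  filter_upwards [hK] with t ht
  rwa [hK0, Pi.sub_apply, sub_eq_zero] at ht

end WeakDeriv

instance : IsProbabilityMeasure (leb 0 1) := ⟨by simp [leb]⟩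

lemma inner_L2 (f g : L2) : inner ℝ f g = ∫ x, (f : ℝ → ℝ) x * (g : ℝ → ℝ) x ∂(leb 0 1) := by
  rw [L2.inner_def]
  exact integral_congr_ae (.of_forall fun x => mul_comm _ _)

namespace H1Zero

lemma dx_surjective : Function.Surjective dx := by
  intro g
  have hg : Integrable (g : ℝ → ℝ) (leb 0 1) := L2.integrable g
  have hcont := continuousOn_primitive zero_le_one hg
  obtain ⟨M, hM⟩ := isCompact_Icc.exists_bound_of_continuousOn hcont
  have hmem : MemLp (fun x => ∫ s in (0 : ℝ)..x, (g : ℝ → ℝ) s) 2 (leb 0 1) := by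
    refine .of_bound
      ((hcont.mono Ioo_subset_Icc_self).aestronglyMeasurable measurableSet_Ioo) M ?_
    filter_upwards [ae_restrict_mem measurableSet_Ioo] with x hx
    exact hM x (Ioo_subset_Icc_self hx)
  refine ⟨(⟨(hmem.toLp _, g), ?_, _, hcont, hmem.coeFn_toLp, by simp⟩ : h1ZeroGraph), rfl⟩
  refine (isWeakDeriv_primitive zero_le_one hg 0).congr ?_ (ae_eq_refl _)
  filter_upwards [hmem.coeFn_toLp] with x hx
  rw [hx, zero_add]

/-- The isometry `∂ₓ : H¹_{(0)}(Ω) → L²(Ω)`, through which elements of `H¹_{(0)}(Ω)` are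
constructed from their derivatives. -/
def dxEquiv : H1Zero ≃ₗᵢ[ℝ] L2 where
  toLinearEquiv := LinearEquiv.ofBijective dx ⟨dx_injective, dx_surjective⟩
  norm_map' _ := rfl

@[simp] lemma dx_dxEquiv_symm (g : L2) : dx (dxEquiv.symm g) = g := dxEquiv.apply_symm_apply g

instance : CompleteSpace H1Zero :=
  (completeSpace_congr (e := dxEquiv.toEquiv) dxEquiv.isometry.isUniformEmbedding).2 inferInstance

/-- The inclusion `H¹_{(0)}(Ω) → L²(Ω)` as a continuous linear map. -/
def toL2L : H1Zero →L[ℝ] L2 :=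
  LinearMap.mkContinuous toL2 1 fun z => by rw [one_mul]; exact norm_toL2_le z

@[simp] lemma toL2L_apply (z : H1Zero) : toL2L z = toL2 z := rfl

lemma inner_eq (y z : H1Zero) : inner ℝ y z = inner ℝ (dx y) (dx z) := rfl

lemma rep_one_eq (z : H1Zero) : z.rep 1 = ∫ s, (dx z : ℝ → ℝ) s ∂(leb 0 1) := by
  rw [rep_eq_integral z (by simp), intervalIntegral_eq_integral_leb zero_le_one]

/-- The trace `z ↦ z(1)`, as the pairing of `∂ₓ z` with the constant `1`; it carries the boundary
control in the weak formulation. -/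
def evalOne : Hm1 :=
  innerSL ℝ (indicatorConstLp 2 MeasurableSet.univ (measure_ne_top (leb 0 1) univ) (1 : ℝ)) ∘L
    (dxEquiv : H1Zero →L[ℝ] L2)

@[simp] lemma evalOne_apply (z : H1Zero) : evalOne z = z.rep 1 := by
  rw [rep_one_eq]
  exact (L2.inner_indicatorConstLp_one _ _ (dx z)).trans (by rw [Measure.restrict_univ])

lemma continuous_rep_one : Continuous fun z : H1Zero => z.rep 1 :=
  evalOne.continuous.congr evalOne_apply

end H1Zero

@[simp] lemma toHm1_apply (w : L2) (z : H1Zero) : toHm1 w z = inner ℝ w z.toL2 := rfl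

/-- The space `L²(ℝ)` of profiles `h`: a d'Alembert solution `y` of the wave equation is encoded by
the `h` with `∂ₓy = (h(t + x) + h(t - x)) / 2` and `∂ₜy = (h(t + x) - h(t - x)) / 2`. -/
abbrev LineL2 : Type := Lp ℝ 2 (volume : Measure ℝ)

namespace LineL2

lemma intervalIntegrable (h : LineL2) (a b : ℝ) :
    IntervalIntegrable (h : ℝ → ℝ) volume a b := by
  rw [intervalIntegrable_iff]
  exact (((Lp.memLp h).locallyIntegrable (by norm_num)).integrableOn_isCompact
    (isCompact_uIcc (a := a) (b := b))).mono_set uIoc_subset_uIcc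

/-- The translation `h ↦ h(· + t)`, which is the time evolution of profiles. -/
def shift (t : ℝ) : LineL2 →ₗᵢ[ℝ] LineL2 :=
  Lp.compMeasurePreservingₗᵢ ℝ (fun x => x + t) (measurePreserving_add_right volume t)

/-- The reflection `h ↦ h(-·)`, which expresses the left- and right-moving parts of a wave by one
profile. -/
def reflect : LineL2 →ₗᵢ[ℝ] LineL2 :=
  Lp.compMeasurePreservingₗᵢ ℝ Neg.neg (Measure.measurePreserving_neg volume)

lemma coeFn_shift (t : ℝ) (h : LineL2) : shift t h =ᵐ[volume] fun x => (h : ℝ → ℝ) (x + t) :=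
  Lp.coeFn_compMeasurePreserving h (measurePreserving_add_right volume t)

lemma coeFn_reflect (h : LineL2) : reflect h =ᵐ[volume] fun x => (h : ℝ → ℝ) (-x) :=
  Lp.coeFn_compMeasurePreserving h (Measure.measurePreserving_neg volume)

lemma ae_comp_add {p : ℝ → Prop} (hp : ∀ᵐ x, p x) (t : ℝ) : ∀ᵐ x, p (x + t) :=
  (measurePreserving_add_right volume t).quasiMeasurePreserving.ae hp

lemma ae_comp_neg {p : ℝ → Prop} (hp : ∀ᵐ x, p x) : ∀ᵐ x, p (-x) :=
  (Measure.measurePreserving_neg (volume : Measure ℝ)).quasiMeasurePreserving.ae hp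

lemma shift_shift (s t : ℝ) (h : LineL2) : shift s (shift t h) = shift (s + t) h := by
  refine Lp.ext ?_
  filter_upwards [coeFn_shift s (shift t h), coeFn_shift (s + t) h, ae_comp_add (coeFn_shift t h) s]
    with x hst hadd ht
  rw [hst, hadd, ht, add_assoc]

@[simp] lemma shift_zero (h : LineL2) : shift 0 h = h := by
  refine Lp.ext ?_
  filter_upwards [coeFn_shift 0 h] with x hx
  rw [hx, add_zero]

@[simp] lemma reflect_reflect (h : LineL2) : reflect (reflect h) = h := by
  refine Lp.ext ?_
  filter_upwards [coeFn_reflect (reflect h), ae_comp_neg (coeFn_reflect h)] with x hx hx'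
  rw [hx, hx', neg_neg]

lemma continuous_shift : Continuous fun p : ℝ × LineL2 => shift p.1 p.2 := by
  let g : ℝ × LineL2 → C(ℝ, ℝ) := fun p => ⟨fun x => x + p.1, by fun_prop⟩
  have hg : Continuous g := by
    refine ContinuousMap.continuous_of_continuous_uncurry _ ?_
    change Continuous fun q : (ℝ × LineL2) × ℝ => q.2 + q.1.1
    fun_prop
  exact continuous_snd.compMeasurePreservingLp hg
    (fun p => measurePreserving_add_right volume p.1) (by norm_num)

/-- Restriction of a profile to `Ω`. -/
def restr : LineL2 →L[ℝ] L2 := LpToLpRestrictCLM ℝ ℝ ℝ volume 2 (Ioo 0 1)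

lemma coeFn_restr (h : LineL2) : restr h =ᵐ[leb 0 1] h := LpToLpRestrictCLM_coeFn ℝ (Ioo 0 1) h

/-- Extension by zero from `(a, b)` to the line, as a bare function; see `zeroExtend`. -/
def zeroExtendFun (a b : ℝ) (f : Lp ℝ 2 (leb a b)) : LineL2 :=
  ((memLp_indicator_iff_restrict measurableSet_Ioo).2 (Lp.memLp f)).toLp ((Ioo a b).indicator f)

lemma coeFn_zeroExtendFun {a b : ℝ} (f : Lp ℝ 2 (leb a b)) :
    zeroExtendFun a b f =ᵐ[volume] (Ioo a b).indicator f := MemLp.coeFn_toLp _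

/-- Extension by zero from `(a, b)` to the line, used for data given on a bounded interval. -/
def zeroExtend (a b : ℝ) : Lp ℝ 2 (leb a b) →ₗᵢ[ℝ] LineL2 where
  toFun := zeroExtendFun a b
  map_add' f g := by
    have hadd := Lp.coeFn_add f g
    rw [Filter.EventuallyEq, ae_restrict_iff' measurableSet_Ioo] at hadd
    refine Lp.ext ?_
    filter_upwards [hadd, coeFn_zeroExtendFun f, coeFn_zeroExtendFun g,
      coeFn_zeroExtendFun (f + g), Lp.coeFn_add (zeroExtendFun a b f) (zeroExtendFun a b g)]
      with x hx hf hg hfg hsum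
    rw [hfg, hsum, Pi.add_apply, hf, hg]
    by_cases hm : x ∈ Ioo a b
    · simp only [indicator_of_mem hm, hx hm, Pi.add_apply]
    · simp only [indicator_of_notMem hm, add_zero]
  map_smul' c f := by
    have hsmul := Lp.coeFn_smul c f
    rw [Filter.EventuallyEq, ae_restrict_iff' measurableSet_Ioo] at hsmul
    refine Lp.ext ?_
    filter_upwards [hsmul, coeFn_zeroExtendFun f, coeFn_zeroExtendFun (c • f),
      Lp.coeFn_smul c (zeroExtendFun a b f)] with x hx hf hcf hprod
    rw [hcf, RingHom.id_apply, hprod, Pi.smul_apply, hf]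
    by_cases hm : x ∈ Ioo a b
    · simp only [indicator_of_mem hm, hx hm, Pi.smul_apply]
    · simp only [indicator_of_notMem hm, smul_zero]
  norm_map' f := by
    change ‖zeroExtendFun a b f‖ = _
    rw [zeroExtendFun, Lp.norm_toLp, eLpNorm_indicator_eq_eLpNorm_restrict measurableSet_Ioo,
      Lp.norm_def]

lemma coeFn_zeroExtend {a b : ℝ} (f : Lp ℝ 2 (leb a b)) :
    zeroExtend a b f =ᵐ[volume] (Ioo a b).indicator f := coeFn_zeroExtendFun f

lemma restr_zeroExtend (f : L2) : restr (zeroExtend 0 1 f) = f := by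
  refine Lp.ext ((coeFn_restr _).trans ?_)
  filter_upwards [ae_restrict_of_ae (coeFn_zeroExtend f), ae_restrict_mem measurableSet_Ioo]
    with x hx hmem
  rw [hx, indicator_of_mem hmem]

lemma restr_reflect_zeroExtend (f : L2) : restr (reflect (zeroExtend 0 1 f)) = 0 := by
  refine Lp.ext ((coeFn_restr _).trans (Filter.EventuallyEq.trans ?_ (Lp.coeFn_zero _ _ _).symm))
  filter_upwards [ae_restrict_of_ae (ae_comp_neg (coeFn_zeroExtend f)),
    ae_restrict_of_ae (coeFn_reflect (zeroExtend 0 1 f)), ae_restrict_mem measurableSet_Ioo]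
    with x hneg hx hmem
  rw [hx, hneg, indicator_of_notMem (fun h => by linarith [h.1, hmem.1]), Pi.zero_apply]

/-- The even part `x ↦ (h(x) + h(-x)) / 2` on `Ω`; at time `t` it is `∂ₓy` of the wave with profile
`h` translated by `t`. -/
def evenPart : LineL2 →L[ℝ] L2 :=
  (1 / 2 : ℝ) • (restr ∘L (ContinuousLinearMap.id ℝ LineL2 + reflect.toContinuousLinearMap))

/-- The odd part `x ↦ (h(x) - h(-x)) / 2` on `Ω`; at time `t` it is `∂ₜy` of the wave with profile
`h` translated by `t`. -/
def oddPart : LineL2 →L[ℝ] L2 :=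
  (1 / 2 : ℝ) • (restr ∘L (ContinuousLinearMap.id ℝ LineL2 - reflect.toContinuousLinearMap))

lemma evenPart_apply (h : LineL2) : evenPart h = (1 / 2 : ℝ) • (restr h + restr (reflect h)) := by
  simp [evenPart]

lemma oddPart_apply (h : LineL2) : oddPart h = (1 / 2 : ℝ) • (restr h - restr (reflect h)) := by
  simp [oddPart]

lemma coeFn_evenPart_shift (t : ℝ) (h : LineL2) : evenPart (shift t h) =ᵐ[leb 0 1]
    fun x => ((h : ℝ → ℝ) (x + t) + (h : ℝ → ℝ) (-x + t)) / 2 := by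
  rw [evenPart_apply]
  filter_upwards [Lp.coeFn_smul (1 / 2 : ℝ) (restr (shift t h) + restr (reflect (shift t h))),
    Lp.coeFn_add (restr (shift t h)) (restr (reflect (shift t h))), coeFn_restr (shift t h),
    coeFn_restr (reflect (shift t h)), ae_restrict_of_ae (coeFn_shift t h),
    ae_restrict_of_ae (coeFn_reflect (shift t h)),
    ae_restrict_of_ae (ae_comp_neg (coeFn_shift t h))]
    with x hsmul hadd hres hres' hshift hrefl hneg
  rw [hsmul, Pi.smul_apply, hadd, Pi.add_apply, hres, hres', hshift, hrefl, hneg, smul_eq_mul]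
  ring

lemma coeFn_oddPart_shift (t : ℝ) (h : LineL2) : oddPart (shift t h) =ᵐ[leb 0 1]
    fun x => ((h : ℝ → ℝ) (x + t) - (h : ℝ → ℝ) (-x + t)) / 2 := by
  rw [oddPart_apply]
  filter_upwards [Lp.coeFn_smul (1 / 2 : ℝ) (restr (shift t h) - restr (reflect (shift t h))),
    Lp.coeFn_sub (restr (shift t h)) (restr (reflect (shift t h))), coeFn_restr (shift t h),
    coeFn_restr (reflect (shift t h)), ae_restrict_of_ae (coeFn_shift t h),
    ae_restrict_of_ae (coeFn_reflect (shift t h)),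
    ae_restrict_of_ae (ae_comp_neg (coeFn_shift t h))]
    with x hsmul hsub hres hres' hshift hrefl hneg
  rw [hsmul, Pi.smul_apply, hsub, Pi.sub_apply, hres, hres', hshift, hrefl, hneg, smul_eq_mul]
  ring

/-- The odd extension to the line, vanishing off `(-1, 1)`: the profile of a wave of zero slope
with velocity `g`. -/
def oddExt : L2 →L[ℝ] LineL2 :=
  (ContinuousLinearMap.id ℝ LineL2 - reflect.toContinuousLinearMap) ∘L
    (zeroExtend 0 1).toContinuousLinearMap

/-- The even extension to the line, vanishing off `(-1, 1)`: the profile of a wave of zero velocity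
with slope `g`. -/
def evenExt : L2 →L[ℝ] LineL2 :=
  (ContinuousLinearMap.id ℝ LineL2 + reflect.toContinuousLinearMap) ∘L
    (zeroExtend 0 1).toContinuousLinearMap

lemma oddExt_apply (g : L2) : oddExt g = zeroExtend 0 1 g - reflect (zeroExtend 0 1 g) := rfl

lemma evenExt_apply (g : L2) : evenExt g = zeroExtend 0 1 g + reflect (zeroExtend 0 1 g) := rfl

@[simp] lemma oddPart_oddExt (g : L2) : oddPart (oddExt g) = g := by
  rw [oddPart_apply, oddExt_apply]
  simp only [map_sub, reflect_reflect, restr_zeroExtend, restr_reflect_zeroExtend]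
  rw [sub_zero, zero_sub, sub_neg_eq_add, ← two_smul ℝ g, smul_smul]
  norm_num

@[simp] lemma evenPart_oddExt (g : L2) : evenPart (oddExt g) = 0 := by
  rw [evenPart_apply, oddExt_apply]
  simp only [map_sub, reflect_reflect, restr_zeroExtend, restr_reflect_zeroExtend, sub_zero,
    zero_sub, add_neg_cancel, smul_zero]

@[simp] lemma evenPart_evenExt (g : L2) : evenPart (evenExt g) = g := by
  rw [evenPart_apply, evenExt_apply]
  simp only [map_add, reflect_reflect, restr_zeroExtend, restr_reflect_zeroExtend]
  rw [add_zero, zero_add, ← two_smul ℝ g, smul_smul]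
  norm_num

@[simp] lemma oddPart_evenExt (g : L2) : oddPart (evenExt g) = 0 := by
  rw [oddPart_apply, evenExt_apply]
  simp only [map_add, reflect_reflect, restr_zeroExtend, restr_reflect_zeroExtend, add_zero,
    zero_add, sub_self, smul_zero]

lemma norm_oddExt_le (g : L2) : ‖oddExt g‖ ≤ 2 * ‖g‖ := by
  rw [oddExt_apply]
  refine (norm_sub_le _ _).trans ?_
  simp only [LinearIsometry.norm_map]
  linarith

lemma norm_evenExt_le (g : L2) : ‖evenExt g‖ ≤ 2 * ‖g‖ := by
  rw [evenExt_apply]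
  refine (norm_add_le _ _).trans ?_
  simp only [LinearIsometry.norm_map]
  linarith

lemma zeroExtend_ae_eq_zero (g : L2) :
    ∀ᵐ x, x ∉ Ioo (-1 : ℝ) 1 → (zeroExtend 0 1 g : ℝ → ℝ) x = 0 ∧
      (reflect (zeroExtend 0 1 g) : ℝ → ℝ) x = 0 := by
  filter_upwards [coeFn_zeroExtend g, coeFn_reflect (zeroExtend 0 1 g),
    ae_comp_neg (coeFn_zeroExtend g)] with x hext hrefl hneg hx
  rw [hext, hrefl, hneg, indicator_of_notMem, indicator_of_notMem]
  · exact ⟨rfl, rfl⟩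
  · exact fun h => hx ⟨by linarith [h.2], by linarith [h.1]⟩
  · exact fun h => hx ⟨by linarith [h.1], by linarith [h.2]⟩

lemma oddExt_ae_eq_zero (g : L2) : ∀ᵐ x, x ∉ Ioo (-1 : ℝ) 1 → (oddExt g : ℝ → ℝ) x = 0 := by
  rw [oddExt_apply]
  filter_upwards [zeroExtend_ae_eq_zero g,
    Lp.coeFn_sub (zeroExtend 0 1 g) (reflect (zeroExtend 0 1 g))] with x hzero hsub hx
  rw [hsub, Pi.sub_apply, (hzero hx).1, (hzero hx).2, sub_zero]

lemma evenExt_ae_eq_zero (g : L2) : ∀ᵐ x, x ∉ Ioo (-1 : ℝ) 1 → (evenExt g : ℝ → ℝ) x = 0 := by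
  rw [evenExt_apply]
  filter_upwards [zeroExtend_ae_eq_zero g,
    Lp.coeFn_add (zeroExtend 0 1 g) (reflect (zeroExtend 0 1 g))] with x hzero hadd hx
  rw [hadd, Pi.add_apply, (hzero hx).1, (hzero hx).2, add_zero]

end LineL2

lemma integral_mul_primitive_add {a b : ℝ} {f g : ℝ → ℝ}
    (hf : IntervalIntegrable f volume a b) (hg : IntervalIntegrable g volume a b) (c d : ℝ) :
    ∫ x in a..b, (f x * (d + ∫ s in a..x, g s) + (c + ∫ s in a..x, f s) * g x)
      = (c + ∫ s in a..b, f s) * (d + ∫ s in a..b, g s) - c * d := by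
  have absCont {f : ℝ → ℝ} (hf : IntervalIntegrable f volume a b) (c : ℝ) :
      AbsolutelyContinuousOnInterval (fun x => c + ∫ s in a..x, f s) a b :=
    contDiff_const.contDiffOn.absolutelyContinuousOnInterval.add
      (hf.absolutelyContinuousOnInterval_intervalIntegral (by simp))
  have by_parts := (absCont hf c).integral_deriv_mul_eq_sub (absCont hg d)
  simp only [intervalIntegral.integral_same, add_zero] at by_parts
  rw [← by_parts]
  refine intervalIntegral.integral_congr_ae ?_
  filter_upwards [hf.ae_hasDerivAt_integral, hg.ae_hasDerivAt_integral] with s hfs hgs hs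
  rw [((hfs (uIoc_subset_uIcc hs) a (by simp)).const_add c).deriv,
    ((hgs (uIoc_subset_uIcc hs) a (by simp)).const_add d).deriv]

lemma L2.intervalIntegrable (w : L2) : IntervalIntegrable (w : ℝ → ℝ) volume 0 1 :=
  intervalIntegrable_of_leb (L2.integrable w) le_rfl zero_le_one le_rfl

lemma L2.integrable_continuous_mul (w : L2) {F : ℝ → ℝ} (hF : Continuous F) :
    Integrable (fun x => F x * (w : ℝ → ℝ) x) (leb 0 1) :=
  (intervalIntegrable_iff_integrableOn_Ioo_of_le zero_le_one).1
    (w.intervalIntegrable.continuousOn_mul hF.continuousOn)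

namespace LineL2

/-- The primitive of a profile vanishing at `0`; differences of its values are integrals of the
profile along characteristics. -/
def primitive (h : LineL2) (x : ℝ) : ℝ := ∫ r in (0 : ℝ)..x, (h : ℝ → ℝ) r

lemma primitive_sub (h : LineL2) (a b : ℝ) :
    h.primitive b - h.primitive a = ∫ r in a..b, (h : ℝ → ℝ) r :=
  intervalIntegral.integral_interval_sub_left (h.intervalIntegrable _ _) (h.intervalIntegrable _ _)

lemma continuous_primitive (h : LineL2) : Continuous h.primitive :=
  intervalIntegral.continuous_primitive h.intervalIntegrable 0

lemma intervalIntegrable_comp_add (h : LineL2) (t a b : ℝ) :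
    IntervalIntegrable (fun x => (h : ℝ → ℝ) (x + t)) volume a b := by
  simpa only [add_sub_cancel_right] using (h.intervalIntegrable (a + t) (b + t)).comp_add_right t

lemma intervalIntegrable_comp_neg_add (h : LineL2) (t a b : ℝ) :
    IntervalIntegrable (fun x => (h : ℝ → ℝ) (-x + t)) volume a b := by
  simpa only [sub_sub_cancel, neg_add_eq_sub] using
    (h.intervalIntegrable (t - a) (t - b)).comp_sub_left t

lemma integral_comp_add (h : LineL2) (t a b : ℝ) :
    ∫ x in a..b, (h : ℝ → ℝ) (x + t) = h.primitive (b + t) - h.primitive (a + t) := by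
  rw [intervalIntegral.integral_comp_add_right (fun x => (h : ℝ → ℝ) x), primitive_sub]

lemma integral_comp_neg_add (h : LineL2) (t a b : ℝ) :
    ∫ x in a..b, (h : ℝ → ℝ) (-x + t) = h.primitive (-a + t) - h.primitive (-b + t) := by
  simp only [neg_add_eq_sub]
  rw [intervalIntegral.integral_comp_sub_left (fun x => (h : ℝ → ℝ) x), primitive_sub]

/-- The pairing over `Ω` of `w` with `f` restricted to the characteristics `x ↦ c x + t` (where
`c = ±1`), through which the weak form of the wave equation is computed. -/
def charPairing (f : ℝ → ℝ) (w : L2) (c t : ℝ) : ℝ :=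
  ∫ x, f (c * x + t) * (w : ℝ → ℝ) x ∂(leb 0 1)

lemma integral_norm_comp_add_le (h : LineL2) {a s t : ℝ} (ha : |a| ≤ 1) (hst : s ≤ t) :
    ∫ r in Ioc s t, ‖(h : ℝ → ℝ) (a + r)‖ ≤ ∫ r in (s - 1)..(t + 1), ‖(h : ℝ → ℝ) r‖ := by
  rw [← intervalIntegral.integral_of_le hst,
    intervalIntegral.integral_comp_add_left (fun r => ‖(h : ℝ → ℝ) r‖)]
  exact intervalIntegral.integral_mono_interval (by linarith [(abs_le.1 ha).1]) (by linarith)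
    (by linarith [(abs_le.1 ha).2]) (.of_forall fun _ => norm_nonneg _)
    (h.intervalIntegrable _ _).norm

lemma integrable_strip (h : LineL2) (w : L2) {c : ℝ} (hc : |c| ≤ 1) {s t : ℝ} (hst : s ≤ t) :
    Integrable (Function.uncurry fun x r => (h : ℝ → ℝ) (c * x + r) * (w : ℝ → ℝ) x)
      ((leb 0 1).prod (volume.restrict (Ioc s t))) := by
  have hmeas : StronglyMeasurable
      (Function.uncurry fun x r => (h : ℝ → ℝ) (c * x + r) * (w : ℝ → ℝ) x) :=
    ((Lp.stronglyMeasurable h).comp_measurable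
      ((measurable_fst.const_mul c).add measurable_snd)).mul
      ((Lp.stronglyMeasurable w).comp_measurable measurable_fst)
  rw [integrable_prod_iff hmeas.aestronglyMeasurable]
  constructor
  · refine .of_forall fun x => ?_
    have hsection := (h.intervalIntegrable_comp_add (c * x) s t).mul_const ((w : ℝ → ℝ) x)
    rw [intervalIntegrable_iff_integrableOn_Ioc_of_le hst] at hsection
    simpa only [IntegrableOn, Function.uncurry, add_comm (c * x)] using hsection
  · refine ((L2.integrable w).norm.const_mul (∫ r in (s - 1)..(t + 1), ‖(h : ℝ → ℝ) r‖)).mono'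
      hmeas.norm.integral_prod_right'.aestronglyMeasurable ?_
    filter_upwards [ae_restrict_mem measurableSet_Ioo] with x hx
    have hcx : |c * x| ≤ 1 := by
      rw [abs_mul, abs_of_pos hx.1]
      exact mul_le_one₀ hc hx.1.le hx.2.le
    rw [Real.norm_of_nonneg (integral_nonneg fun _ => norm_nonneg _)]
    simp only [Function.uncurry, norm_mul]
    rw [integral_mul_const]
    exact mul_le_mul_of_nonneg_right (h.integral_norm_comp_add_le hcx hst) (norm_nonneg _)

lemma intervalIntegrable_charPairing (h : LineL2) (w : L2) {c : ℝ} (hc : |c| ≤ 1) {s t : ℝ}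
    (hst : s ≤ t) : IntervalIntegrable (charPairing h w c) volume s t := by
  rw [intervalIntegrable_iff_integrableOn_Ioc_of_le hst]
  exact (integrable_strip h w hc hst).integral_prod_right

lemma integral_charPairing (h : LineL2) (w : L2) {c : ℝ} (hc : |c| ≤ 1) {s t : ℝ} (hst : s ≤ t) :
    ∫ r in s..t, charPairing h w c r
      = charPairing h.primitive w c t - charPairing h.primitive w c s := by
  have hint (t : ℝ) : Integrable (fun x => h.primitive (c * x + t) * (w : ℝ → ℝ) x) (leb 0 1) :=
    w.integrable_continuous_mul (h.continuous_primitive.comp (by fun_prop))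
  simp only [charPairing]
  rw [intervalIntegral.integral_of_le hst, ← integral_integral_swap (integrable_strip h w hc hst),
    ← integral_sub (hint t) (hint s)]
  refine integral_congr_ae (.of_forall fun x => ?_)
  simp only
  rw [integral_mul_const, ← intervalIntegral.integral_of_le hst, ← sub_mul, primitive_sub,
    intervalIntegral.integral_comp_add_left (fun r => (h : ℝ → ℝ) r)]

lemma integrable_section (h : LineL2) (w : L2) {c : ℝ} (hc : |c| = 1) (r : ℝ) :
    Integrable (fun x => (h : ℝ → ℝ) (c * x + r) * (w : ℝ → ℝ) x) (leb 0 1) := by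
  have hmem : MemLp (fun x => (h : ℝ → ℝ) (c * x + r)) 2 (leb 0 1) := by
    rcases eq_or_eq_neg_of_abs_eq hc with rfl | rfl
    · refine MemLp.ae_eq ?_ ((Lp.memLp (shift r h)).restrict _)
      filter_upwards [ae_restrict_of_ae (coeFn_shift r h)] with x hx
      rw [hx, one_mul]
    · refine MemLp.ae_eq ?_ ((Lp.memLp (reflect (shift r h))).restrict _)
      filter_upwards [ae_restrict_of_ae (coeFn_reflect (shift r h)),
        ae_restrict_of_ae (ae_comp_neg (coeFn_shift r h))] with x hx hx'
      rw [hx, hx', neg_one_mul]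
  exact hmem.integrable_mul (Lp.memLp w)

lemma inner_evenPart_shift (t : ℝ) (h : LineL2) (w : L2) :
    inner ℝ (evenPart (shift t h)) w = (charPairing h w 1 t + charPairing h w (-1) t) / 2 := by
  rw [inner_L2, charPairing, charPairing, ← integral_add (integrable_section h w (by simp) t)
    (integrable_section h w (by simp) t), ← integral_div]
  refine integral_congr_ae ?_
  filter_upwards [coeFn_evenPart_shift t h] with x hx
  rw [hx, one_mul, neg_one_mul]
  ring

lemma inner_oddPart_shift (t : ℝ) (h : LineL2) (w : L2) :
    inner ℝ (oddPart (shift t h)) w = (charPairing h w 1 t - charPairing h w (-1) t) / 2 := by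
  rw [inner_L2, charPairing, charPairing, ← integral_sub (integrable_section h w (by simp) t)
    (integrable_section h w (by simp) t), ← integral_div]
  refine integral_congr_ae ?_
  filter_upwards [coeFn_oddPart_shift t h] with x hx
  rw [hx, one_mul, neg_one_mul]
  ring

/-- The displacement `x ↦ ½ ∫_{-x}^x h` of the wave whose profile, translated to the current time,
is `h`; it is encoded by its space derivative. -/
def wave (h : LineL2) : H1Zero := H1Zero.dxEquiv.symm (evenPart h)

@[simp] lemma dx_wave (h : LineL2) : (wave h).dx = evenPart h := H1Zero.dx_dxEquiv_symm _

lemma rep_wave_shift (t : ℝ) (h : LineL2) {x : ℝ} (hx : x ∈ Icc (0 : ℝ) 1) :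
    (wave (shift t h)).rep x = (h.primitive (x + t) - h.primitive (-x + t)) / 2 := by
  have heven : ∫ s in (0 : ℝ)..x, (evenPart (shift t h) : ℝ → ℝ) s
      = ∫ s in (0 : ℝ)..x, ((h : ℝ → ℝ) (s + t) + (h : ℝ → ℝ) (-s + t)) / 2 := by
    rw [intervalIntegral_eq_integral_leb hx.1, intervalIntegral_eq_integral_leb hx.1]
    exact integral_congr_ae (ae_mono (Measure.restrict_mono (Ioo_subset_Ioo_right hx.2) le_rfl)
      (coeFn_evenPart_shift t h))
  rw [H1Zero.rep_eq_integral _ hx, dx_wave, heven, intervalIntegral.integral_div,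
    intervalIntegral.integral_add (h.intervalIntegrable_comp_add t 0 x)
      (h.intervalIntegrable_comp_neg_add t 0 x), integral_comp_add, integral_comp_neg_add, neg_zero,
    zero_add]
  ring

lemma inner_toL2_wave_shift (t : ℝ) (h : LineL2) (w : L2) :
    inner ℝ (wave (shift t h)).toL2 w
      = (charPairing h.primitive w 1 t - charPairing h.primitive w (-1) t) / 2 := by
  have hint (c : ℝ) : Integrable (fun x => h.primitive (c * x + t) * (w : ℝ → ℝ) x) (leb 0 1) :=
    w.integrable_continuous_mul (h.continuous_primitive.comp (by fun_prop))
  rw [inner_L2, charPairing, charPairing, ← integral_sub (hint 1) (hint (-1)), ← integral_div]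
  refine integral_congr_ae ?_
  filter_upwards [(wave (shift t h)).toL2_ae_eq_rep, ae_restrict_mem measurableSet_Ioo]
    with x hx hmem
  rw [hx, rep_wave_shift t h (Ioo_subset_Icc_self hmem), one_mul, neg_one_mul]
  ring

lemma inner_wave_sub (h : LineL2) (w : L2) {s t : ℝ} (hst : s ≤ t) :
    inner ℝ (wave (shift t h)).toL2 w - inner ℝ (wave (shift s h)).toL2 w
      = ∫ r in s..t, inner ℝ (oddPart (shift r h)) w := by
  simp only [inner_oddPart_shift]
  rw [intervalIntegral.integral_div, intervalIntegral.integral_sub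
    (intervalIntegrable_charPairing h w (by simp) hst)
    (intervalIntegrable_charPairing h w (by simp) hst), integral_charPairing h w (by simp) hst,
    integral_charPairing h w (by simp) hst, inner_toL2_wave_shift, inner_toL2_wave_shift]
  ring

-- `x ↦ H(x + t) + H(-x + t)`, with `H` the primitive of `h`, is a primitive of twice the odd part.
lemma integral_oddPart_mul_rep_add (h : LineL2) (z : H1Zero) (t : ℝ) :
    ∫ x in (0 : ℝ)..1, (((h : ℝ → ℝ) (x + t) - (h : ℝ → ℝ) (-x + t)) * z.rep x
        + (h.primitive (x + t) + h.primitive (-x + t)) * (z.dx : ℝ → ℝ) x)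
      = (h.primitive (1 + t) + h.primitive (-1 + t)) * z.rep 1 := by
  have hprim (x : ℝ) : 2 * h.primitive t
      + ∫ ξ in (0 : ℝ)..x, ((h : ℝ → ℝ) (ξ + t) - (h : ℝ → ℝ) (-ξ + t))
        = h.primitive (x + t) + h.primitive (-x + t) := by
    rw [intervalIntegral.integral_sub (h.intervalIntegrable_comp_add t 0 x)
      (h.intervalIntegrable_comp_neg_add t 0 x), integral_comp_add, integral_comp_neg_add, neg_zero,
      zero_add]
    ring
  have by_parts := integral_mul_primitive_add ((h.intervalIntegrable_comp_add t 0 1).sub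
    (h.intervalIntegrable_comp_neg_add t 0 1)) z.dx.intervalIntegrable (2 * h.primitive t) 0
  simp only [hprim, mul_zero, sub_zero, zero_add] at by_parts
  rw [z.rep_eq_integral (x := 1) (by simp), ← by_parts]
  refine intervalIntegral.integral_congr fun x hx => ?_
  rw [uIcc_of_le zero_le_one] at hx
  simp only [z.rep_eq_integral hx]

lemma inner_oddPart_shift_toL2 (h : LineL2) (z : H1Zero) (t : ℝ) :
    inner ℝ (oddPart (shift t h)) z.toL2
      = ((h.primitive (1 + t) + h.primitive (-1 + t)) * z.rep 1
        - (charPairing h.primitive z.dx 1 t + charPairing h.primitive z.dx (-1) t)) / 2 := by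
  have hint (c : ℝ) :
      Integrable (fun x => h.primitive (c * x + t) * (z.dx : ℝ → ℝ) x) (leb 0 1) :=
    z.dx.integrable_continuous_mul (h.continuous_primitive.comp (by fun_prop))
  have hint' (c : ℝ) (hc : |c| = 1) := integrable_section h z.toL2 hc t
  rw [inner_oddPart_shift, ← integral_oddPart_mul_rep_add,
    intervalIntegral_eq_integral_leb zero_le_one]
  simp only [charPairing]
  rw [← integral_sub (hint' 1 (by simp)) (hint' (-1) (by simp)),
    ← integral_add (hint 1) (hint (-1)), eq_div_iff two_ne_zero, div_mul_cancel₀ _ two_ne_zero,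
    eq_sub_iff_add_eq,
    ← integral_add (by exact (hint' 1 (by simp)).sub (hint' (-1) (by simp)))
      (by exact (hint 1).add (hint (-1)))]
  refine integral_congr_ae ?_
  filter_upwards [z.toL2_ae_eq_rep] with x hx
  simp only [hx, one_mul, neg_one_mul]
  ring

lemma integral_boundary_slope (h : LineL2) (s t : ℝ) :
    ∫ r in s..t, ((h : ℝ → ℝ) (r + 1) + (h : ℝ → ℝ) (r - 1)) / 2
      = (h.primitive (1 + t) + h.primitive (-1 + t)) / 2
        - (h.primitive (1 + s) + h.primitive (-1 + s)) / 2 := by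
  simp only [sub_eq_add_neg _ (1 : ℝ)]
  rw [intervalIntegral.integral_div, intervalIntegral.integral_add
    (h.intervalIntegrable_comp_add 1 s t) (h.intervalIntegrable_comp_add (-1) s t),
    integral_comp_add, integral_comp_add, add_comm t, add_comm s, add_comm t, add_comm s]
  ring

lemma inner_oddPart_sub (h : LineL2) (z : H1Zero) {s t : ℝ} (hst : s ≤ t) :
    inner ℝ (oddPart (shift t h)) z.toL2 - inner ℝ (oddPart (shift s h)) z.toL2
      = (∫ r in s..t, ((h : ℝ → ℝ) (r + 1) + (h : ℝ → ℝ) (r - 1)) / 2) * z.rep 1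
        - ∫ r in s..t, inner ℝ (evenPart (shift r h)) z.dx := by
  simp only [inner_evenPart_shift]
  rw [integral_boundary_slope, intervalIntegral.integral_div, intervalIntegral.integral_add
    (intervalIntegrable_charPairing h z.dx (by simp) hst)
    (intervalIntegrable_charPairing h z.dx (by simp) hst),
    integral_charPairing h z.dx (by simp) hst, integral_charPairing h z.dx (by simp) hst,
    inner_oddPart_shift_toL2, inner_oddPart_shift_toL2]
  ring

lemma rep_one_wave_sub (h : LineL2) (s t : ℝ) :
    (wave (shift t h)).rep 1 - (wave (shift s h)).rep 1
      = ∫ r in s..t, ((h : ℝ → ℝ) (r + 1) - (h : ℝ → ℝ) (r - 1)) / 2 := by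
  simp only [sub_eq_add_neg _ (1 : ℝ)]
  rw [rep_wave_shift t h (by simp), rep_wave_shift s h (by simp), intervalIntegral.integral_div,
    intervalIntegral.integral_sub (h.intervalIntegrable_comp_add 1 s t)
      (h.intervalIntegrable_comp_add (-1) s t), integral_comp_add, integral_comp_add,
    add_comm 1 t, add_comm 1 s, add_comm (-1) t, add_comm (-1) s]
  ring

end LineL2

namespace LineL2

/-- Restriction of a profile to `(-∞, a)`: by causality, the wave up to time `t` depends only on
`past (t + 1) h`. -/
def past (a : ℝ) : LineL2 →L[ℝ] Lp ℝ 2 (volume.restrict (Iio a)) :=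
  LpToLpRestrictCLM ℝ ℝ ℝ volume 2 (Iio a)

lemma coeFn_past (a : ℝ) (h : LineL2) : past a h =ᵐ[volume.restrict (Iio a)] h :=
  LpToLpRestrictCLM_coeFn ℝ (Iio a) h

lemma norm_past (a : ℝ) (h : LineL2) :
    ‖past a h‖ = (eLpNorm (h : ℝ → ℝ) 2 (volume.restrict (Iio a))).toReal := by
  rw [Lp.norm_def, eLpNorm_congr_ae (coeFn_past a h)]

lemma eLpNorm_restrict_ne_top (h : LineL2) (s : Set ℝ) :
    eLpNorm (h : ℝ → ℝ) 2 (volume.restrict s) ≠ ⊤ :=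
  ((Lp.memLp h).restrict s).2.ne

lemma norm_past_le (a : ℝ) (h : LineL2) : ‖past a h‖ ≤ ‖h‖ := norm_Lp_toLp_restrict_le (Iio a) h

lemma norm_past_mono {a b : ℝ} (hab : a ≤ b) (h : LineL2) : ‖past a h‖ ≤ ‖past b h‖ := by
  rw [norm_past, norm_past]
  exact ENNReal.toReal_mono (eLpNorm_restrict_ne_top h _)
    (eLpNorm_mono_measure _ (Measure.restrict_mono (Iio_subset_Iio hab) le_rfl))

lemma past_eq_zero_iff {a : ℝ} {h : LineL2} :
    past a h = 0 ↔ ∀ᵐ x, x < a → (h : ℝ → ℝ) x = 0 := by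
  rw [Lp.eq_zero_iff_ae_eq_zero]
  exact ⟨fun hh => (ae_restrict_iff' measurableSet_Iio).1 ((coeFn_past a h).symm.trans hh),
    fun hh => (coeFn_past a h).trans ((ae_restrict_iff' measurableSet_Iio).2 hh)⟩

lemma norm_past_shift (a t : ℝ) (h : LineL2) : ‖past a (shift t h)‖ = ‖past (a + t) h‖ := by
  rw [norm_past, norm_past, eLpNorm_congr_ae (ae_restrict_of_ae (coeFn_shift t h))]
  have hpreserving := (measurePreserving_add_right (volume : Measure ℝ) t).restrict_preimage
    (measurableSet_Iio (a := a + t))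
  rw [preimage_add_const_Iio, add_sub_cancel_right] at hpreserving
  rw [← eLpNorm_comp_measurePreserving ((Lp.memLp h).1.restrict) hpreserving]
  rfl

lemma norm_restr_le (h : LineL2) : ‖restr h‖ ≤ ‖past 1 h‖ := by
  rw [norm_past, Lp.norm_def, eLpNorm_congr_ae (coeFn_restr h)]
  exact ENNReal.toReal_mono (eLpNorm_restrict_ne_top h _)
    (eLpNorm_mono_measure _ (Measure.restrict_mono (fun x hx => hx.2) le_rfl))

lemma norm_restr_reflect_le (h : LineL2) : ‖restr (reflect h)‖ ≤ ‖past 1 h‖ := by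
  rw [norm_past, Lp.norm_def, eLpNorm_congr_ae (coeFn_restr _),
    eLpNorm_congr_ae (ae_restrict_of_ae (coeFn_reflect h))]
  have hpreserving := (Measure.measurePreserving_neg (volume : Measure ℝ)).restrict_preimage
    (measurableSet_Ioo (a := (-1 : ℝ)) (b := 0))
  have hpreimage : Neg.neg ⁻¹' Ioo (-1 : ℝ) 0 = Ioo 0 1 := by ext x; simp
  rw [hpreimage] at hpreserving
  refine ENNReal.toReal_mono (eLpNorm_restrict_ne_top h _)
    ((eLpNorm_comp_measurePreserving (Lp.memLp h).1.restrict hpreserving).le.trans ?_)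
  exact eLpNorm_mono_measure _ (Measure.restrict_mono (fun x hx => hx.2.trans one_pos) le_rfl)

lemma norm_evenPart_shift_le (t : ℝ) (h : LineL2) : ‖evenPart (shift t h)‖ ≤ ‖past (t + 1) h‖ := by
  rw [evenPart_apply, norm_smul, add_comm t 1, ← norm_past_shift]
  rw [Real.norm_of_nonneg (by norm_num)]
  linarith [norm_add_le (restr (shift t h)) (restr (reflect (shift t h))),
    norm_restr_le (shift t h), norm_restr_reflect_le (shift t h)]

lemma norm_oddPart_shift_le (t : ℝ) (h : LineL2) : ‖oddPart (shift t h)‖ ≤ ‖past (t + 1) h‖ := by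
  rw [oddPart_apply, norm_smul, add_comm t 1, ← norm_past_shift]
  rw [Real.norm_of_nonneg (by norm_num)]
  linarith [norm_sub_le (restr (shift t h)) (restr (reflect (shift t h))),
    norm_restr_le (shift t h), norm_restr_reflect_le (shift t h)]

lemma norm_wave (h : LineL2) : ‖wave h‖ = ‖evenPart h‖ := by rw [H1Zero.norm_eq, dx_wave]

lemma evenPart_eq_zero_of_past_eq_zero {h : LineL2} (hh : past 1 h = 0) : evenPart h = 0 := by
  have hle := norm_evenPart_shift_le 0 h
  rwa [zero_add, shift_zero, hh, norm_zero, norm_le_zero_iff] at hle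

lemma oddPart_eq_zero_of_past_eq_zero {h : LineL2} (hh : past 1 h = 0) : oddPart h = 0 := by
  have hle := norm_oddPart_shift_le 0 h
  rwa [zero_add, shift_zero, hh, norm_zero, norm_le_zero_iff] at hle

/-- The alternating sum `∑_{j ≤ N} (-1)^j k(· - 2j)`. It is the profile obtained from `k` after `N`
reflections at the two ends of `Ω`, with a homogeneous Neumann condition at `1`. -/
def bounce (N : ℕ) : LineL2 →L[ℝ] LineL2 :=
  ∑ j ∈ Finset.range (N + 1), (-1 : ℝ) ^ j • (shift (-(2 * j))).toContinuousLinearMap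

lemma bounce_apply (N : ℕ) (k : LineL2) :
    bounce N k = ∑ j ∈ Finset.range (N + 1), (-1 : ℝ) ^ j • shift (-(2 * j)) k := by
  simp [bounce]

lemma bounce_add_shift (N : ℕ) (k : LineL2) :
    bounce N k + shift (-2) (bounce N k) = k + (-1 : ℝ) ^ N • shift (-(2 * (N + 1 : ℝ))) k := by
  induction N with
  | zero => simp [bounce_apply]
  | succ N ih =>
    have hsucc : bounce (N + 1) k = bounce N k
        + (-1 : ℝ) ^ (N + 1) • shift (-(2 * (N + 1 : ℝ))) k := by
      rw [bounce_apply, bounce_apply, Finset.sum_range_succ _ (N + 1)]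
      push_cast
      rfl
    rw [hsucc, map_add, add_add_add_comm, ih, map_smul, shift_shift,
      show (-2 : ℝ) + -(2 * (N + 1)) = -(2 * ((N + 1 : ℕ) + 1 : ℝ)) by push_cast; ring, pow_succ]
    module

lemma norm_past_bounce_le (N : ℕ) (a : ℝ) (k : LineL2) :
    ‖past a (bounce N k)‖ ≤ (N + 1) * ‖past a k‖ := by
  rw [bounce_apply, map_sum]
  refine (norm_sum_le_of_le (f := fun j : ℕ => past a ((-1 : ℝ) ^ j • shift (-(2 * j)) k)) _
    (n := fun _ => ‖past a k‖) fun j _ => ?_).trans (by simp)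
  rw [map_smul, norm_smul, norm_pow, norm_neg, norm_one, one_pow, one_mul, norm_past_shift]
  exact norm_past_mono (by linarith [Nat.cast_nonneg (α := ℝ) j]) k

lemma norm_bounce_le (N : ℕ) (k : LineL2) : ‖bounce N k‖ ≤ (N + 1) * ‖k‖ := by
  rw [bounce_apply]
  refine (norm_sum_le_of_le (f := fun j : ℕ => (-1 : ℝ) ^ j • shift (-(2 * j)) k) _
    (n := fun _ => ‖k‖) fun j _ => ?_).trans (by simp)
  rw [norm_smul, norm_pow, norm_neg, norm_one, one_pow, one_mul, LinearIsometry.norm_map]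

lemma past_bounce_eq_zero {a : ℝ} {k : LineL2} (N : ℕ) (hk : past a k = 0) :
    past a (bounce N k) = 0 := by
  simpa only [hk, norm_zero, mul_zero, norm_le_zero_iff] using norm_past_bounce_le N a k

lemma past_shift_eq_zero {a b t : ℝ} {k : LineL2} (hk : past a k = 0) (hb : b + t ≤ a) :
    past b (shift t k) = 0 := by
  simpa only [hk, norm_zero, ← norm_past_shift, norm_le_zero_iff] using norm_past_mono hb k

-- Reflections change a profile supported in `[-1, ∞)` only from `1` on, that is, after time `0`.
lemma past_bounce_sub_eq_zero {k : LineL2} (N : ℕ) (hk : past (-1) k = 0) :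
    past 1 (bounce N k - k) = 0 := by
  have hsub : bounce N k - k = (-1 : ℝ) ^ N • shift (-(2 * (N + 1 : ℝ))) k
      - shift (-2) (bounce N k) := by
    rw [eq_sub_iff_add_eq, sub_add_eq_add_sub, bounce_add_shift]
    abel
  rw [hsub, map_sub, map_smul,
    past_shift_eq_zero hk (by linarith [Nat.cast_nonneg (α := ℝ) N]),
    past_shift_eq_zero (past_bounce_eq_zero N hk) (by norm_num), smul_zero, sub_zero]

lemma evenPart_bounce {k : LineL2} (N : ℕ) (hk : past (-1) k = 0) :
    evenPart (bounce N k) = evenPart k := by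
  rw [← sub_eq_zero, ← map_sub]
  exact evenPart_eq_zero_of_past_eq_zero (past_bounce_sub_eq_zero N hk)

lemma oddPart_bounce {k : LineL2} (N : ℕ) (hk : past (-1) k = 0) :
    oddPart (bounce N k) = oddPart k := by
  rw [← sub_eq_zero, ← map_sub]
  exact oddPart_eq_zero_of_past_eq_zero (past_bounce_sub_eq_zero N hk)

lemma bounce_boundary_ae {k : LineL2} (N : ℕ) (hk : past (-1) k = 0) :
    ∀ᵐ r : ℝ, r < 2 * N → (bounce N k : ℝ → ℝ) (r + 1) + (bounce N k : ℝ → ℝ) (r - 1)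
      = (k : ℝ → ℝ) (r + 1) := by
  have hlate : past (2 * N + 1) (shift (-(2 * (N + 1 : ℝ))) k) = 0 :=
    past_shift_eq_zero hk (by linarith)
  rw [past_eq_zero_iff] at hlate
  have hbounce : ∀ᵐ x : ℝ, x < 2 * N + 1 →
      (bounce N k : ℝ → ℝ) x + (bounce N k : ℝ → ℝ) (x + -2) = (k : ℝ → ℝ) x := by
    have hadd := Lp.coeFn_add (bounce N k) (shift (-2) (bounce N k))
    rw [bounce_add_shift] at hadd
    filter_upwards [hlate, hadd, coeFn_shift (-2) (bounce N k),
      Lp.coeFn_add k ((-1 : ℝ) ^ N • shift (-(2 * (N + 1 : ℝ))) k),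
      Lp.coeFn_smul ((-1 : ℝ) ^ N) (shift (-(2 * (N + 1 : ℝ))) k)]
      with x hzero hsum hshift hsum' hsmul hx
    rw [hsum', Pi.add_apply, hsmul, Pi.smul_apply, hzero hx, smul_zero, add_zero, Pi.add_apply,
      hshift] at hsum
    exact hsum.symm
  filter_upwards [ae_comp_add hbounce 1] with r hr hr'
  rw [← hr (by linarith), show r + 1 + -2 = r - 1 by ring]

lemma past_oddExt (g : L2) : past (-1) (oddExt g) = 0 := by
  rw [past_eq_zero_iff]
  filter_upwards [oddExt_ae_eq_zero g] with x hx h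
  exact hx fun h' => by linarith [h'.1]

lemma past_evenExt (g : L2) : past (-1) (evenExt g) = 0 := by
  rw [past_eq_zero_iff]
  filter_upwards [evenExt_ae_eq_zero g] with x hx h
  exact hx fun h' => by linarith [h'.1]

/-- The profile of the free wave starting from zero displacement with velocity `g`, correct for `N`
reflections; forcing terms are superpositions of such impulses. -/
def impulse (N : ℕ) : L2 →L[ℝ] LineL2 := bounce N ∘L oddExt

lemma impulse_apply (N : ℕ) (g : L2) : impulse N g = bounce N (oddExt g) := rfl

lemma norm_impulse_le (N : ℕ) (g : L2) : ‖impulse N g‖ ≤ 2 * (N + 1) * ‖g‖ := by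
  rw [impulse_apply]
  refine (norm_bounce_le N _).trans ?_
  linarith [mul_le_mul_of_nonneg_left (norm_oddExt_le g) (by positivity : (0 : ℝ) ≤ N + 1)]

@[simp] lemma evenPart_impulse (N : ℕ) (g : L2) : evenPart (impulse N g) = 0 := by
  rw [impulse_apply, evenPart_bounce N (past_oddExt g), evenPart_oddExt]

@[simp] lemma oddPart_impulse (N : ℕ) (g : L2) : oddPart (impulse N g) = g := by
  rw [impulse_apply, oddPart_bounce N (past_oddExt g), oddPart_oddExt]

lemma past_impulse (N : ℕ) (g : L2) : past (-1) (impulse N g) = 0 :=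
  past_bounce_eq_zero N (past_oddExt g)

lemma impulse_boundary_ae (N : ℕ) (g : L2) :
    ∀ᵐ r : ℝ, 0 < r → r < 2 * N →
      (impulse N g : ℝ → ℝ) (r + 1) + (impulse N g : ℝ → ℝ) (r - 1) = 0 := by
  filter_upwards [bounce_boundary_ae N (past_oddExt g), ae_comp_add (oddExt_ae_eq_zero g) 1]
    with r hbounce hodd hr hr'
  rw [impulse_apply, hbounce hr', hodd fun h => by linarith [h.2]]

/-- The profile of the wave with initial data `(u₀, u₁)` and slope `V` at `1`, correct for `N`
reflections. The factor `2` solves `(h(t + 1) + h(t - 1)) / 2 = V(t)` for `h(t + 1)`. -/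
def profile (N : ℕ) (u₀ : H1Zero) (u₁ : L2) (V : LineL2) : LineL2 :=
  bounce N (oddExt u₁ + evenExt u₀.dx + (2 : ℝ) • shift (-1) V)

section profile

variable {N : ℕ} {u₀ : H1Zero} {u₁ : L2} {V : LineL2}

lemma past_data_eq_zero (hV : past 0 V = 0) :
    past (-1) (oddExt u₁ + evenExt u₀.dx + (2 : ℝ) • shift (-1) V) = 0 := by
  rw [map_add, map_add, past_oddExt, past_evenExt, map_smul,
    past_shift_eq_zero hV (by norm_num), smul_zero, add_zero, add_zero]

lemma wave_profile (hV : past 0 V = 0) : wave (profile N u₀ u₁ V) = u₀ := by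
  apply H1Zero.dx_injective
  rw [dx_wave, profile, evenPart_bounce N (past_data_eq_zero hV), map_add, map_add, map_smul,
    evenPart_oddExt, evenPart_evenExt,
    evenPart_eq_zero_of_past_eq_zero (past_shift_eq_zero hV (by norm_num)),
    smul_zero, add_zero, zero_add]

lemma oddPart_profile (hV : past 0 V = 0) : oddPart (profile N u₀ u₁ V) = u₁ := by
  rw [profile, oddPart_bounce N (past_data_eq_zero hV), map_add, map_add, map_smul,
    oddPart_oddExt, oddPart_evenExt,
    oddPart_eq_zero_of_past_eq_zero (past_shift_eq_zero hV (by norm_num)),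
    smul_zero, add_zero, add_zero]

lemma profile_boundary_ae (hV : past 0 V = 0) :
    ∀ᵐ r : ℝ, 0 < r → r < 2 * N → (profile N u₀ u₁ V : ℝ → ℝ) (r + 1)
      + (profile N u₀ u₁ V : ℝ → ℝ) (r - 1) = 2 * (V : ℝ → ℝ) r := by
  filter_upwards [bounce_boundary_ae N (past_data_eq_zero (u₀ := u₀) (u₁ := u₁) hV),
    ae_comp_add (oddExt_ae_eq_zero u₁) 1, ae_comp_add (evenExt_ae_eq_zero u₀.dx) 1,
    ae_comp_add (coeFn_shift (-1) V) 1,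
    ae_comp_add (Lp.coeFn_add (oddExt u₁ + evenExt u₀.dx) ((2 : ℝ) • shift (-1) V)) 1,
    ae_comp_add (Lp.coeFn_add (oddExt u₁) (evenExt u₀.dx)) 1,
    ae_comp_add (Lp.coeFn_smul (2 : ℝ) (shift (-1) V)) 1]
    with r hbounce hodd heven hshift hsum hsum' hsmul hr hr'
  have hr_notMem : r + 1 ∉ Ioo (-1 : ℝ) 1 := fun h => by linarith [h.2]
  rw [profile, hbounce hr', hsum, Pi.add_apply, hsum', Pi.add_apply, hodd hr_notMem,
    heven hr_notMem, hsmul, Pi.smul_apply, hshift, add_neg_cancel_right, add_zero, zero_add,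
    smul_eq_mul]

lemma norm_past_profile_le (a : ℝ) : ‖past (a + 1) (profile N u₀ u₁ V)‖
    ≤ 2 * (N + 1) * (‖u₀‖ + ‖u₁‖ + ‖past a V‖) := by
  refine (norm_past_bounce_le N _ _).trans ?_
  have hodd : ‖past (a + 1) (oddExt u₁)‖ ≤ 2 * ‖u₁‖ :=
    (norm_past_le _ _).trans (norm_oddExt_le _)
  have heven : ‖past (a + 1) (evenExt u₀.dx)‖ ≤ 2 * ‖u₀‖ :=
    (norm_past_le _ _).trans (norm_evenExt_le _)
  have hcontrol : ‖past (a + 1) ((2 : ℝ) • shift (-1) V)‖ = 2 * ‖past a V‖ := by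
    rw [map_smul, norm_smul, norm_past_shift, add_neg_cancel_right, Real.norm_ofNat]
  have hsum : ‖past (a + 1) (oddExt u₁ + evenExt u₀.dx + (2 : ℝ) • shift (-1) V)‖
      ≤ 2 * (‖u₀‖ + ‖u₁‖ + ‖past a V‖) := by
    rw [map_add, map_add]
    refine norm_add₃_le.trans ?_
    linarith
  linarith [mul_le_mul_of_nonneg_left hsum (by positivity : (0 : ℝ) ≤ N + 1)]

end profile

end LineL2

lemma intervalIntegral_congr_ae_Ioo {X : Type*} [NormedAddCommGroup X] [NormedSpace ℝ X]
    {f g : ℝ → X} {s t : ℝ} (hst : s ≤ t) (hfg : ∀ᵐ r : ℝ, s < r → r < t → f r = g r) :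
    ∫ r in s..t, f r = ∫ r in s..t, g r := by
  rw [intervalIntegral.integral_of_le hst, intervalIntegral.integral_of_le hst,
    integral_Ioc_eq_integral_Ioo, integral_Ioc_eq_integral_Ioo]
  exact setIntegral_congr_ae measurableSet_Ioo (hfg.mono fun r hr h => hr h.1 h.2)

lemma setIntegral_Ioc_indicator_Ioi (f : ℝ → ℝ) {s t : ℝ} (hs : s ∈ Ioc 0 t) :
    ∫ r in Ioc 0 t, (Ioi s).indicator f r = ∫ r in s..t, f r := by
  rw [setIntegral_indicator measurableSet_Ioi, intervalIntegral.integral_of_le hs.2,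
    ← Ioi_inter_Iic, inter_right_comm, Ioi_inter_Ioi, sup_eq_right.2 hs.1.le, Ioi_inter_Iic]

lemma setIntegral_Ioc_indicator_Iio (f : ℝ → ℝ) {r t : ℝ} (hr : r ∈ Ioc 0 t) :
    ∫ s in Ioc 0 t, (Iio r).indicator f s = ∫ s in (0 : ℝ)..r, f s := by
  rw [setIntegral_indicator measurableSet_Iio, intervalIntegral.integral_of_le hr.1.le,
    integral_Ioc_eq_integral_Ioo]
  congr 2
  ext s
  simp only [mem_inter_iff, mem_Ioc, mem_Iio, mem_Ioo]
  exact ⟨fun h => ⟨h.1.1, h.2⟩, fun h => ⟨⟨h.1, h.2.le.trans hr.2⟩, h.2⟩⟩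

section Triangle

variable {X : Type*} [NormedAddCommGroup X] [NormedSpace ℝ X] {κ : ℝ → X} {m : ℝ → X →L[ℝ] ℝ}

lemma integrable_prod_comp_apply (hκ : Integrable κ)
    (hm : Continuous fun p : ℝ × X => m p.1 p.2) {C : ℝ} (hC : ∀ r, ‖m r‖ ≤ C) (t : ℝ) :
    Integrable (fun p : ℝ × ℝ => m p.2 (κ p.1))
      ((volume.restrict (Ioc 0 t)).prod (volume.restrict (Ioc 0 t))) := by
  have hdom : Integrable (fun p : ℝ × ℝ => C * ‖κ p.1‖)
      ((volume.restrict (Ioc 0 t)).prod (volume.restrict (Ioc 0 t))) :=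
    ((hκ.restrict (s := Ioc 0 t)).norm.comp_fst _).const_mul C
  refine hdom.mono' ?_ (Filter.Eventually.of_forall fun p => (m p.2).le_of_opNorm_le (hC _) _)
  exact hm.comp_aestronglyMeasurable
    (measurable_snd.aestronglyMeasurable.prodMk hκ.1.restrict.comp_fst)

lemma integral_triangle_swap [CompleteSpace X] (hκ : Integrable κ)
    (hm : Continuous fun p : ℝ × X => m p.1 p.2) {C : ℝ} (hC : ∀ r, ‖m r‖ ≤ C) {t : ℝ}
    (ht : 0 ≤ t) :
    IntervalIntegrable (fun s => ∫ r in s..t, m r (κ s)) volume 0 t ∧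
    ∫ s in (0 : ℝ)..t, ∫ r in s..t, m r (κ s)
      = ∫ r in (0 : ℝ)..t, m r (∫ s in (0 : ℝ)..r, κ s) := by
  set G : ℝ → ℝ → ℝ := fun s r => {p : ℝ × ℝ | p.1 < p.2}.indicator (fun p => m p.2 (κ p.1)) (s, r)
  have hG : Integrable (Function.uncurry G)
      ((volume.restrict (Ioc 0 t)).prod (volume.restrict (Ioc 0 t))) :=
    (integrable_prod_comp_apply hκ hm hC t).indicator
      (measurableSet_lt measurable_fst measurable_snd)
  have inner_left : ∀ s ∈ Ioc 0 t, ∫ r in Ioc 0 t, G s r = ∫ r in s..t, m r (κ s) :=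
    fun s hs => setIntegral_Ioc_indicator_Ioi (fun r => m r (κ s)) hs
  have inner_right : ∀ r ∈ Ioc 0 t, ∫ s in Ioc 0 t, G s r = m r (∫ s in (0 : ℝ)..r, κ s) := by
    intro r hr
    rw [← ContinuousLinearMap.intervalIntegral_comp_comm _ hκ.intervalIntegrable]
    exact setIntegral_Ioc_indicator_Iio (fun s => m r (κ s)) hr
  constructor
  · rw [intervalIntegrable_iff_integrableOn_Ioc_of_le ht]
    refine hG.integral_prod_left.congr ?_
    filter_upwards [ae_restrict_mem measurableSet_Ioc] with s hs
    exact inner_left s hs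
  · rw [intervalIntegral.integral_of_le ht, intervalIntegral.integral_of_le ht,
      ← setIntegral_congr_fun measurableSet_Ioc inner_left,
      ← setIntegral_congr_fun measurableSet_Ioc inner_right]
    exact integral_integral_swap hG

end Triangle

namespace LineL2

/-- The profile released at time `s` by the right-hand side `F` of the wave equation: by Duhamel's
principle the solution with zero data is the superposition of these impulses. -/
def source (N : ℕ) (F : ℝ → L2) (s : ℝ) : LineL2 := shift (-s) (impulse N (F s))

/-- The profile governing the solution at time `t`: the profile `h₀` of the data plus everything
released up to time `t`. -/
def history (N : ℕ) (h₀ : LineL2) (F : ℝ → L2) (t : ℝ) : LineL2 :=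
  h₀ + ∫ s in (0 : ℝ)..t, source N F s

section Duhamel

variable {N : ℕ} {h₀ : LineL2} {F : ℝ → L2}

lemma norm_source_le (s : ℝ) : ‖source N F s‖ ≤ 2 * (N + 1) * ‖F s‖ := by
  rw [source, LinearIsometry.norm_map]
  exact norm_impulse_le N (F s)

lemma aestronglyMeasurable_source {μ : Measure ℝ} (hF : AEStronglyMeasurable F μ) :
    AEStronglyMeasurable (source N F) μ := by
  have himpulse : AEStronglyMeasurable (fun s => impulse N (F s)) μ :=
    (impulse N).continuous.comp_aestronglyMeasurable hF
  have hneg : AEStronglyMeasurable (fun s : ℝ => -s) μ := continuous_neg.aestronglyMeasurable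
  have hsource := continuous_shift.comp_aestronglyMeasurable (hneg.prodMk himpulse)
  exact hsource

lemma integrable_source (hF : Integrable F) : Integrable (source N F) :=
  (hF.norm.const_mul (2 * (N + 1 : ℝ))).mono' (aestronglyMeasurable_source hF.1)
    (Filter.Eventually.of_forall fun s => norm_source_le s)

lemma continuous_history (hF : Integrable F) : Continuous (history N h₀ F) :=
  continuous_const.add (intervalIntegral.continuous_primitive
    (fun _ _ => (integrable_source hF).intervalIntegrable) 0)

@[simp] lemma history_zero : history N h₀ F 0 = h₀ := by simp [history]

lemma continuous_shift_history (hF : Integrable F) :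
    Continuous fun t => shift t (history N h₀ F t) :=
  continuous_shift.comp (continuous_id.prodMk (continuous_history hF))

lemma norm_past_history_le (hF : Integrable F) {t : ℝ} (ht : 0 ≤ t) (a : ℝ) :
    ‖past a (history N h₀ F t)‖ ≤ ‖past a h₀‖ + 2 * (N + 1) * ∫ s in (0 : ℝ)..t, ‖F s‖ := by
  rw [history, map_add]
  refine (norm_add_le _ _).trans (add_le_add_right ?_ _)
  refine (norm_past_le _ _).trans ((intervalIntegral.norm_integral_le_integral_norm ht).trans ?_)
  rw [← intervalIntegral.integral_const_mul]
  exact intervalIntegral.integral_mono_on ht (integrable_source hF).norm.intervalIntegrable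
    (hF.norm.const_mul _).intervalIntegrable fun s _ => norm_source_le s

@[simp] lemma shift_source (s : ℝ) : shift s (source N F s) = impulse N (F s) := by
  rw [source, shift_shift, add_neg_cancel, shift_zero]

lemma past_source (s : ℝ) : past (s - 1) (source N F s) = 0 :=
  past_shift_eq_zero (past_impulse N (F s)) (by linarith)

lemma source_boundary_ae (s : ℝ) : ∀ᵐ r : ℝ, s < r → r < s + 2 * N →
    (source N F s : ℝ → ℝ) (r + 1) + (source N F s : ℝ → ℝ) (r - 1) = 0 := by
  filter_upwards [ae_comp_add (impulse_boundary_ae N (F s)) (-s),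
    ae_comp_add (coeFn_shift (-s) (impulse N (F s))) 1,
    ae_comp_add (coeFn_shift (-s) (impulse N (F s))) (-1)] with r hboundary hright hleft hsr hrs
  rw [source, hright, sub_eq_add_neg r 1, hleft, add_right_comm r 1, add_right_comm r (-1),
    ← sub_eq_add_neg (r + -s)]
  exact hboundary (by linarith) (by linarith)

lemma integral_source_boundary (F : ℝ → L2) {s t : ℝ} (hs : s ∈ Ioc 0 t) (htN : t ≤ 2 * N) :
    ∫ r in s..t, ((source N F s : ℝ → ℝ) (r + 1) + (source N F s : ℝ → ℝ) (r - 1)) / 2 = 0 := by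
  rw [intervalIntegral_congr_ae_Ioo (g := fun _ => 0) hs.2, intervalIntegral.integral_zero]
  filter_upwards [source_boundary_ae (N := N) (F := F) s] with r hr hsr hrt
  rw [hr hsr (by linarith [hs.1]), zero_div]

/-- Duhamel's formula in weak form: if `ℓ` is the value at time `t` of a functional whose rate of
change along a freely propagating profile is `m r`, it picks up `c s` from each impulse. -/
lemma apply_history_eq (hF : Integrable F) {ℓ : LineL2 →L[ℝ] ℝ} {m : ℝ → LineL2 →L[ℝ] ℝ}
    (hm : Continuous fun p : ℝ × LineL2 => m p.1 p.2) {C : ℝ} (hC : ∀ r, ‖m r‖ ≤ C) {t : ℝ}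
    (ht : 0 ≤ t) {c : ℝ → ℝ} (hc : IntervalIntegrable c volume 0 t)
    (h : ∀ s ∈ Ioc 0 t, ℓ (source N F s) = c s + ∫ r in s..t, m r (source N F s)) :
    ℓ (history N h₀ F t) = ℓ h₀ + (∫ s in (0 : ℝ)..t, c s)
      + ∫ r in (0 : ℝ)..t, (m r (history N h₀ F r) - m r h₀) := by
  obtain ⟨hint, hswap⟩ := integral_triangle_swap (integrable_source (N := N) hF) hm hC ht
  rw [history, map_add,
    ← ContinuousLinearMap.intervalIntegral_comp_comm _ (integrable_source hF).intervalIntegrable,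
    intervalIntegral.integral_congr_ae (g := fun s => c s + ∫ r in s..t, m r (source N F s)),
    intervalIntegral.integral_add hc hint, hswap, add_assoc]
  · simp only [history, map_add, add_sub_cancel_left]
  · refine Filter.Eventually.of_forall fun s hs => h s ?_
    rwa [uIoc_of_le ht] at hs

/-- The solution at time `t` of the wave equation with data profile `h₀` and right-hand side `F`. -/
def displacement (N : ℕ) (h₀ : LineL2) (F : ℝ → L2) (t : ℝ) : H1Zero :=
  wave (shift t (history N h₀ F t))

/-- The time derivative at time `t` of the solution `displacement N h₀ F`. -/
def velocity (N : ℕ) (h₀ : LineL2) (F : ℝ → L2) (t : ℝ) : L2 :=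
  oddPart (shift t (history N h₀ F t))

/-- `wave` bundled as a continuous linear map, so that it commutes with integrals. -/
def waveL : LineL2 →L[ℝ] H1Zero :=
  H1Zero.dxEquiv.symm.toContinuousLinearEquiv.toContinuousLinearMap ∘L evenPart

@[simp] lemma wave_impulse (g : L2) : wave (impulse N g) = 0 :=
  H1Zero.dx_injective (by rw [dx_wave, evenPart_impulse, map_zero])

lemma continuous_displacement (hF : Integrable F) : Continuous (displacement N h₀ F) :=
  waveL.continuous.comp (continuous_shift_history hF)

lemma continuous_velocity (hF : Integrable F) : Continuous (velocity N h₀ F) :=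
  oddPart.continuous.comp (continuous_shift_history hF)

lemma norm_displacement_le (t : ℝ) :
    ‖displacement N h₀ F t‖ ≤ ‖past (t + 1) (history N h₀ F t)‖ := by
  rw [displacement, norm_wave]
  exact norm_evenPart_shift_le _ _

lemma norm_velocity_le (t : ℝ) : ‖velocity N h₀ F t‖ ≤ ‖past (t + 1) (history N h₀ F t)‖ :=
  norm_oddPart_shift_le _ _

/-- The functional `h ↦ ⟨P (h(· + r)), w⟩`, tracking a component `P` of the wave with profile `h` at
time `r` against a fixed test element `w`. -/
def testShift (P : LineL2 →L[ℝ] L2) (w : L2) (r : ℝ) : LineL2 →L[ℝ] ℝ :=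
  innerSL ℝ w ∘L P ∘L (shift r).toContinuousLinearMap

lemma testShift_apply (P : LineL2 →L[ℝ] L2) (w : L2) (r : ℝ) (h : LineL2) :
    testShift P w r h = inner ℝ (P (shift r h)) w := by
  rw [real_inner_comm]; rfl

lemma continuous_testShift (P : LineL2 →L[ℝ] L2) (w : L2) :
    Continuous fun p : ℝ × LineL2 => testShift P w p.1 p.2 :=
  (innerSL ℝ w ∘L P).continuous.comp continuous_shift

lemma norm_testShift_le (P : LineL2 →L[ℝ] L2) (w : L2) (r : ℝ) :
    ‖testShift P w r‖ ≤ ‖innerSL ℝ w ∘L P‖ := by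
  refine ContinuousLinearMap.opNorm_le_bound _ (norm_nonneg _) fun h => ?_
  refine ((innerSL ℝ w ∘L P).le_opNorm (shift r h)).trans ?_
  rw [LinearIsometry.norm_map]

lemma intervalIntegrable_testShift (P : LineL2 →L[ℝ] L2) (w : L2) {k : ℝ → LineL2}
    (hk : Continuous k) (a b : ℝ) :
    IntervalIntegrable (fun r => testShift P w r (k r)) volume a b :=
  ((continuous_testShift P w).comp (continuous_id.prodMk hk)).intervalIntegrable _ _

lemma inner_displacement (hF : Integrable F) (w : L2) {t : ℝ} (ht : 0 ≤ t) :
    inner ℝ (displacement N h₀ F t).toL2 w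
      = inner ℝ (wave h₀).toL2 w + ∫ r in (0 : ℝ)..t, inner ℝ (velocity N h₀ F r) w := by
  have h := apply_history_eq (h₀ := h₀) hF
    (ℓ := testShift (H1Zero.toL2L ∘L waveL) w t) (continuous_testShift oddPart w)
    (norm_testShift_le oddPart w) ht (c := fun _ => 0) (by simp) (by
      intro s hs
      have hsource := inner_wave_sub (source N F s) w hs.2
      rw [shift_source, wave_impulse] at hsource
      simp only [map_zero, inner_zero_left, sub_zero] at hsource
      simp only [testShift_apply, zero_add]
      exact hsource)
  have hdata := inner_wave_sub h₀ w ht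
  rw [intervalIntegral.integral_sub
    (intervalIntegrable_testShift _ _ (continuous_history hF) _ _)
    (intervalIntegrable_testShift _ _ continuous_const _ _)] at h
  simp only [testShift_apply, intervalIntegral.integral_zero, add_zero] at h
  rw [shift_zero] at hdata
  simp only [displacement, velocity]
  change inner ℝ (wave (shift t (history N h₀ F t))).toL2 w
    = inner ℝ (wave (shift t h₀)).toL2 w + _ at h
  linarith

lemma toL2_displacement (hF : Integrable F) {t : ℝ} (ht : 0 ≤ t) :
    (displacement N h₀ F t).toL2 = (wave h₀).toL2 + ∫ r in (0 : ℝ)..t, velocity N h₀ F r := by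
  refine ext_inner_right ℝ fun w => ?_
  rw [inner_displacement hF w ht, inner_add_left, real_inner_comm w (∫ r in (0 : ℝ)..t, _),
    ← innerSL_apply_apply ℝ w, ← ContinuousLinearMap.intervalIntegral_comp_comm _
      ((continuous_velocity hF).intervalIntegrable _ _)]
  simp only [innerSL_apply_apply, real_inner_comm]

lemma testShift_oddPart_source (F : ℝ → L2) (z : H1Zero) {s t : ℝ} (hs : s ∈ Ioc 0 t)
    (htN : t ≤ 2 * N) :
    testShift oddPart z.toL2 t (source N F s)
      = inner ℝ (F s) z.toL2 + ∫ r in s..t, testShift (-evenPart) z.dx r (source N F s) := by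
  have hsource := inner_oddPart_sub (source N F s) z hs.2
  rw [shift_source, oddPart_impulse, integral_source_boundary F hs htN, zero_mul] at hsource
  simp only [testShift_apply, neg_apply, inner_neg_left, intervalIntegral.integral_neg]
  linarith

lemma integral_slope_eq {t : ℝ} (ht : 0 ≤ t) (htN : t ≤ 2 * N) {V : ℝ → ℝ}
    (hV : ∀ᵐ r : ℝ, 0 < r → r < 2 * N →
      (h₀ : ℝ → ℝ) (r + 1) + (h₀ : ℝ → ℝ) (r - 1) = 2 * V r) :
    ∫ r in (0 : ℝ)..t, ((h₀ : ℝ → ℝ) (r + 1) + (h₀ : ℝ → ℝ) (r - 1)) / 2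
      = ∫ r in (0 : ℝ)..t, V r := by
  refine intervalIntegral_congr_ae_Ioo ht ?_
  filter_upwards [hV] with r hr h0r hrt
  rw [hr h0r (hrt.trans_le htN)]
  ring

lemma inner_velocity (hF : Integrable F) (z : H1Zero) {t : ℝ} (ht : 0 ≤ t) (htN : t ≤ 2 * N)
    {V : ℝ → ℝ} (hV : ∀ᵐ r : ℝ, 0 < r → r < 2 * N →
      (h₀ : ℝ → ℝ) (r + 1) + (h₀ : ℝ → ℝ) (r - 1) = 2 * V r) :
    inner ℝ (velocity N h₀ F t) z.toL2
      = inner ℝ (oddPart h₀) z.toL2 + (∫ r in (0 : ℝ)..t, V r) * z.rep 1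
        - (∫ r in (0 : ℝ)..t, inner ℝ (displacement N h₀ F r).dx z.dx)
        + ∫ r in (0 : ℝ)..t, inner ℝ (F r) z.toL2 := by
  have h := apply_history_eq (h₀ := h₀) hF
    (ℓ := testShift oddPart z.toL2 t) (continuous_testShift (-evenPart) z.dx)
    (norm_testShift_le (-evenPart) z.dx) ht (hF.inner_const _).intervalIntegrable
    fun s hs => testShift_oddPart_source F z hs htN
  have hdata := inner_oddPart_sub h₀ z ht
  rw [integral_slope_eq ht htN hV, shift_zero] at hdata
  rw [intervalIntegral.integral_sub
    (intervalIntegrable_testShift _ _ (continuous_history hF) _ _)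
    (intervalIntegrable_testShift _ _ continuous_const _ _)] at h
  simp only [testShift_apply, neg_apply, inner_neg_left, intervalIntegral.integral_neg] at h
  simp only [displacement, velocity, dx_wave]
  linarith

/-- The functional `h ↦ ∫₀ᵗ h(r - 1) dr`: the part of the trace at `x = 1` carried by the profile
incoming from the left. -/
def delayedIntegral (t : ℝ) : LineL2 →L[ℝ] ℝ :=
  innerSL ℝ (indicatorConstLp 2 (measurableSet_Ioc (a := 0) (b := t)) (by simp) (1 : ℝ)) ∘L
    (shift (-1)).toContinuousLinearMap

lemma delayedIntegral_apply {t : ℝ} (ht : 0 ≤ t) (h : LineL2) :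
    delayedIntegral t h = ∫ r in (0 : ℝ)..t, (h : ℝ → ℝ) (r - 1) := by
  change inner ℝ (indicatorConstLp 2 _ _ (1 : ℝ)) (shift (-1) h) = _
  rw [L2.inner_indicatorConstLp_one, intervalIntegral.integral_of_le ht]
  refine integral_congr_ae ?_
  filter_upwards [ae_restrict_of_ae (coeFn_shift (-1) h)] with r hr
  rw [hr, sub_eq_add_neg]

lemma delayedIntegral_eq_zero {t : ℝ} (ht : 0 ≤ t) {h : LineL2} (hh : past (t - 1) h = 0) :
    delayedIntegral t h = 0 := by
  rw [delayedIntegral_apply ht]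
  rw [intervalIntegral_congr_ae_Ioo (g := fun _ => 0) ht, intervalIntegral.integral_zero]
  filter_upwards [ae_comp_add (past_eq_zero_iff.1 hh) (-1)] with r hr _ hrt
  exact hr (by linarith)

lemma past_history_sub (hF : Integrable F) {t T : ℝ} (htT : t ≤ T) :
    past (t - 1) (history N h₀ F T - history N h₀ F t) = 0 := by
  rw [history, history, add_sub_add_left_eq_sub,
    intervalIntegral.integral_interval_sub_left (integrable_source hF).intervalIntegrable
      (integrable_source hF).intervalIntegrable,
    ← ContinuousLinearMap.intervalIntegral_comp_comm _ (integrable_source hF).intervalIntegrable]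
  refine intervalIntegral.integral_zero_ae (Filter.Eventually.of_forall fun s hs => ?_)
  rw [uIoc_of_le htT] at hs
  have hmono := norm_past_mono (by linarith [hs.1] : t - 1 ≤ s - 1) (source N F s)
  rwa [past_source, norm_zero, norm_le_zero_iff] at hmono

lemma delayedIntegral_history_eq (hF : Integrable F) {t T : ℝ} (ht : 0 ≤ t) (htT : t ≤ T) :
    delayedIntegral t (history N h₀ F T) = delayedIntegral t (history N h₀ F t) := by
  rw [← sub_eq_zero, ← map_sub]
  exact delayedIntegral_eq_zero ht (past_history_sub hF htT)

lemma intervalIntegrable_comp_sub_one (h : LineL2) (a b : ℝ) :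
    IntervalIntegrable (fun r => (h : ℝ → ℝ) (r - 1)) volume a b :=
  h.intervalIntegrable_comp_add (-1) a b

lemma integral_half_sub_eq (h : LineL2) {s t : ℝ} :
    ∫ r in s..t, ((h : ℝ → ℝ) (r + 1) - (h : ℝ → ℝ) (r - 1)) / 2
      = (∫ r in s..t, ((h : ℝ → ℝ) (r + 1) + (h : ℝ → ℝ) (r - 1)) / 2)
        - ∫ r in s..t, (h : ℝ → ℝ) (r - 1) := by
  have hsub := intervalIntegrable_comp_sub_one h s t
  rw [← intervalIntegral.integral_sub
    (((h.intervalIntegrable_comp_add 1 s t).add hsub).div_const 2) hsub]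
  refine intervalIntegral.integral_congr fun r _ => ?_
  ring

/-- The trace at `x = 1` of the wave with profile `h` at time `t`, as a functional of `h`. -/
def traceShift (t : ℝ) : LineL2 →L[ℝ] ℝ :=
  H1Zero.evalOne ∘L waveL ∘L (shift t).toContinuousLinearMap

lemma traceShift_apply (t : ℝ) (h : LineL2) : traceShift t h = (wave (shift t h)).rep 1 :=
  H1Zero.evalOne_apply _

lemma traceShift_source (F : ℝ → L2) {s t : ℝ} (hs : s ∈ Ioc 0 t) (htN : t ≤ 2 * N) :
    traceShift t (source N F s) = -delayedIntegral t (source N F s) := by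
  have htrace := rep_one_wave_sub (source N F s) s t
  rw [shift_source, wave_impulse, ← H1Zero.evalOne_apply 0, map_zero, sub_zero,
    integral_half_sub_eq, integral_source_boundary F hs htN, zero_sub] at htrace
  have hpast : ∫ r in (0 : ℝ)..s, (source N F s : ℝ → ℝ) (r - 1) = 0 := by
    rw [← delayedIntegral_apply hs.1.le]
    exact delayedIntegral_eq_zero hs.1.le (past_source s)
  rw [traceShift_apply, htrace, delayedIntegral_apply (hs.1.le.trans hs.2),
    ← intervalIntegral.integral_add_adjacent_intervals
      (intervalIntegrable_comp_sub_one _ 0 s) (intervalIntegrable_comp_sub_one _ s t),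
    hpast, zero_add]

lemma traceShift_integral_source (hF : Integrable F) {t : ℝ} (ht : 0 ≤ t) (htN : t ≤ 2 * N) :
    traceShift t (∫ s in (0 : ℝ)..t, source N F s)
      = -delayedIntegral t (∫ s in (0 : ℝ)..t, source N F s) := by
  have hsource := (integrable_source (N := N) hF).intervalIntegrable (a := 0) (b := t)
  rw [← (traceShift t).intervalIntegral_comp_comm hsource,
    ← (delayedIntegral t).intervalIntegral_comp_comm hsource, ← intervalIntegral.integral_neg]
  refine intervalIntegral.integral_congr_ae (Filter.Eventually.of_forall fun s hs => ?_)
  rw [uIoc_of_le ht] at hs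
  exact traceShift_source F hs htN

lemma rep_one_displacement (hF : Integrable F) {t T : ℝ} (ht : 0 ≤ t) (htT : t ≤ T)
    (htN : t ≤ 2 * N) {V : ℝ → ℝ} (hV : ∀ᵐ r : ℝ, 0 < r → r < 2 * N →
      (h₀ : ℝ → ℝ) (r + 1) + (h₀ : ℝ → ℝ) (r - 1) = 2 * V r) :
    (displacement N h₀ F t).rep 1 = (wave h₀).rep 1
      + ∫ r in (0 : ℝ)..t, (V r - (history N h₀ F T : ℝ → ℝ) (r - 1)) := by
  have hslope : IntervalIntegrable
      (fun r => ((h₀ : ℝ → ℝ) (r + 1) + (h₀ : ℝ → ℝ) (r - 1)) / 2) volume 0 t :=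
    ((h₀.intervalIntegrable_comp_add 1 0 t).add
      (intervalIntegrable_comp_sub_one h₀ 0 t)).div_const 2
  have hintegral : ∫ r in (0 : ℝ)..t, (V r - (history N h₀ F T : ℝ → ℝ) (r - 1))
      = (∫ r in (0 : ℝ)..t, ((h₀ : ℝ → ℝ) (r + 1) + (h₀ : ℝ → ℝ) (r - 1)) / 2)
        - delayedIntegral t (history N h₀ F t) := by
    rw [← delayedIntegral_history_eq hF ht htT, delayedIntegral_apply ht,
      ← intervalIntegral.integral_sub hslope (intervalIntegrable_comp_sub_one _ 0 t)]
    refine intervalIntegral_congr_ae_Ioo ht ?_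
    filter_upwards [hV] with r hr h0r hrt
    rw [hr h0r (hrt.trans_le htN), mul_div_cancel_left₀ _ two_ne_zero]
  have hdata := rep_one_wave_sub h₀ 0 t
  rw [shift_zero, integral_half_sub_eq, ← delayedIntegral_apply ht] at hdata
  rw [displacement, ← traceShift_apply, history, map_add, traceShift_apply,
    traceShift_integral_source hF ht htN, hintegral, history, map_add]
  linarith

end Duhamel

end LineL2

lemma measurable_of_measurable_dist {α X : Type*} [MeasurableSpace α] [PseudoMetricSpace X]
    [SecondCountableTopology X] [MeasurableSpace X] [BorelSpace X] {f : α → X}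
    (h : ∀ x, Measurable fun a => dist (f a) x) : Measurable f := by
  refine measurable_of_isOpen fun U hU => ?_
  choose! ε hε hεU using fun x (hx : x ∈ U) => Metric.isOpen_iff.1 hU x hx
  obtain ⟨S, hS, hSU⟩ := TopologicalSpace.isOpen_iUnion_countable
    (fun x : U => Metric.ball (x : X) (ε x)) fun _ => Metric.isOpen_ball
  have hcover : U = ⋃ x ∈ S, Metric.ball (x : X) (ε x) := by
    rw [hSU]
    refine subset_antisymm (fun x hx => ?_) (iUnion_subset fun x => hεU x x.2)
    exact mem_iUnion.2 ⟨(⟨x, hx⟩ : U), Metric.mem_ball_self (hε x hx)⟩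
  rw [hcover, preimage_iUnion₂]
  refine MeasurableSet.biUnion hS fun x _ => ?_
  exact measurableSet_lt (h x) measurable_const

lemma exists_stronglyMeasurable_bounded_ae_eq {α : Type*} [MeasurableSpace α] {μ : Measure α}
    {f : α → ℝ} (hf : MemLp f ⊤ μ) :
    ∃ g, StronglyMeasurable g ∧ (∀ p, ‖g p‖ ≤ MeasureTheory.lpNorm f ⊤ μ) ∧ f =ᵐ[μ] g := by
  obtain ⟨f', hf'm, hff'⟩ := hf.1
  set a := MeasureTheory.lpNorm f ⊤ μ
  have ha : 0 ≤ a := lpNorm_nonneg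
  refine ⟨fun p => max (-a) (min a (f' p)),
    stronglyMeasurable_const.sup (stronglyMeasurable_const.inf hf'm), fun p => ?_, ?_⟩
  · exact abs_le.2 ⟨le_max_left _ _, max_le (by linarith) (min_le_left _ _)⟩
  · filter_upwards [hff', ae_le_lpNorm_exponent_top hf] with p hp hbound
    rw [Real.norm_eq_abs, abs_le] at hbound
    rw [← hp, min_eq_right hbound.2, max_eq_right hbound.1]

section SectionMul

variable {b : ℝ × ℝ → ℝ} (hbm : StronglyMeasurable b) {a : ℝ} (hb : ∀ p, ‖b p‖ ≤ a)

lemma memLp_top_section (hbm : StronglyMeasurable b) (hb : ∀ p, ‖b p‖ ≤ a) (t : ℝ) :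
    MemLp (fun x => b (x, t)) ⊤ (leb 0 1) :=
  memLp_top_of_bound (hbm.comp_measurable measurable_prodMk_right).aestronglyMeasurable a
    (Filter.Eventually.of_forall fun _ => hb _)

/-- Multiplication by the time slice `b(·, t)` of a bounded function, as an operator on `L²(0,1)`:
the zeroth order term of the wave equation. -/
def sectionMul (t : ℝ) : L2 →L[ℝ] L2 :=
  (ContinuousLinearMap.mul ℝ ℝ).holderL (leb 0 1) ⊤ 2 2 ((memLp_top_section hbm hb t).toLp _)

lemma coeFn_sectionMul (t : ℝ) (u : L2) :
    sectionMul hbm hb t u =ᵐ[leb 0 1] fun x => b (x, t) * (u : ℝ → ℝ) x := by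
  filter_upwards [(ContinuousLinearMap.mul ℝ ℝ).coeFn_holder (r := 2)
    ((memLp_top_section hbm hb t).toLp _) u, (memLp_top_section hbm hb t).coeFn_toLp] with x hmul hx
  exact hmul.trans (by rw [hx, ContinuousLinearMap.mul_apply'])

lemma norm_sectionMul_le (t : ℝ) (u : L2) : ‖sectionMul hbm hb t u‖ ≤ a * ‖u‖ := by
  refine Lp.norm_le_mul_norm_of_ae_le_mul ?_
  filter_upwards [coeFn_sectionMul hbm hb t u] with x hx
  rw [hx, norm_mul]
  exact mul_le_mul_of_nonneg_right (hb _) (norm_nonneg _)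

lemma dist_sectionMul (t : ℝ) (u w : L2) : dist (sectionMul hbm hb t u) w
    = √(∫ x, (b (x, t) * (u : ℝ → ℝ) x - (w : ℝ → ℝ) x) ^ 2 ∂(leb 0 1)) := by
  rw [dist_eq_norm, ← Real.sqrt_sq (norm_nonneg _), ← real_inner_self_eq_norm_sq, inner_L2]
  congr 1
  refine integral_congr_ae ?_
  filter_upwards [Lp.coeFn_sub (sectionMul hbm hb t u) w, coeFn_sectionMul hbm hb t u]
    with x hsub hmul
  rw [hsub, Pi.sub_apply, hmul, sq]

lemma stronglyMeasurable_sectionMul (u : L2) :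
    StronglyMeasurable fun t => sectionMul hbm hb t u := by
  have : Fact ((2 : ℝ≥0∞) ≠ ⊤) := ⟨by norm_num⟩
  borelize L2
  refine (measurable_of_measurable_dist fun w => ?_).stronglyMeasurable
  simp_rw [dist_sectionMul hbm hb]
  refine Real.continuous_sqrt.measurable.comp (StronglyMeasurable.measurable ?_)
  refine StronglyMeasurable.integral_prod_left (f := fun x t =>
    (b (x, t) * (u : ℝ → ℝ) x - (w : ℝ → ℝ) x) ^ 2) ?_
  exact ((hbm.mul ((Lp.stronglyMeasurable u).comp_measurable measurable_fst)).sub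
    ((Lp.stronglyMeasurable w).comp_measurable measurable_fst)).pow 2

lemma aestronglyMeasurable_sectionMul_comp {μ : Measure ℝ} {y : ℝ → L2}
    (hy : AEStronglyMeasurable y μ) :
    AEStronglyMeasurable (fun t => sectionMul hbm hb t (y t)) μ := by
  have : Fact ((2 : ℝ≥0∞) ≠ ⊤) := ⟨by norm_num⟩
  borelize L2
  have huncurry :
      StronglyMeasurable (Function.uncurry fun (u : L2) (t : ℝ) => sectionMul hbm hb t u) :=
    stronglyMeasurable_uncurry_of_continuous_of_stronglyMeasurable
      (fun t => (sectionMul hbm hb t).continuous) (stronglyMeasurable_sectionMul hbm hb)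
  have hcomp := huncurry.comp_measurable
    (hy.stronglyMeasurable_mk.measurable.prodMk measurable_id)
  refine ⟨fun t => sectionMul hbm hb t (hy.mk y t), hcomp, ?_⟩
  filter_upwards [hy.ae_eq_mk] with t ht
  rw [ht]

end SectionMul

lemma ae_ae_section_of_ae_cylinder {T : ℝ} {p : ℝ × ℝ → Prop}
    (hp : ∀ᵐ q ∂(volume.restrict (cylinder T)), p q) :
    ∀ᵐ t ∂(leb 0 T), ∀ᵐ x ∂(leb 0 1), p (x, t) := by
  have hprod : ∀ᵐ q ∂((leb 0 1).prod (leb 0 T)), p q := by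
    rw [Measure.prod_restrict]
    exact hp
  exact Measure.ae_ae_of_ae_prod (p := fun q : ℝ × ℝ => p (q.2, q.1))
    (Measure.measurePreserving_swap.quasiMeasurePreserving.ae hprod)

lemma exists_potential_operator {T : ℝ} {A : ℝ × ℝ → ℝ}
    (hA : MemLp A ⊤ (volume.restrict (cylinder T))) :
    ∃ M : ℝ → L2 →L[ℝ] L2, (∀ t u, ‖M t u‖ ≤ supNorm T A * ‖u‖) ∧
      (∀ y : ℝ → L2, AEStronglyMeasurable y (leb 0 T) →
        AEStronglyMeasurable (fun t => M t (y t)) (leb 0 T)) ∧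
      ∀ᵐ t ∂(leb 0 T), ∀ u z : L2,
        ∫ x in Ioo (0 : ℝ) 1, A (x, t) * (u : ℝ → ℝ) x * (z : ℝ → ℝ) x = inner ℝ (M t u) z := by
  obtain ⟨b, hbm, hb, hAb⟩ := exists_stronglyMeasurable_bounded_ae_eq hA
  rw [← toReal_eLpNorm hA.1] at hb
  refine ⟨sectionMul hbm hb, norm_sectionMul_le hbm hb,
    fun y hy => aestronglyMeasurable_sectionMul_comp hbm hb hy, ?_⟩
  filter_upwards [ae_ae_section_of_ae_cylinder hAb] with t ht u z
  rw [inner_L2]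
  refine integral_congr_ae ?_
  filter_upwards [ht, coeFn_sectionMul hbm hb t u] with x hx hmul
  rw [hmul, hx]

lemma integral_exp_mul_le {c : ℝ} (hc : 0 < c) (t : ℝ) :
    ∫ s in (0 : ℝ)..t, Real.exp (c * s) ≤ Real.exp (c * t) / c := by
  rw [intervalIntegral.integral_comp_mul_left (fun s => Real.exp s) hc.ne', integral_exp,
    smul_eq_mul, mul_zero, Real.exp_zero, inv_mul_eq_div]
  gcongr
  linarith

lemma intervalIntegral_le_of_le_exp {n : ℝ → ℝ} {m c s : ℝ} (hn : Continuous n) (hm : 0 ≤ m)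
    (hc : 0 < c) (hs : 0 ≤ s) (h : ∀ r ∈ Icc 0 s, n r ≤ m * Real.exp (c * r)) :
    ∫ r in (0 : ℝ)..s, n r ≤ m / c * Real.exp (c * s) :=
  calc ∫ r in (0 : ℝ)..s, n r ≤ ∫ r in (0 : ℝ)..s, m * Real.exp (c * r) :=
        intervalIntegral.integral_mono_on hs (hn.intervalIntegrable _ _)
          (Continuous.intervalIntegrable (by fun_prop) _ _) h
    _ ≤ m * (Real.exp (c * s) / c) := by
        rw [intervalIntegral.integral_const_mul]
        exact mul_le_mul_of_nonneg_left (integral_exp_mul_le hc s) hm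
    _ = m / c * Real.exp (c * s) := by ring

lemma le_exp_of_le_double_integral {n : ℝ → ℝ} {τ D κ c : ℝ} (hn : Continuous n)
    (hD : 0 ≤ D) (hκ : 0 ≤ κ) (hc : 0 < c) (hκc : 2 * κ ≤ c ^ 2)
    (h : ∀ t ∈ Icc 0 τ, n t ≤ D + κ * ∫ s in (0 : ℝ)..t, ∫ r in (0 : ℝ)..s, n r) :
    ∀ t ∈ Icc 0 τ, n t ≤ 2 * D * Real.exp (c * t) := by
  intro t ht
  -- Let `m` be the maximum of `exp (-c t) n t`: the double integral costs at most `m / 2`.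
  obtain ⟨t₀, ht₀, hmax⟩ := isCompact_Icc.exists_isMaxOn (nonempty_of_mem ht)
    (f := fun t => Real.exp (-(c * t)) * n t) (by fun_prop)
  set m := Real.exp (-(c * t₀)) * n t₀ with hm
  have hnm : ∀ r ∈ Icc 0 τ, n r ≤ m * Real.exp (c * r) := by
    intro r hr
    rw [← div_le_iff₀ (Real.exp_pos _), div_eq_inv_mul, ← Real.exp_neg]
    exact hmax hr
  suffices hmD : m ≤ 2 * D from (hnm t ht).trans (by gcongr)
  rcases le_or_gt m 0 with hm0 | hm0
  · linarith
  have hinner : ∀ s ∈ Icc 0 t₀, ∫ r in (0 : ℝ)..s, n r ≤ m / c * Real.exp (c * s) := fun s hs =>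
    intervalIntegral_le_of_le_exp hn hm0.le hc hs.1 fun r hr =>
      hnm r ⟨hr.1, hr.2.trans (hs.2.trans ht₀.2)⟩
  have houter : ∫ s in (0 : ℝ)..t₀, ∫ r in (0 : ℝ)..s, n r ≤ m / c / c * Real.exp (c * t₀) :=
    intervalIntegral_le_of_le_exp
      (intervalIntegral.continuous_primitive (fun a b => hn.intervalIntegrable a b) 0)
      (by positivity) hc ht₀.1 hinner
  have hhalf : κ * (m / c / c * Real.exp (c * t₀)) ≤ m / 2 * Real.exp (c * t₀) := by
    have hκ2 : κ / c ^ 2 ≤ 1 / 2 := by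
      rw [div_le_iff₀ (by positivity)]
      linarith
    calc κ * (m / c / c * Real.exp (c * t₀)) = κ / c ^ 2 * (m * Real.exp (c * t₀)) := by
          field_simp
      _ ≤ 1 / 2 * (m * Real.exp (c * t₀)) := by gcongr
      _ = m / 2 * Real.exp (c * t₀) := by ring
  have hnt₀ : n t₀ ≤ D + m / 2 * Real.exp (c * t₀) :=
    (h t₀ ht₀).trans (add_le_add_right ((mul_le_mul_of_nonneg_left houter hκ).trans hhalf) _)
  have hexp : Real.exp (-(c * t₀)) ≤ 1 :=
    Real.exp_le_one_iff.2 (neg_nonpos.2 (mul_nonneg hc.le ht₀.1))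
  have hmle : m ≤ D + m / 2 :=
    calc m ≤ Real.exp (-(c * t₀)) * (D + m / 2 * Real.exp (c * t₀)) := by rw [hm]; gcongr
      _ = Real.exp (-(c * t₀)) * D + m / 2 * (Real.exp (-(c * t₀)) * Real.exp (c * t₀)) := by ring
      _ = Real.exp (-(c * t₀)) * D + m / 2 := by
          rw [← Real.exp_add, neg_add_cancel, Real.exp_zero, mul_one]
      _ ≤ D + m / 2 := add_le_add_left (mul_le_of_le_one_left hD hexp) _
  linarith

lemma exists_eqOn_of_norm_sub_le_integral {E : Type*} [NormedAddCommGroup E] [NormedSpace ℝ E]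
    [CompleteSpace E] {T κ : ℝ} (hT : 0 ≤ T) (hκ : 0 ≤ κ) {Φ : (ℝ → E) → ℝ → E}
    (hcont : ∀ y, Continuous y → Continuous (Φ y))
    (hΦ : ∀ y z, Continuous y → Continuous z → ∀ t ∈ Icc 0 T,
      ‖Φ y t - Φ z t‖ ≤ κ * ∫ s in (0 : ℝ)..t, ‖y s - z s‖) :
    ∃ y, Continuous y ∧ EqOn y (Φ y) (Icc 0 T) := by
  -- `Φ` is a contraction for the weighted sup norm `sup exp (-c t) ‖y t‖`, that is, on `y = Y f`.
  set c : ℝ := 2 * κ + 1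
  have hc0 : 0 < c := by positivity
  have hcancel (t : ℝ) : Real.exp (-(c * t)) * Real.exp (c * t) = 1 := by
    rw [← Real.exp_add, neg_add_cancel, Real.exp_zero]
  let Y (f : C(Icc 0 T, E)) (s : ℝ) : E := Real.exp (c * s) • IccExtend hT f s
  have hY (f : C(Icc 0 T, E)) : Continuous (Y f) :=
    Continuous.smul (by fun_prop) f.continuous.Icc_extend'
  let Ψ (f : C(Icc 0 T, E)) : C(Icc 0 T, E) :=
    ⟨fun t => Real.exp (-(c * t)) • Φ (Y f) t,
      Continuous.smul (by fun_prop) ((hcont _ (hY f)).comp continuous_subtype_val)⟩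
  have hΨ : ContractingWith (1 / 2) Ψ := by
    refine ⟨by norm_num, LipschitzWith.of_dist_le_mul fun f g => ?_⟩
    rw [ContinuousMap.dist_le (by positivity)]
    intro t
    have hYsub (s : ℝ) : ‖Y f s - Y g s‖ ≤ dist f g * Real.exp (c * s) := by
      simp only [Y]
      rw [← smul_sub, norm_smul, Real.norm_of_nonneg (Real.exp_pos _).le, mul_comm, ← dist_eq_norm]
      exact mul_le_mul_of_nonneg_right (ContinuousMap.dist_apply_le_dist _) (Real.exp_pos _).le
    have hint : ∫ s in (0 : ℝ)..t, ‖Y f s - Y g s‖ ≤ dist f g / c * Real.exp (c * t) :=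
      intervalIntegral_le_of_le_exp ((hY f).sub (hY g)).norm dist_nonneg hc0 t.2.1
        fun s _ => hYsub s
    calc dist (Ψ f t) (Ψ g t) = Real.exp (-(c * t)) * ‖Φ (Y f) t - Φ (Y g) t‖ := by
          rw [dist_eq_norm, ContinuousMap.coe_mk, ContinuousMap.coe_mk, ← smul_sub, norm_smul,
            Real.norm_of_nonneg (Real.exp_pos _).le]
      _ ≤ Real.exp (-(c * t)) * (κ * (dist f g / c * Real.exp (c * t))) := by
          gcongr
          exact (hΦ _ _ (hY f) (hY g) t t.2).trans (mul_le_mul_of_nonneg_left hint hκ)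
      _ = κ / c * dist f g * (Real.exp (-(c * t)) * Real.exp (c * t)) := by ring
      _ ≤ 1 / 2 * dist f g := by
          rw [hcancel, mul_one]
          refine mul_le_mul_of_nonneg_right ?_ dist_nonneg
          rw [div_le_iff₀ hc0]
          linarith
      _ = ↑(1 / 2 : NNReal) * dist f g := by norm_num
  refine ⟨Y (hΨ.fixedPoint Ψ), hY _, fun t ht => ?_⟩
  have hfix : hΨ.fixedPoint Ψ ⟨t, ht⟩ = Real.exp (-(c * t)) • Φ (Y (hΨ.fixedPoint Ψ)) t :=
    (DFunLike.congr_fun hΨ.fixedPoint_isFixedPt ⟨t, ht⟩).symm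
  calc Y (hΨ.fixedPoint Ψ) t = Real.exp (c * t) • hΨ.fixedPoint Ψ ⟨t, ht⟩ := by
        simp only [Y, IccExtend_of_mem hT _ ht]
    _ = Φ (Y (hΨ.fixedPoint Ψ)) t := by
        rw [hfix, smul_smul, mul_comm, hcancel, one_smul]

namespace LineL2

variable {N : ℕ} {h₀ : LineL2}

lemma displacement_sub (F G : ℝ → L2) (hF : Integrable F) (hG : Integrable G) (t : ℝ) :
    displacement N h₀ F t - displacement N h₀ G t = displacement N 0 (F - G) t := by
  have hhistory : history N h₀ F t - history N h₀ G t = history N 0 (F - G) t := by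
    simp only [history, add_sub_add_left_eq_sub, zero_add]
    rw [← intervalIntegral.integral_sub (integrable_source hF).intervalIntegrable
      (integrable_source hG).intervalIntegrable]
    refine intervalIntegral.integral_congr fun s _ => ?_
    simp only [source, Pi.sub_apply, map_sub]
  have hlin := (waveL ∘L (shift t).toContinuousLinearMap).map_sub
    (history N h₀ F t) (history N h₀ G t)
  rw [hhistory] at hlin
  exact hlin.symm

section Potential

variable {T a : ℝ} {M : ℝ → L2 →L[ℝ] L2} {B F : ℝ → L2}

/-- The forcing `B - M y` on `(0, T)`, extended by zero: the wave equation with potential `M` is the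
free wave equation with this source. -/
def potentialSource (T : ℝ) (M : ℝ → L2 →L[ℝ] L2) (B y : ℝ → L2) : ℝ → L2 :=
  (Ioo 0 T).indicator fun s => B s - M s (y s)

lemma integrable_potential_comp (hM : ∀ t u, ‖M t u‖ ≤ a * ‖u‖)
    (hMm : ∀ y : ℝ → L2, AEStronglyMeasurable y (leb 0 T) →
      AEStronglyMeasurable (fun t => M t (y t)) (leb 0 T))
    {y : ℝ → L2} (hy : Integrable y (leb 0 T)) : Integrable (fun t => M t (y t)) (leb 0 T) :=
  (hy.norm.const_mul a).mono' (hMm y hy.1) (Filter.Eventually.of_forall fun s => hM s _)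

lemma integrable_potentialSource (hM : ∀ t u, ‖M t u‖ ≤ a * ‖u‖)
    (hMm : ∀ y : ℝ → L2, AEStronglyMeasurable y (leb 0 T) →
      AEStronglyMeasurable (fun t => M t (y t)) (leb 0 T))
    (hB : Integrable B (leb 0 T)) {y : ℝ → L2} (hy : Continuous y) :
    Integrable (potentialSource T M B y) :=
  (integrable_indicator_iff measurableSet_Ioo).2 (hB.sub
    (integrable_potential_comp hM hMm (integrable_leb_of_continuousOn hy.continuousOn)))

lemma norm_potentialSource_sub_le (ha : 0 ≤ a) (hM : ∀ t u, ‖M t u‖ ≤ a * ‖u‖) (y z : ℝ → L2)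
    (s : ℝ) :
    ‖(potentialSource T M B y - potentialSource T M B z) s‖ ≤ a * ‖y s - z s‖ := by
  by_cases hs : s ∈ Ioo 0 T
  · simp only [Pi.sub_apply, potentialSource, indicator_of_mem hs, sub_sub_sub_cancel_left]
    rw [← map_sub, norm_sub_rev]
    exact hM s _
  · simp only [Pi.sub_apply, potentialSource, indicator_of_notMem hs, sub_zero, norm_zero]
    positivity

lemma exists_source_fixed_point (hT : 0 < T) (ha : 0 ≤ a) (hM : ∀ t u, ‖M t u‖ ≤ a * ‖u‖)
    (hMm : ∀ y : ℝ → L2, AEStronglyMeasurable y (leb 0 T) →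
      AEStronglyMeasurable (fun t => M t (y t)) (leb 0 T))
    (hB : Integrable B (leb 0 T)) :
    ∃ F : ℝ → L2, Integrable F ∧
      ∀ s ∈ Ioo 0 T, F s = B s - M s (displacement N h₀ F s).toL2 := by
  let S (y : ℝ → L2) : ℝ → L2 := potentialSource T M B y
  have hS {y : ℝ → L2} (hy : Continuous y) : Integrable (S y) :=
    integrable_potentialSource hM hMm hB hy
  have hlip (y z : ℝ → L2) (hy : Continuous y) (hz : Continuous z) (t : ℝ) (ht : t ∈ Icc 0 T) :
      ‖(displacement N h₀ (S y) t).toL2 - (displacement N h₀ (S z) t).toL2‖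
        ≤ 2 * (N + 1) * a * ∫ s in (0 : ℝ)..t, ‖y s - z s‖ := by
    have hsub := norm_past_history_le (N := N) (h₀ := 0) ((hS hy).sub (hS hz)) ht.1 (t + 1)
    rw [map_zero, norm_zero, zero_add] at hsub
    calc ‖(displacement N h₀ (S y) t).toL2 - (displacement N h₀ (S z) t).toL2‖
        ≤ ‖displacement N 0 (S y - S z) t‖ := by
          rw [← map_sub, displacement_sub _ _ (hS hy) (hS hz)]
          exact H1Zero.norm_toL2_le _
      _ ≤ 2 * (N + 1) * ∫ s in (0 : ℝ)..t, ‖(S y - S z) s‖ := (norm_displacement_le _).trans hsub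
      _ ≤ 2 * (N + 1) * ∫ s in (0 : ℝ)..t, a * ‖y s - z s‖ := by
          refine mul_le_mul_of_nonneg_left ?_ (by positivity)
          exact intervalIntegral.integral_mono_on ht.1
            ((hS hy).sub (hS hz)).norm.intervalIntegrable
            (Continuous.intervalIntegrable (by fun_prop) _ _)
            fun s _ => norm_potentialSource_sub_le ha hM y z s
      _ = 2 * (N + 1) * a * ∫ s in (0 : ℝ)..t, ‖y s - z s‖ := by
          rw [intervalIntegral.integral_const_mul, ← mul_assoc]
  obtain ⟨y, hy, hfix⟩ := exists_eqOn_of_norm_sub_le_integral hT.le (by positivity)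
    (Φ := fun y t => (displacement N h₀ (S y) t).toL2)
    (fun y hy => H1Zero.toL2L.continuous.comp (continuous_displacement (hS hy))) hlip
  refine ⟨S y, hS hy, fun s hs => ?_⟩
  have hys : y s = (displacement N h₀ (S y) s).toL2 := hfix (Ioo_subset_Icc_self hs)
  rw [← hys]
  exact indicator_of_mem hs _

lemma integral_norm_source_le (hM : ∀ t u, ‖M t u‖ ≤ a * ‖u‖) (hB : Integrable B (leb 0 T))
    (hF : Integrable F) (hFB : ∀ s ∈ Ioo 0 T, F s = B s - M s (displacement N h₀ F s).toL2)
    {s t : ℝ} (hs : 0 ≤ s) (hst : s ≤ t) (ht : t ≤ T) :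
    ∫ r in (0 : ℝ)..s, ‖F r‖ ≤ (∫ r in (0 : ℝ)..t, ‖B r‖)
      + a * ∫ r in (0 : ℝ)..s, ‖(displacement N h₀ F r).toL2‖ := by
  have hn : Continuous fun r => ‖(displacement N h₀ F r).toL2‖ :=
    (H1Zero.toL2L.continuous.comp (continuous_displacement hF)).norm
  have hBi {r : ℝ} (hr : 0 ≤ r) (hrT : r ≤ T) : IntervalIntegrable (fun s => ‖B s‖) volume 0 r :=
    intervalIntegrable_of_leb hB.norm le_rfl hr hrT
  have hni : IntervalIntegrable (fun r => a * ‖(displacement N h₀ F r).toL2‖) volume 0 s :=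
    (hn.const_mul a).intervalIntegrable _ _
  calc ∫ r in (0 : ℝ)..s, ‖F r‖
      ≤ ∫ r in (0 : ℝ)..s, (‖B r‖ + a * ‖(displacement N h₀ F r).toL2‖) := by
        refine intervalIntegral.integral_mono_ae_restrict hs hF.norm.intervalIntegrable
          ((hBi hs (hst.trans ht)).add hni) ?_
        rw [← restrict_Ioo_eq_restrict_Icc]
        filter_upwards [ae_restrict_mem measurableSet_Ioo] with r hr
        rw [hFB r ⟨hr.1, hr.2.trans_le (hst.trans ht)⟩]
        exact (norm_sub_le _ _).trans (add_le_add_right (hM r _) _)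
    _ = (∫ r in (0 : ℝ)..s, ‖B r‖) + a * ∫ r in (0 : ℝ)..s, ‖(displacement N h₀ F r).toL2‖ := by
        rw [intervalIntegral.integral_add (hBi hs (hst.trans ht)) hni,
          intervalIntegral.integral_const_mul]
    _ ≤ (∫ r in (0 : ℝ)..t, ‖B r‖) + a * ∫ r in (0 : ℝ)..s, ‖(displacement N h₀ F r).toL2‖ :=
        add_le_add_left (intervalIntegral.integral_mono_interval le_rfl hs hst
          (Filter.Eventually.of_forall fun _ => norm_nonneg _) (hBi (hs.trans hst) ht)) _

lemma norm_past_history_le_integral (hM : ∀ t u, ‖M t u‖ ≤ a * ‖u‖) (hB : Integrable B (leb 0 T))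
    (hF : Integrable F) (hFB : ∀ s ∈ Ioo 0 T, F s = B s - M s (displacement N h₀ F s).toL2)
    {κ : ℝ} (hκ : κ = 2 * (N + 1)) {s t : ℝ} (hs : 0 ≤ s) (hst : s ≤ t) (ht : t ≤ T) :
    ‖past (s + 1) (history N h₀ F s)‖ ≤ ‖past (t + 1) h₀‖ + κ * (∫ r in (0 : ℝ)..t, ‖B r‖)
      + κ * a * ∫ r in (0 : ℝ)..s, ‖(displacement N h₀ F r).toL2‖ := by
  have hκ0 : 0 ≤ κ := by rw [hκ]; positivity
  have hhistory := norm_past_history_le (N := N) (h₀ := h₀) hF hs (s + 1)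
  have hsource :=
    mul_le_mul_of_nonneg_left (integral_norm_source_le hM hB hF hFB hs hst ht) hκ0
  have hmono := norm_past_mono (add_le_add_left hst 1) h₀
  rw [← hκ] at hhistory
  linarith

lemma norm_toL2_displacement_le (hF : Integrable F) {D k t : ℝ}
    (hpast : ∀ s ∈ Icc 0 t, ‖past (s + 1) (history N h₀ F s)‖
      ≤ D + k * ∫ r in (0 : ℝ)..s, ‖(displacement N h₀ F r).toL2‖) (ht : 0 ≤ t) :
    ‖(displacement N h₀ F t).toL2‖ ≤ ‖wave h₀‖ + t * D
      + k * ∫ s in (0 : ℝ)..t, ∫ r in (0 : ℝ)..s, ‖(displacement N h₀ F r).toL2‖ := by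
  have hn : Continuous fun r => ‖(displacement N h₀ F r).toL2‖ :=
    (H1Zero.toL2L.continuous.comp (continuous_displacement hF)).norm
  have hprim : Continuous fun s => ∫ r in (0 : ℝ)..s, ‖(displacement N h₀ F r).toL2‖ :=
    intervalIntegral.continuous_primitive (fun a b => hn.intervalIntegrable a b) 0
  rw [toL2_displacement hF ht, add_assoc]
  refine (norm_add_le _ _).trans (add_le_add (H1Zero.norm_toL2_le _) ?_)
  calc ‖∫ s in (0 : ℝ)..t, velocity N h₀ F s‖
      ≤ ∫ s in (0 : ℝ)..t, ‖velocity N h₀ F s‖ :=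
        intervalIntegral.norm_integral_le_integral_norm ht
    _ ≤ ∫ s in (0 : ℝ)..t, (D + k * ∫ r in (0 : ℝ)..s, ‖(displacement N h₀ F r).toL2‖) :=
        intervalIntegral.integral_mono_on ht
          ((continuous_velocity hF).norm.intervalIntegrable _ _)
          (Continuous.intervalIntegrable (by fun_prop) _ _)
          fun s hs => (norm_velocity_le s).trans (hpast s hs)
    _ = t * D + k * ∫ s in (0 : ℝ)..t, ∫ r in (0 : ℝ)..s, ‖(displacement N h₀ F r).toL2‖ := by
        rw [intervalIntegral.integral_add intervalIntegrable_const
          (Continuous.intervalIntegrable (by fun_prop) _ _), intervalIntegral.integral_const_mul,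
          intervalIntegral.integral_const, sub_zero, smul_eq_mul]

lemma norm_past_history_le_exp (ha : 0 ≤ a) (hM : ∀ t u, ‖M t u‖ ≤ a * ‖u‖)
    (hB : Integrable B (leb 0 T)) (hF : Integrable F)
    (hFB : ∀ s ∈ Ioo 0 T, F s = B s - M s (displacement N h₀ F s).toL2)
    {κ : ℝ} (hκ : κ = 2 * (N + 1)) {t D : ℝ} (ht : t ∈ Icc 0 T)
    (hD : D = ‖past (t + 1) h₀‖ + κ * ∫ s in (0 : ℝ)..t, ‖B s‖) :
    ‖past (t + 1) (history N h₀ F t)‖ ≤ D + 2 * κ * a * T * (‖wave h₀‖ + T * D)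
      * Real.exp ((√(2 * κ * a) + 1) * T) := by
  have hκ0 : 0 ≤ κ := by rw [hκ]; positivity
  have hT : 0 ≤ T := ht.1.trans ht.2
  have hD0 : 0 ≤ D := by
    rw [hD]
    exact add_nonneg (norm_nonneg _) (mul_nonneg hκ0
      (intervalIntegral.integral_nonneg ht.1 fun _ _ => norm_nonneg _))
  set n : ℝ → ℝ := fun s => ‖(displacement N h₀ F s).toL2‖
  have hnc : Continuous n := (H1Zero.toL2L.continuous.comp (continuous_displacement hF)).norm
  have hpast : ∀ s ∈ Icc 0 t, ‖past (s + 1) (history N h₀ F s)‖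
      ≤ D + κ * a * ∫ r in (0 : ℝ)..s, n r := fun s hs =>
    hD ▸ norm_past_history_le_integral hM hB hF hFB hκ hs.1 hs.2 ht.2
  set W := ‖wave h₀‖ + T * D
  have hnle : ∀ s ∈ Icc 0 t,
      n s ≤ W + κ * a * ∫ r in (0 : ℝ)..s, ∫ r' in (0 : ℝ)..r, n r' := fun s hs =>
    (norm_toL2_displacement_le hF (fun r hr => hpast r ⟨hr.1, hr.2.trans hs.2⟩) hs.1).trans
      (add_le_add_left (add_le_add_right
        (mul_le_mul_of_nonneg_right (hs.2.trans ht.2) hD0) _) _)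
  set c := √(2 * κ * a) + 1 with hc
  have hsqrt : 0 ≤ √(2 * κ * a) := Real.sqrt_nonneg _
  have hc2 : 2 * (κ * a) ≤ c ^ 2 := by
    rw [hc, ← mul_assoc]
    nlinarith [Real.sq_sqrt (by positivity : 0 ≤ 2 * κ * a)]
  have hexp (r : ℝ) (hr : r ∈ Icc 0 t) : n r ≤ 2 * W * Real.exp (c * T) :=
    (le_exp_of_le_double_integral hnc (by positivity) (by positivity) (by positivity) hc2 hnle
      r hr).trans (by gcongr; exact hr.2.trans ht.2)
  have hintegral : ∫ r in (0 : ℝ)..t, n r ≤ T * (2 * W * Real.exp (c * T)) := by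
    refine (intervalIntegral.integral_mono_on ht.1 (hnc.intervalIntegrable _ _)
      intervalIntegrable_const hexp).trans ?_
    rw [intervalIntegral.integral_const, sub_zero, smul_eq_mul]
    gcongr
    exact ht.2
  calc ‖past (t + 1) (history N h₀ F t)‖ ≤ D + κ * a * ∫ r in (0 : ℝ)..t, n r :=
        hpast t ⟨ht.1, le_rfl⟩
    _ ≤ D + κ * a * (T * (2 * W * Real.exp (c * T))) := by gcongr
    _ = D + 2 * κ * a * T * W * Real.exp (c * T) := by ring

end Potential

end LineL2

section Energy

lemma absolutelyContinuousOnInterval_of_dist_le {X Y : Type*} [PseudoMetricSpace X]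
    [PseudoMetricSpace Y] {f : ℝ → X} {g : ℝ → Y} {a b : ℝ}
    (hg : AbsolutelyContinuousOnInterval g a b)
    (h : ∀ x ∈ uIcc a b, ∀ y ∈ uIcc a b, dist (f x) (f y) ≤ dist (g x) (g y)) :
    AbsolutelyContinuousOnInterval f a b := by
  rw [AbsolutelyContinuousOnInterval] at hg ⊢
  refine squeeze_zero' (Filter.Eventually.of_forall fun _ =>
    Finset.sum_nonneg fun _ _ => dist_nonneg) ?_ hg
  rw [Filter.eventually_inf_principal]
  filter_upwards with I hI
  exact Finset.sum_le_sum fun i hi => h _ (hI.1 i hi).1 _ (hI.1 i hi).2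

variable {E : Type*} [NormedAddCommGroup E] [InnerProductSpace ℝ E]

lemma integrable_inner_of_continuousOn {f g : ℝ → E} {a b : ℝ} (hf : Integrable f (leb a b))
    (hg : ContinuousOn g (Icc a b)) : Integrable (fun s => inner ℝ (f s) (g s)) (leb a b) := by
  obtain ⟨K, hK⟩ := isCompact_Icc.exists_bound_of_continuousOn hg
  refine (hf.norm.const_mul K).mono' (hf.1.inner
    ((hg.mono Ioo_subset_Icc_self).aestronglyMeasurable measurableSet_Ioo)) ?_
  filter_upwards [ae_restrict_mem measurableSet_Ioo] with s hs
  refine (norm_inner_le_norm _ _).trans ?_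
  rw [mul_comm]
  exact mul_le_mul_of_nonneg_right (hK s (Ioo_subset_Icc_self hs)) (norm_nonneg _)

lemma absolutelyContinuousOnInterval_norm_primitive {f : ℝ → E} {a b : ℝ}
    (hf : IntervalIntegrable f volume a b) :
    AbsolutelyContinuousOnInterval (fun t => ‖∫ s in a..t, f s‖) a b := by
  refine absolutelyContinuousOnInterval_of_dist_le
    (hf.norm.absolutelyContinuousOnInterval_intervalIntegral left_mem_uIcc) fun x hx y hy => ?_
  have hsub {z : ℝ} (hz : z ∈ uIcc a b) : IntervalIntegrable f volume a z :=
    hf.mono_set (uIcc_subset_uIcc left_mem_uIcc hz)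
  calc dist ‖∫ s in a..x, f s‖ ‖∫ s in a..y, f s‖ ≤ ‖(∫ s in a..x, f s) - ∫ s in a..y, f s‖ :=
        abs_norm_sub_norm_le _ _
    _ = ‖∫ s in y..x, f s‖ := by
        rw [intervalIntegral.integral_interval_sub_left (hsub hx) (hsub hy)]
    _ ≤ |∫ s in y..x, ‖f s‖| := intervalIntegral.norm_integral_le_abs_integral_norm
    _ = dist (∫ s in a..x, ‖f s‖) (∫ s in a..y, ‖f s‖) := by
        rw [Real.dist_eq,
          intervalIntegral.integral_interval_sub_left (hsub hx).norm (hsub hy).norm]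

variable [CompleteSpace E]

lemma inner_intervalIntegral_left {f : ℝ → E} {a b : ℝ} (hf : IntervalIntegrable f volume a b)
    (z : E) : inner ℝ (∫ s in a..b, f s) z = ∫ s in a..b, inner ℝ (f s) z := by
  rw [real_inner_comm, ← innerSL_apply_apply ℝ z,
    ← ContinuousLinearMap.intervalIntegral_comp_comm _ hf]
  simp only [innerSL_apply_apply, real_inner_comm]

lemma norm_sq_primitive {f : ℝ → E} {a b : ℝ} (hf : IntervalIntegrable f volume a b) :
    ‖∫ s in a..b, f s‖ ^ 2 = ∫ t in a..b, 2 * inner ℝ (f t) (∫ s in a..t, f s) := by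
  have hac := absolutelyContinuousOnInterval_norm_primitive hf
  have hsq : (fun t => ‖∫ s in a..t, f s‖) * (fun t => ‖∫ s in a..t, f s‖)
      = fun t => ‖∫ s in a..t, f s‖ ^ 2 := by
    ext t
    rw [Pi.mul_apply, sq]
  have hftc := (hac.mul hac).integral_deriv_eq_sub
  rw [hsq] at hftc
  simp only [intervalIntegral.integral_same, norm_zero, zero_pow two_ne_zero, sub_zero] at hftc
  rw [← hftc]
  refine intervalIntegral.integral_congr_ae ?_
  filter_upwards [hf.ae_hasDerivAt_integral] with t ht htab
  rw [(ht (uIoc_subset_uIcc htab) a left_mem_uIcc).norm_sq.deriv, real_inner_comm]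

lemma ae_eq_zero_of_primitive_eq_zero {X : Type*} [NormedAddCommGroup X] [NormedSpace ℝ X]
    [CompleteSpace X] {f : ℝ → X} {a b : ℝ} (hab : a ≤ b) (hf : Integrable f (leb a b))
    (h : ∀ t ∈ Icc a b, ∫ s in a..t, f s = 0) : f =ᵐ[leb a b] 0 := by
  rw [Filter.EventuallyEq, ae_restrict_iff' measurableSet_Ioo]
  filter_upwards [(intervalIntegrable_of_leb hf le_rfl hab le_rfl).ae_hasDerivAt_integral]
    with t ht htab
  have hmem : t ∈ uIcc a b := by
    rw [uIcc_of_le hab]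
    exact Ioo_subset_Icc_self htab
  refine (ht hmem a left_mem_uIcc).unique
    ((hasDerivAt_const t (0 : X)).congr_of_eventuallyEq ?_)
  filter_upwards [Ioo_mem_nhds htab.1 htab.2] with s hs
  exact h s (Ioo_subset_Icc_self hs)

end Energy

lemma eq_zero_of_le_mul_integral {φ : ℝ → ℝ} {T k : ℝ} (hφ : ContinuousOn φ (Icc 0 T))
    (hφ0 : ∀ t ∈ Icc 0 T, 0 ≤ φ t) (h : ∀ t ∈ Icc 0 T, φ t ≤ k * ∫ s in (0 : ℝ)..t, φ s) :
    ∀ t ∈ Icc 0 T, φ t = 0 := by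
  have hint {t : ℝ} (ht : t ∈ Icc 0 T) : IntervalIntegrable φ volume 0 t :=
    (hφ.mono (by rw [uIcc_of_le ht.1]; exact Icc_subset_Icc_right ht.2)).intervalIntegrable
  have hprim : ∀ t ∈ Icc 0 T, ∫ s in (0 : ℝ)..t, φ s = 0 := by
    intro t ht
    have hT : 0 ≤ T := ht.1.trans ht.2
    refine eq_zero_of_abs_deriv_le_mul_abs_self_of_eq_zero_right (f' := φ) (K := k)
      (continuousOn_primitive hT (integrable_leb_of_continuousOn hφ)) (fun s hs => ?_)
      intervalIntegral.integral_same (fun s hs => ?_) t ht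
    · have hmem : Icc 0 T ∈ nhdsWithin s (Ioi s) :=
        Filter.mem_of_superset (Ioo_mem_nhdsGT hs.2) fun r hr =>
          ⟨hs.1.trans hr.1.le, hr.2.le⟩
      exact intervalIntegral.integral_hasDerivWithinAt_right (t := Ioi s)
        (hint (Ico_subset_Icc_self hs))
        ⟨_, hmem, hφ.aestronglyMeasurable measurableSet_Icc⟩
        ((hφ s (Ico_subset_Icc_self hs)).mono_of_mem_nhdsWithin hmem)
    · have hs' := Ico_subset_Icc_self hs
      rw [Real.norm_of_nonneg (hφ0 s hs'), Real.norm_of_nonneg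
        (intervalIntegral.integral_nonneg hs.1 fun r hr => hφ0 r ⟨hr.1, hr.2.trans hs'.2⟩)]
      exact h s hs'
  intro t ht
  refine le_antisymm ?_ (hφ0 t ht)
  have hle := h t ht
  rwa [hprim t ht, mul_zero] at hle

section IntegratedEquation

variable {T a : ℝ} {M : ℝ → L2 →L[ℝ] L2} {d : ℝ → H1Zero} {δ : ℝ → L2}

lemma norm_sq_add_norm_sq_eq_of_integrated_equation (hT : 0 ≤ T)
    (hd : Integrable d (leb 0 T)) (hδ : Integrable δ (leb 0 T))
    (hdδ : ∀ᵐ t ∂(leb 0 T), (d t).toL2 = ∫ s in (0 : ℝ)..t, δ s)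
    (heq : ∀ᵐ t ∂(leb 0 T), ∀ z : H1Zero, inner ℝ (δ t) z.toL2
      + inner ℝ (∫ s in (0 : ℝ)..t, d s) z
      + inner ℝ (∫ s in (0 : ℝ)..t, M s (d s).toL2) z.toL2 = 0) {t : ℝ} (ht : t ∈ Icc 0 T) :
    ‖∫ s in (0 : ℝ)..t, δ s‖ ^ 2 + ‖∫ s in (0 : ℝ)..t, d s‖ ^ 2
      = -∫ s in (0 : ℝ)..t,
          2 * inner ℝ (∫ r in (0 : ℝ)..s, δ r) (∫ r in (0 : ℝ)..s, M r (d r).toL2) := by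
  have hint {X : Type} [NormedAddCommGroup X] {f : ℝ → X} (hf : Integrable f (leb 0 T)) :
      IntervalIntegrable f volume 0 t := intervalIntegrable_of_leb hf le_rfl ht.1 ht.2
  have hδi := integrable_inner_of_continuousOn hδ (continuousOn_primitive hT hδ)
  have hdi := integrable_inner_of_continuousOn hd (continuousOn_primitive hT hd)
  rw [norm_sq_primitive (hint hδ), norm_sq_primitive (hint hd),
    ← intervalIntegral.integral_add ((hint hδi).const_mul 2) ((hint hdi).const_mul 2),
    ← intervalIntegral.integral_neg]
  refine intervalIntegral_congr_ae_Ioo ht.1 ?_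
  filter_upwards [(ae_restrict_iff' measurableSet_Ioo).1 hdδ,
    (ae_restrict_iff' measurableSet_Ioo).1 heq] with s hds heqs hs0 hst
  have hs : s ∈ Ioo 0 T := ⟨hs0, hst.trans_le ht.2⟩
  have htest := heqs hs (d s)
  rw [hds hs, real_inner_comm (d s), real_inner_comm (∫ r in (0 : ℝ)..s, δ r)
    (∫ r in (0 : ℝ)..s, M r (d r).toL2)] at htest
  linarith

lemma norm_sq_add_norm_sq_le_of_integrated_equation (hT : 0 ≤ T)
    (hM : ∀ t u, ‖M t u‖ ≤ a * ‖u‖) (hMd : Integrable (fun t => M t (d t).toL2) (leb 0 T))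
    (hd : Integrable d (leb 0 T)) (hδ : Integrable δ (leb 0 T))
    (hdδ : ∀ᵐ t ∂(leb 0 T), (d t).toL2 = ∫ s in (0 : ℝ)..t, δ s)
    (heq : ∀ᵐ t ∂(leb 0 T), ∀ z : H1Zero, inner ℝ (δ t) z.toL2
      + inner ℝ (∫ s in (0 : ℝ)..t, d s) z
      + inner ℝ (∫ s in (0 : ℝ)..t, M s (d s).toL2) z.toL2 = 0) {t : ℝ} (ht : t ∈ Icc 0 T) :
    ‖∫ s in (0 : ℝ)..t, δ s‖ ^ 2 + ‖∫ s in (0 : ℝ)..t, d s‖ ^ 2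
      ≤ a * (∫ s in (0 : ℝ)..t, ‖∫ r in (0 : ℝ)..s, δ r‖) ^ 2 := by
  set D : ℝ → L2 := fun t => ∫ s in (0 : ℝ)..t, δ s
  set G : ℝ → L2 := fun t => ∫ s in (0 : ℝ)..t, M s (d s).toL2
  set Q : ℝ → ℝ := fun t => ∫ s in (0 : ℝ)..t, ‖D s‖
  have hD : ContinuousOn D (Icc 0 T) := continuousOn_primitive hT hδ
  have hG : ContinuousOn G (Icc 0 T) := continuousOn_primitive hT hMd
  have hDi : Integrable (fun s => ‖D s‖) (leb 0 T) := integrable_leb_of_continuousOn hD.norm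
  have hQ : ContinuousOn Q (Icc 0 T) := continuousOn_primitive hT hDi
  have hint {f : ℝ → ℝ} (hf : Integrable f (leb 0 T)) {s : ℝ} (hs : s ∈ Icc 0 T) :
      IntervalIntegrable f volume 0 s := intervalIntegrable_of_leb hf le_rfl hs.1 hs.2
  have hGQ (s : ℝ) (hs : s ∈ Icc 0 T) : ‖G s‖ ≤ a * Q s := by
    refine (intervalIntegral.norm_integral_le_integral_norm hs.1).trans ?_
    rw [← intervalIntegral.integral_const_mul]
    refine intervalIntegral.integral_mono_ae_restrict hs.1 (hint hMd.norm hs)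
      ((hint hDi hs).const_mul a) ?_
    rw [← restrict_Ioo_eq_restrict_Icc]
    filter_upwards [ae_mono (Measure.restrict_mono (Ioo_subset_Ioo_right hs.2) le_rfl) hdδ]
      with r hr
    exact (hM r _).trans_eq (by rw [hr])
  have hQsq : Q t ^ 2 = ∫ s in (0 : ℝ)..t, 2 * (‖D s‖ * Q s) := by
    rw [← sq_abs, ← Real.norm_eq_abs, norm_sq_primitive (hint hDi ht)]
    refine intervalIntegral.integral_congr fun s _ => ?_
    simp only [RCLike.inner_apply, conj_trivial, mul_comm ‖D s‖, Q]
  rw [norm_sq_add_norm_sq_eq_of_integrated_equation hT hd hδ hdδ heq ht, hQsq,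
    ← intervalIntegral.integral_neg, ← intervalIntegral.integral_const_mul]
  refine intervalIntegral.integral_mono_on ht.1
    (hint ((integrable_leb_of_continuousOn (hD.inner hG)).const_mul 2) ht).neg
    (hint (((integrable_leb_of_continuousOn (hD.norm.mul hQ)).const_mul 2).const_mul a) ht)
    fun s hs => ?_
  calc -(2 * inner ℝ (D s) (G s)) ≤ 2 * (‖D s‖ * ‖G s‖) := by
        linarith [(abs_le.1 (abs_real_inner_le_norm (D s) (G s))).1]
    _ ≤ 2 * (‖D s‖ * (a * Q s)) := by
        gcongr
        exact hGQ s ⟨hs.1, hs.2.trans ht.2⟩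
    _ = a * (2 * (‖D s‖ * Q s)) := by ring

lemma ae_eq_zero_of_integrated_equation (hT : 0 ≤ T) (ha : 0 ≤ a)
    (hM : ∀ t u, ‖M t u‖ ≤ a * ‖u‖)
    (hMm : ∀ y : ℝ → L2, AEStronglyMeasurable y (leb 0 T) →
      AEStronglyMeasurable (fun t => M t (y t)) (leb 0 T))
    (hd : Integrable d (leb 0 T)) (hδ : Integrable δ (leb 0 T))
    (hdδ : ∀ᵐ t ∂(leb 0 T), (d t).toL2 = ∫ s in (0 : ℝ)..t, δ s)
    (heq : ∀ᵐ t ∂(leb 0 T), ∀ z : H1Zero, inner ℝ (δ t) z.toL2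
      + inner ℝ (∫ s in (0 : ℝ)..t, d s) z
      + inner ℝ (∫ s in (0 : ℝ)..t, M s (d s).toL2) z.toL2 = 0) :
    d =ᵐ[leb 0 T] 0 := by
  have hMd := LineL2.integrable_potential_comp hM hMm (H1Zero.toL2L.integrable_comp hd)
  have henergy {t : ℝ} (ht : t ∈ Icc 0 T) :=
    norm_sq_add_norm_sq_le_of_integrated_equation hT hM hMd hd hδ hdδ heq ht
  have hD : ∀ t ∈ Icc 0 T, ‖∫ s in (0 : ℝ)..t, δ s‖ = 0 := by
    refine eq_zero_of_le_mul_integral (k := √a) (continuousOn_primitive hT hδ).norm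
      (fun _ _ => norm_nonneg _) fun t ht => ?_
    have hQ : 0 ≤ ∫ s in (0 : ℝ)..t, ‖∫ r in (0 : ℝ)..s, δ r‖ :=
      intervalIntegral.integral_nonneg ht.1 fun _ _ => norm_nonneg _
    refine (sq_le_sq₀ (norm_nonneg _) (by positivity)).1 ?_
    rw [mul_pow, Real.sq_sqrt ha]
    exact (le_add_of_nonneg_right (sq_nonneg _)).trans (henergy ht)
  have hV : ∀ t ∈ Icc 0 T, ∫ s in (0 : ℝ)..t, d s = 0 := by
    intro t ht
    have hQ : ∫ s in (0 : ℝ)..t, ‖∫ r in (0 : ℝ)..s, δ r‖ = 0 := by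
      rw [intervalIntegral_congr_ae_Ioo (g := fun _ => 0) ht.1, intervalIntegral.integral_zero]
      exact Filter.Eventually.of_forall fun s hs hst => hD s ⟨hs.le, hst.le.trans ht.2⟩
    have hle := henergy ht
    rw [hQ, zero_pow two_ne_zero, mul_zero] at hle
    exact norm_eq_zero.1 (pow_eq_zero_iff two_ne_zero |>.1
      (le_antisymm (by linarith [sq_nonneg ‖∫ s in (0 : ℝ)..t, δ s‖]) (sq_nonneg _)))
  exact ae_eq_zero_of_primitive_eq_zero hT hd hV

end IntegratedEquation

section Dual

variable {X Y : Type*} [NormedAddCommGroup X] [InnerProductSpace ℝ X] [NormedAddCommGroup Y]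
  [InnerProductSpace ℝ Y] {a b : ℝ}

lemma integrable_of_memLp_dual {p : ℝ≥0∞} (hp : 1 ≤ p) {g : ℝ → StrongDual ℝ X}
    (hg : MemLp g p (leb a b)) : Integrable g (leb a b) :=
  memLp_one_iff_integrable.1 (hg.mono_exponent hp)

lemma integrable_dual_apply {g : ℝ → StrongDual ℝ X} (hg : MemLp g 1 (leb a b)) (z : X) :
    Integrable (fun s => g s z) (leb a b) :=
  (ContinuousLinearMap.apply ℝ ℝ z).integrable_comp (memLp_one_iff_integrable.1 hg)

lemma dual_apply_ae_eq_primitive (hab : a < b) {f g : ℝ → StrongDual ℝ X} {e : StrongDual ℝ X}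
    (hf : MemLp f 1 (leb a b)) (hg : MemLp g 1 (leb a b)) (hfg : IsWeakDeriv a b f g)
    (he : HasValueAt a b f a e) :
    ∀ᵐ t ∂(leb a b), ∀ z, f t z = e z + ∫ s in a..t, g s z := by
  have hg' := memLp_one_iff_integrable.1 hg
  filter_upwards [hfg.ae_eq_primitive hab (memLp_one_iff_integrable.1 hf) hg' he,
    ae_restrict_mem measurableSet_Ioo] with t h ht z
  rw [h, add_apply, ContinuousLinearMap.intervalIntegral_apply
    (intervalIntegrable_of_leb hg' le_rfl ht.1.le ht.2.le)]

lemma isWeakDeriv_of_dual_apply_eq (hab : a ≤ b) {f g : ℝ → StrongDual ℝ X} {e : StrongDual ℝ X}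
    (hg : MemLp g 1 (leb a b))
    (h : ∀ t ∈ Ioo a b, ∀ z, f t z = e z + ∫ s in a..t, g s z) : IsWeakDeriv a b f g := by
  have hg' := memLp_one_iff_integrable.1 hg
  refine (isWeakDeriv_primitive hab hg' e).congr ?_ (Filter.EventuallyEq.refl _ _)
  filter_upwards [ae_restrict_mem measurableSet_Ioo] with t ht
  ext z
  rw [h t ht, add_apply, ContinuousLinearMap.intervalIntegral_apply
    (intervalIntegrable_of_leb hg' le_rfl ht.1.le ht.2.le)]

lemma memLp_inner_dual (j : X →L[ℝ] Y) {p : ℝ≥0∞} {w : ℝ → Y} (hw : MemLp w p (leb a b)) :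
    MemLp (fun t => (innerSL ℝ (w t)).comp j) p (leb a b) :=
  (((ContinuousLinearMap.compL ℝ X Y ℝ).flip j).comp (innerSL ℝ)).comp_memLp' hw

lemma continuousOn_inner_dual (j : X →L[ℝ] Y) {s : Set ℝ} {w : ℝ → Y} (hw : ContinuousOn w s) :
    ContinuousOn (fun t => (innerSL ℝ (w t)).comp j) s :=
  (((ContinuousLinearMap.compL ℝ X Y ℝ).flip j).comp (innerSL ℝ)).continuous.comp_continuousOn hw

lemma memLp_force_dual (ℓ : StrongDual ℝ X) (j : X →L[ℝ] Y) {p : ℝ≥0∞} {v : ℝ → ℝ} {y : ℝ → X}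
    {F : ℝ → Y} (hv : MemLp v p (leb a b)) (hy : MemLp y p (leb a b)) (hF : MemLp F p (leb a b)) :
    MemLp (fun t => v t • ℓ - innerSL ℝ (y t) + (innerSL ℝ (F t)).comp j) p (leb a b) :=
  ((((1 : ℝ →L[ℝ] ℝ).smulRight ℓ).comp_memLp' hv).sub ((innerSL ℝ).comp_memLp' hy)).add
    (memLp_inner_dual j hF)

end Dual

lemma memLp_toHm1 {a b : ℝ} {p : ℝ≥0∞} {w : ℝ → L2} (hw : MemLp w p (leb a b)) :
    MemLp (fun t => toHm1 (w t)) p (leb a b) := memLp_inner_dual H1Zero.toL2L hw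

lemma continuousOn_toHm1 {s : Set ℝ} {w : ℝ → L2} (hw : ContinuousOn w s) :
    ContinuousOn (fun t => toHm1 (w t)) s := continuousOn_inner_dual H1Zero.toL2L hw

lemma HasValueAt.sub {E : Type*} [AddCommGroup E] [TopologicalSpace E] [ContinuousSub E]
    {a b c : ℝ} {f f' : ℝ → E} {e e' : E} (h : HasValueAt a b f c e)
    (h' : HasValueAt a b f' c e') : HasValueAt a b (f - f') c (e - e') := by
  obtain ⟨r, hr, hfr, rfl⟩ := h
  obtain ⟨r', hr', hfr', rfl⟩ := h'
  exact ⟨r - r', hr.sub hr', hfr.sub hfr', rfl⟩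

lemma toHm1_sub (w w' : L2) : toHm1 (w - w') = toHm1 w - toHm1 w' := by
  ext z
  simp only [toHm1_apply, inner_sub_left, sub_apply]

namespace IsWeakSolution

variable {T : ℝ} {A : ℝ × ℝ → ℝ} {B B' : ℝ → L2} {v v' : ℝ → ℝ} {u₀ u₀' : H1Zero} {u₁ u₁' : L2}
  {w y : ℝ → H1Zero}

lemma sub {q : ℝ≥0∞} (hq : 1 ≤ q) (hA : MemLp A ⊤ (volume.restrict (cylinder T)))
    (hw : IsWeakSolution q T A B v u₀ u₁ w) (hy : IsWeakSolution q T A B' v' u₀' u₁' y) :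
    IsWeakSolution q T A (B - B') (v - v') (u₀ - u₀') (u₁ - u₁') (w - y) := by
  obtain ⟨wt, wtt, hwp, hwtp, hwttp, hdw, hdwt, hweq, hw₀, hw₁⟩ := hw
  obtain ⟨yt, ytt, hyp, hytp, hyttp, hdy, hdyt, hyeq, hy₀, hy₁⟩ := hy
  obtain ⟨M, -, -, hMA⟩ := exists_potential_operator hA
  have hL2 {x : ℝ → H1Zero} (hx : MemLp x 2 (leb 0 T)) :
      Integrable (fun t => (x t).toL2) (leb 0 T) :=
    H1Zero.toL2L.integrable_comp (hx.integrable (by norm_num))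
  have htoHm1 : (fun t => toHm1 ((wt - yt) t)) = (fun t => toHm1 (wt t)) - fun t => toHm1 (yt t) :=
    funext fun t => toHm1_sub _ _
  have htoL2 : (fun t => ((w - y) t).toL2) = (fun t => (w t).toL2) - fun t => (y t).toL2 :=
    funext fun t => map_sub H1Zero.toL2 _ _
  refine ⟨wt - yt, wtt - ytt, hwp.sub hyp, hwtp.sub hytp, ?_, ?_, ?_, ?_, ?_, ?_⟩
  · exact MemLp.sub (E := Hm1) hwttp hyttp
  · rw [htoL2]
    exact hdw.sub hdy (hL2 hwp) (hL2 hyp) (hwtp.integrable (by norm_num))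
      (hytp.integrable (by norm_num))
  · rw [htoHm1]
    exact hdwt.sub hdyt (integrable_of_memLp_dual one_le_two (memLp_toHm1 hwtp))
      (integrable_of_memLp_dual one_le_two (memLp_toHm1 hytp)) (integrable_of_memLp_dual hq hwttp)
      (integrable_of_memLp_dual hq hyttp)
  · filter_upwards [hweq, hyeq, hMA] with t hwt hyt hMt z
    have hwz := hwt z
    have hyz := hyt z
    rw [hMt] at hwz hyz ⊢
    simp only [Pi.sub_apply, map_sub, inner_sub_left, sub_apply]
    linarith
  · rw [htoL2, map_sub]
    exact hw₀.sub hy₀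
  · rw [htoHm1, toHm1_sub]
    exact hw₁.sub hy₁

lemma ae_eq_zero (hT : 0 < T) (hA : MemLp A ⊤ (volume.restrict (cylinder T)))
    (hy : IsWeakSolution 1 T A 0 0 0 0 y) : y =ᵐ[leb 0 T] 0 := by
  obtain ⟨M, hM, hMm, hMA⟩ := exists_potential_operator hA
  obtain ⟨yt, ytt, hyp, hytp, hyttp, hdy, hdyt, hyeq, hy₀, hy₁⟩ := hy
  have hyi : Integrable y (leb 0 T) := hyp.integrable (by norm_num)
  have hyti : Integrable yt (leb 0 T) := hytp.integrable (by norm_num)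
  have hyL2 := H1Zero.toL2L.integrable_comp hyi
  have hMy : Integrable (fun t => M t (y t).toL2) (leb 0 T) :=
    LineL2.integrable_potential_comp hM hMm hyL2
  refine ae_eq_zero_of_integrated_equation hT.le ENNReal.toReal_nonneg hM hMm hyi hyti ?_ ?_
  · filter_upwards [hdy.ae_eq_primitive hT hyL2 hyti hy₀] with t ht
    rw [ht, map_zero, zero_add]
  filter_upwards [dual_apply_ae_eq_primitive hT
    (memLp_toHm1 (memLp_one_iff_integrable.2 hyti)) hyttp hdyt hy₁,
    ae_restrict_mem measurableSet_Ioo] with t hyt ht z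
  have hint {X : Type} [NormedAddCommGroup X] {f : ℝ → X} (hf : Integrable f (leb 0 T)) :
      IntervalIntegrable f volume 0 t := intervalIntegrable_of_leb hf le_rfl ht.1.le ht.2.le
  have hytti := hint (integrable_dual_apply hyttp z)
  have hyz := hint (X := ℝ) (hyi.inner_const z)
  have hMyz := hint (X := ℝ) (hMy.inner_const z.toL2)
  rw [← toHm1_apply, hyt z, toHm1_apply, inner_zero_left, zero_add,
    inner_intervalIntegral_left (hint hyi), inner_intervalIntegral_left (hint hMy),
    ← intervalIntegral.integral_add hytti hyz,
    ← intervalIntegral.integral_add (hytti.add hyz) hMyz,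
    intervalIntegral_congr_ae_Ioo (g := fun _ => 0) ht.1.le, intervalIntegral.integral_zero]
  filter_upwards [(ae_restrict_iff' measurableSet_Ioo).1 hyeq,
    (ae_restrict_iff' measurableSet_Ioo).1 hMA] with s hys hMs hs0 hst
  have hs : s ∈ Ioo 0 T := ⟨hs0, hst.trans ht.2⟩
  have hweak := hys hs z
  rw [hMs hs, Pi.zero_apply, Pi.zero_apply, inner_zero_left, zero_mul, sub_zero] at hweak
  exact hweak

lemma ae_eq (hT : 0 < T) (hA : MemLp A ⊤ (volume.restrict (cylinder T)))
    (hw : IsWeakSolution 1 T A B v u₀ u₁ w) (hy : IsWeakSolution 1 T A B v u₀ u₁ y) :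
    w =ᵐ[leb 0 T] y := by
  have hsub := hw.sub le_rfl hA hy
  simp only [sub_self] at hsub
  filter_upwards [hsub.ae_eq_zero hT hA] with t ht
  exact sub_eq_zero.1 ht

end IsWeakSolution

open LineL2

section Control

variable {T : ℝ} {v : ℝ → ℝ}

/-- The Neumann datum `v` extended by zero from `(0, T)` to the line: the form in which it enters
the d'Alembert profile. -/
def control (hv : MemLp v 2 (leb 0 T)) : LineL2 := zeroExtend 0 T (hv.toLp v)

lemma coeFn_control (hv : MemLp v 2 (leb 0 T)) :
    control hv =ᵐ[volume] (Ioo 0 T).indicator v := by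
  filter_upwards [coeFn_zeroExtend (hv.toLp v),
    (ae_restrict_iff' measurableSet_Ioo).1 hv.coeFn_toLp] with r hext hrep
  rw [control, hext]
  by_cases hr : r ∈ Ioo 0 T
  · rw [indicator_of_mem hr, indicator_of_mem hr, hrep hr]
  · rw [indicator_of_notMem hr, indicator_of_notMem hr]

lemma past_control (hv : MemLp v 2 (leb 0 T)) : past 0 (control hv) = 0 := by
  rw [past_eq_zero_iff]
  filter_upwards [coeFn_control hv] with r hr h
  rw [hr, indicator_of_notMem fun h' => h.not_gt h'.1]

lemma norm_past_control (hv : MemLp v 2 (leb 0 T)) {t : ℝ} (ht : t ≤ T) :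
    ‖past t (control hv)‖ = lpNorm 2 0 t v := by
  have hcontrol : control hv =ᵐ[volume.restrict (Iio t)] (Ioo 0 t).indicator v := by
    filter_upwards [ae_restrict_of_ae (coeFn_control hv), ae_restrict_mem measurableSet_Iio]
      with r hr hrt
    rw [hr]
    by_cases hr0 : 0 < r
    · rw [indicator_of_mem (show r ∈ Ioo 0 T from ⟨hr0, (mem_Iio.1 hrt).trans_le ht⟩),
        indicator_of_mem (show r ∈ Ioo 0 t from ⟨hr0, hrt⟩)]
    · rw [indicator_of_notMem fun h => hr0 h.1, indicator_of_notMem fun h => hr0 h.1]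
  rw [norm_past, eLpNorm_congr_ae hcontrol, eLpNorm_indicator_eq_eLpNorm_restrict measurableSet_Ioo,
    Measure.restrict_restrict_of_subset Ioo_subset_Iio_self, lpNorm]

lemma integral_norm_eq_lpNorm {T t : ℝ} {B : ℝ → L2} (hB : Integrable B (leb 0 T))
    (ht : t ∈ Icc 0 T) : ∫ s in (0 : ℝ)..t, ‖B s‖ = lpNorm 1 0 t B := by
  have hm := hB.1.mono_measure (Measure.restrict_mono (Ioo_subset_Ioo_right ht.2) le_rfl :
    leb 0 t ≤ leb 0 T)
  rw [intervalIntegral_eq_integral_leb ht.1, integral_norm_eq_lintegral_enorm hm, lpNorm,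
    eLpNorm_one_eq_lintegral_enorm]

end Control

section EnergyConst

variable {κ T : ℝ}

/-- The coefficient of `√‖A‖` in the exponent of the energy estimate, for profiles whose bounce
operator has norm at most `κ`. -/
def energyRate (κ T : ℝ) : ℝ := 1 + √(2 * κ) * T

/-- The factor in front of the exponential in the energy estimate, for profiles whose bounce
operator has norm at most `κ`. -/
def energyConst (κ T : ℝ) : ℝ := 2 * κ + 4 * κ * T * (1 + 2 * κ * T) * Real.exp T

lemma energyRate_nonneg (hT : 0 ≤ T) : 0 ≤ energyRate κ T := by
  rw [energyRate]
  positivity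

lemma energyConst_nonneg (hκ : 0 ≤ κ) (hT : 0 ≤ T) : 0 ≤ energyConst κ T := by
  rw [energyConst]
  positivity

lemma le_two_mul_exp_sqrt {a : ℝ} (ha : 0 ≤ a) : a ≤ 2 * Real.exp √a := by
  have hquad := Real.quadratic_le_exp_of_nonneg (Real.sqrt_nonneg a)
  rw [Real.sq_sqrt ha] at hquad
  linarith [Real.sqrt_nonneg a]

lemma exp_sqrt_mul_exp (hκ : 0 ≤ κ) (T a : ℝ) :
    Real.exp √a * Real.exp ((√(2 * κ * a) + 1) * T)
      = Real.exp T * Real.exp (energyRate κ T * √a) := by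
  rw [energyRate, Real.sqrt_mul (by positivity), ← Real.exp_add, ← Real.exp_add]
  ring_nf

-- The polynomial factor `a` is absorbed in `exp √a`, so that the exponent stays linear in `√a`.
lemma add_mul_exp_le_energyConst {a w D d : ℝ} (hκ : 0 ≤ κ) (hT : 0 ≤ T) (ha : 0 ≤ a) (hd : 0 ≤ d)
    (hw : w ≤ d) (hD : D ≤ 2 * κ * d) :
    D + 2 * κ * a * T * (w + T * D) * Real.exp ((√(2 * κ * a) + 1) * T)
      ≤ energyConst κ T * Real.exp (energyRate κ T * √a) * d := by
  have hrate : 0 ≤ energyRate κ T := energyRate_nonneg hT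
  have hone : 1 ≤ Real.exp (energyRate κ T * √a) := Real.one_le_exp (by positivity)
  have hwD : w + T * D ≤ (1 + 2 * κ * T) * d := by
    calc w + T * D ≤ d + T * (2 * κ * d) := by gcongr
      _ = (1 + 2 * κ * T) * d := by ring
  calc D + 2 * κ * a * T * (w + T * D) * Real.exp ((√(2 * κ * a) + 1) * T)
      ≤ 2 * κ * d + 2 * κ * a * T * ((1 + 2 * κ * T) * d)
          * Real.exp ((√(2 * κ * a) + 1) * T) := by gcongr
    _ ≤ 2 * κ * d * Real.exp (energyRate κ T * √a)
        + 2 * κ * (2 * Real.exp √a) * T * ((1 + 2 * κ * T) * d)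
          * Real.exp ((√(2 * κ * a) + 1) * T) := by
        refine add_le_add (le_mul_of_one_le_right (by positivity) hone) ?_
        gcongr
        exact le_two_mul_exp_sqrt ha
    _ = energyConst κ T * Real.exp (energyRate κ T * √a) * d := by
        rw [energyConst]
        linear_combination 4 * κ * T * (1 + 2 * κ * T) * d * exp_sqrt_mul_exp hκ T a

/-- The constant `C(T)` of the theorem, for profiles whose bounce operator has norm at most `κ`. -/
def dataConst (κ T : ℝ) : ℝ := 2 * energyConst κ T + 1 + energyRate κ T

lemma dataConst_pos (hκ : 0 ≤ κ) (hT : 0 ≤ T) : 0 < dataConst κ T := by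
  have hrate : 0 ≤ energyRate κ T := energyRate_nonneg hT
  have hconst := energyConst_nonneg hκ hT
  rw [dataConst]
  positivity

lemma le_dataBound {A : ℝ × ℝ → ℝ} {B : ℝ → L2} {v : ℝ → ℝ} {u₀ : H1Zero} {u₁ : L2} {t p x : ℝ}
    (hκ : 0 ≤ κ) (hT : 0 ≤ T)
    (hp : p ≤ energyConst κ T * Real.exp (energyRate κ T * √(supNorm T A))
      * (√(‖u₀‖ ^ 2 + ‖u₁‖ ^ 2) + lpNorm 1 0 t B + lpNorm 2 0 t v))
    (hx : x ≤ lpNorm 2 0 t v + 2 * p) : x ≤ dataBound (dataConst κ T) T A B v u₀ u₁ t := by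
  have hB : 0 ≤ lpNorm 1 0 t B := ENNReal.toReal_nonneg
  have hv : 0 ≤ lpNorm 2 0 t v := ENNReal.toReal_nonneg
  have hu := Real.sqrt_nonneg (‖u₀‖ ^ 2 + ‖u₁‖ ^ 2)
  have hrate : 0 ≤ energyRate κ T := energyRate_nonneg hT
  have hconst := energyConst_nonneg hκ hT
  have hC : 2 * energyConst κ T + 1 + energyRate κ T = dataConst κ T := rfl
  rw [dataBound]
  set d := √(‖u₀‖ ^ 2 + ‖u₁‖ ^ 2) + lpNorm 1 0 t B + lpNorm 2 0 t v
  have hd : 0 ≤ d := by positivity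
  set e := Real.exp (energyRate κ T * √(supNorm T A))
  have he : 1 ≤ e := Real.one_le_exp (by positivity)
  have hve : lpNorm 2 0 t v ≤ e * d := by
    calc lpNorm 2 0 t v ≤ d := by linarith
      _ ≤ e * d := le_mul_of_one_le_left hd he
  calc x ≤ (2 * energyConst κ T + 1) * e * d := by linarith
    _ ≤ dataConst κ T * Real.exp (dataConst κ T * √(supNorm T A)) * d := by
        refine mul_le_mul_of_nonneg_right
          (mul_le_mul ?_ (Real.exp_le_exp.2 ?_) (by positivity) ?_) hd
        · linarith
        · exact mul_le_mul_of_nonneg_right (by linarith) (Real.sqrt_nonneg _)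
        · linarith

end EnergyConst

section Solution

variable {T a : ℝ} {N : ℕ} {M : ℝ → L2 →L[ℝ] L2} {A : ℝ × ℝ → ℝ} {B F : ℝ → L2} {v : ℝ → ℝ}
  {u₀ : H1Zero} {u₁ : L2}

lemma memLp_of_continuous {E : Type*} [NormedAddCommGroup E] {f : ℝ → E} (hf : Continuous f)
    (p : ℝ≥0∞) (a b : ℝ) : MemLp f p (leb a b) := by
  obtain ⟨K, hK⟩ := isCompact_Icc.exists_bound_of_continuousOn (hf.continuousOn (s := Icc a b))
  refine MemLp.of_bound hf.aestronglyMeasurable K ?_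
  filter_upwards [ae_restrict_mem measurableSet_Ioo] with t ht
  exact hK t (Ioo_subset_Icc_self ht)

lemma intervalIntegral_control (hv : MemLp v 2 (leb 0 T)) {t : ℝ} (ht : t ∈ Icc 0 T)
    (f : ℝ → ℝ) :
    ∫ r in (0 : ℝ)..t, ((control hv : ℝ → ℝ) r - f r) = ∫ r in (0 : ℝ)..t, (v r - f r) := by
  rw [intervalIntegral_eq_integral_leb ht.1, intervalIntegral_eq_integral_leb ht.1]
  refine integral_congr_ae ?_
  filter_upwards [ae_restrict_of_ae (coeFn_control hv), ae_restrict_mem measurableSet_Ioo]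
    with r hr hrt
  rw [hr, indicator_of_mem (Ioo_subset_Ioo_right ht.2 hrt)]

lemma toHm1_velocity_apply (hF : Integrable F) (hTN : T ≤ 2 * N) (hv : MemLp v 2 (leb 0 T))
    {t : ℝ} (ht : t ∈ Icc 0 T) (z : H1Zero) :
    toHm1 (velocity N (profile N u₀ u₁ (control hv)) F t) z = toHm1 u₁ z
      + ∫ s in (0 : ℝ)..t, (v s * z.rep 1
        - inner ℝ (displacement N (profile N u₀ u₁ (control hv)) F s) z
        + inner ℝ (F s) z.toL2) := by
  have hvi : IntervalIntegrable v volume 0 t :=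
    intervalIntegrable_of_leb (hv.integrable (by norm_num)) le_rfl ht.1 ht.2
  have hyi : IntervalIntegrable
      (fun s => inner ℝ (displacement N (profile N u₀ u₁ (control hv)) F s) z) volume 0 t :=
    ((continuous_displacement hF).inner continuous_const).intervalIntegrable _ _
  have hFi : IntervalIntegrable (fun s => inner ℝ (F s) z.toL2) volume 0 t :=
    (hF.inner_const _).intervalIntegrable
  have hV := intervalIntegral_control hv ht fun _ => 0
  simp only [sub_zero] at hV
  rw [toHm1_apply, toHm1_apply, inner_velocity hF z ht.1 (ht.2.trans hTN)
    (profile_boundary_ae (past_control hv)), oddPart_profile (past_control hv), hV,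
    intervalIntegral.integral_add ((hvi.mul_const _).sub hyi) hFi,
    intervalIntegral.integral_sub (hvi.mul_const _) hyi, intervalIntegral.integral_mul_const]
  simp only [H1Zero.inner_eq]
  ring

lemma force_dual_apply (c : ℝ) (y z : H1Zero) (f : L2) :
    (c • H1Zero.evalOne - innerSL ℝ y + (innerSL ℝ f).comp H1Zero.toL2L) z
      = c * z.rep 1 - inner ℝ y z + inner ℝ f z.toL2 := by
  simp

lemma memLp_source {q : ℝ≥0∞} {h₀ : LineL2} (hM : ∀ t u, ‖M t u‖ ≤ a * ‖u‖)
    (hMm : ∀ y : ℝ → L2, AEStronglyMeasurable y (leb 0 T) →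
      AEStronglyMeasurable (fun t => M t (y t)) (leb 0 T))
    (hB : MemLp B q (leb 0 T)) (hF : Integrable F)
    (hFB : ∀ s ∈ Ioo 0 T, F s = B s - M s (displacement N h₀ F s).toL2) :
    MemLp F q (leb 0 T) := by
  have hy : Continuous fun t => (displacement N h₀ F t).toL2 :=
    H1Zero.toL2L.continuous.comp (continuous_displacement hF)
  have hMy : MemLp (fun s => M s (displacement N h₀ F s).toL2) q (leb 0 T) :=
    (memLp_of_continuous hy q 0 T).of_le_mul (hMm _ hy.aestronglyMeasurable)
      (Filter.Eventually.of_forall fun s => hM s _)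
  refine (hB.sub hMy).ae_eq ?_
  filter_upwards [ae_restrict_mem measurableSet_Ioo] with s hs
  exact (hFB s hs).symm

lemma isWeakDeriv_toL2_displacement (hT : 0 ≤ T) (hF : Integrable F) (h₀ : LineL2) :
    IsWeakDeriv 0 T (fun t => (displacement N h₀ F t).toL2) (velocity N h₀ F) := by
  refine (isWeakDeriv_primitive hT (memLp_one_iff_integrable.1 (memLp_of_continuous
    (continuous_velocity hF) 1 0 T)) (wave h₀).toL2).congr ?_ (Filter.EventuallyEq.refl _ _)
  filter_upwards [ae_restrict_mem measurableSet_Ioo] with t ht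
  exact (toL2_displacement hF ht.1.le).symm

lemma isWeakSolution_displacement {q : ℝ≥0∞} (hq : 1 ≤ q) (hq2 : q ≤ 2) (hT : 0 ≤ T)
    (hTN : T ≤ 2 * N) (hM : ∀ t u, ‖M t u‖ ≤ a * ‖u‖)
    (hMm : ∀ y : ℝ → L2, AEStronglyMeasurable y (leb 0 T) →
      AEStronglyMeasurable (fun t => M t (y t)) (leb 0 T))
    (hMA : ∀ᵐ t ∂(leb 0 T), ∀ u z : L2,
      ∫ x in Ioo (0 : ℝ) 1, A (x, t) * u x * z x = inner ℝ (M t u) z)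
    (hB : MemLp B q (leb 0 T)) (hv : MemLp v 2 (leb 0 T)) (hF : Integrable F)
    (hFB : ∀ s ∈ Ioo 0 T,
      F s = B s - M s (displacement N (profile N u₀ u₁ (control hv)) F s).toL2) :
    IsWeakSolution q T A B v u₀ u₁ (displacement N (profile N u₀ u₁ (control hv)) F) := by
  set h₀ := profile N u₀ u₁ (control hv)
  set y := displacement N h₀ F
  have hy : Continuous y := continuous_displacement hF
  have hyL2 : Continuous fun t => (y t).toL2 := H1Zero.toL2L.continuous.comp hy
  have hyt : Continuous (velocity N h₀ F) := continuous_velocity hF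
  have hytt := memLp_force_dual H1Zero.evalOne H1Zero.toL2L (hv.mono_exponent hq2)
    (memLp_of_continuous hy q 0 T) (memLp_source hM hMm hB hF hFB)
  refine ⟨velocity N h₀ F, _, memLp_of_continuous hy 2 0 T, memLp_of_continuous hyt 2 0 T, hytt,
    isWeakDeriv_toL2_displacement hT hF h₀,
    isWeakDeriv_of_dual_apply_eq hT (e := toHm1 u₁) (hytt.mono_exponent hq) ?_, ?_,
    ⟨_, hyL2.continuousOn, Filter.EventuallyEq.refl _ _, ?_⟩,
    ⟨_, continuousOn_toHm1 hyt.continuousOn, Filter.EventuallyEq.refl _ _, ?_⟩⟩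
  · intro t ht z
    simp only [force_dual_apply]
    exact toHm1_velocity_apply hF hTN hv (Ioo_subset_Icc_self ht) z
  · filter_upwards [hMA, ae_restrict_mem measurableSet_Ioo] with t hMAt ht z
    rw [hMAt, force_dual_apply, hFB t ht, inner_sub_left, H1Zero.inner_eq]
    ring
  · simp [y, displacement, h₀, wave_profile (past_control hv)]
  · simp [velocity, h₀, oddPart_profile (past_control hv)]

lemma hasDerivWithinAt_displacement {h₀ : LineL2} (hF : Integrable F) {t : ℝ} (ht : t ∈ Icc 0 T) :
    HasDerivWithinAt (fun s => (displacement N h₀ F s).toL2) (velocity N h₀ F t) (Icc 0 T) t := by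
  have hc := continuous_velocity (N := N) (h₀ := h₀) hF
  refine (((hc.integral_hasStrictDerivAt 0 t).hasDerivAt.const_add
    (wave h₀).toL2).hasDerivWithinAt (s := Icc 0 T)).congr ?_ ?_
  · exact fun s hs => toL2_displacement hF hs.1
  · exact toL2_displacement hF ht.1

lemma norm_past_history_le_data (ha : 0 ≤ a) (hM : ∀ t u, ‖M t u‖ ≤ a * ‖u‖)
    (hB : Integrable B (leb 0 T)) (hv : MemLp v 2 (leb 0 T)) (hF : Integrable F)
    (hFB : ∀ s ∈ Ioo 0 T,
      F s = B s - M s (displacement N (profile N u₀ u₁ (control hv)) F s).toL2)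
    {κ : ℝ} (hκ : κ = 2 * (N + 1)) {t : ℝ} (ht : t ∈ Icc 0 T) :
    ‖past (t + 1) (history N (profile N u₀ u₁ (control hv)) F t)‖
      ≤ energyConst κ T * Real.exp (energyRate κ T * √a)
        * (√(‖u₀‖ ^ 2 + ‖u₁‖ ^ 2) + lpNorm 1 0 t B + lpNorm 2 0 t v) := by
  have hκ0 : 0 ≤ κ := by rw [hκ]; positivity
  have hu₀ : ‖u₀‖ ≤ √(‖u₀‖ ^ 2 + ‖u₁‖ ^ 2) :=
    Real.le_sqrt_of_sq_le (by linarith [sq_nonneg ‖u₁‖])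
  have hu₁ : ‖u₁‖ ≤ √(‖u₀‖ ^ 2 + ‖u₁‖ ^ 2) :=
    Real.le_sqrt_of_sq_le (by linarith [sq_nonneg ‖u₀‖])
  have hB0 : 0 ≤ lpNorm 1 0 t B := ENNReal.toReal_nonneg
  have hv0 : 0 ≤ lpNorm 2 0 t v := ENNReal.toReal_nonneg
  refine (norm_past_history_le_exp ha hM hB hF hFB hκ ht rfl).trans
    (add_mul_exp_le_energyConst hκ0 (ht.1.trans ht.2) ha (by positivity) ?_ ?_)
  · rw [wave_profile (past_control hv)]
    linarith
  · have hprofile := norm_past_profile_le (N := N) (u₀ := u₀) (u₁ := u₁) (V := control hv) t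
    rw [norm_past_control hv ht.2, ← hκ] at hprofile
    rw [integral_norm_eq_lpNorm hB ht]
    nlinarith [mul_le_mul_of_nonneg_left hu₀ hκ0, mul_le_mul_of_nonneg_left hu₁ hκ0,
      mul_nonneg hκ0 hB0, mul_nonneg hκ0 hv0]

lemma isWeakDeriv_rep_one_displacement (hT : 0 ≤ T) (hTN : T ≤ 2 * N) (hF : Integrable F)
    (hv : MemLp v 2 (leb 0 T)) :
    IsWeakDeriv 0 T (fun t => (displacement N (profile N u₀ u₁ (control hv)) F t).rep 1)
      (fun r => v r
        - (shift (-1) (history N (profile N u₀ u₁ (control hv)) F T) : ℝ → ℝ) r) := by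
  set H := history N (profile N u₀ u₁ (control hv)) F T
  have hg : MemLp (fun r => v r - (shift (-1) H : ℝ → ℝ) r) 2 (leb 0 T) :=
    hv.sub ((Lp.memLp (shift (-1) H)).restrict _)
  refine (isWeakDeriv_primitive hT (hg.integrable (by norm_num)) (u₀.rep 1)).congr ?_
    (Filter.EventuallyEq.refl _ _)
  filter_upwards [ae_restrict_mem measurableSet_Ioo] with t ht
  rw [rep_one_displacement hF ht.1.le ht.2.le (ht.2.le.trans hTN)
    (profile_boundary_ae (past_control hv)), intervalIntegral_control hv (Ioo_subset_Icc_self ht),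
    wave_profile (past_control hv)]
  congr 1
  refine intervalIntegral.integral_congr_ae ?_
  filter_upwards [coeFn_shift (-1) H] with r hr _
  rw [hr, sub_eq_add_neg r 1]

lemma norm_displacement_add_norm_velocity_le {h₀ : LineL2} (t : ℝ) :
    ‖displacement N h₀ F t‖ + ‖velocity N h₀ F t‖ ≤ 2 * ‖past (t + 1) (history N h₀ F t)‖ := by
  linarith [norm_displacement_le (N := N) (h₀ := h₀) (F := F) t,
    norm_velocity_le (N := N) (h₀ := h₀) (F := F) t]

lemma lpNorm_sub_shift_history_le {h₀ : LineL2} (hF : Integrable F) (hv : MemLp v 2 (leb 0 T))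
    {t : ℝ} (ht : t ≤ T) :
    lpNorm 2 0 t (fun r => v r - (shift (-1) (history N h₀ F T) : ℝ → ℝ) r)
      ≤ lpNorm 2 0 t v + ‖past (t + 1) (history N h₀ F t)‖ := by
  set H := history N h₀ F T
  have hvt : MemLp v 2 (leb 0 t) :=
    hv.mono_measure (Measure.restrict_mono (Ioo_subset_Ioo_right ht) le_rfl)
  have hHt : MemLp (shift (-1) H : ℝ → ℝ) 2 (leb 0 t) := (Lp.memLp (shift (-1) H)).restrict _
  have hcausal : past (t - 1) H = past (t - 1) (history N h₀ F t) := by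
    have hsub := past_history_sub (N := N) (h₀ := h₀) hF ht
    rwa [map_sub, sub_eq_zero] at hsub
  calc lpNorm 2 0 t (fun r => v r - (shift (-1) H : ℝ → ℝ) r)
      ≤ lpNorm 2 0 t v + lpNorm 2 0 t (shift (-1) H : ℝ → ℝ) := by
        rw [lpNorm, lpNorm, lpNorm, ← ENNReal.toReal_add hvt.2.ne hHt.2.ne]
        exact ENNReal.toReal_mono (ENNReal.add_ne_top.2 ⟨hvt.2.ne, hHt.2.ne⟩)
          (eLpNorm_sub_le hvt.1 hHt.1 (by norm_num))
    _ ≤ lpNorm 2 0 t v + ‖past t (shift (-1) H)‖ := by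
        rw [norm_past]
        exact add_le_add_right (ENNReal.toReal_mono (eLpNorm_restrict_ne_top _ _)
          (eLpNorm_mono_measure _ (Measure.restrict_mono Ioo_subset_Iio_self le_rfl))) _
    _ ≤ lpNorm 2 0 t v + ‖past (t + 1) (history N h₀ F t)‖ := by
        rw [norm_past_shift, ← sub_eq_add_neg, hcausal]
        exact add_le_add_right (norm_past_mono (by linarith) _) _

end Solution

end Wave1D

end

open Wave1D in
theorem theorem4 (T : ℝ) (hT : 0 < T) :
    ∃ C : ℝ, 0 < C ∧
      ∀ (A : ℝ × ℝ → ℝ) (B : ℝ → L2) (v : ℝ → ℝ) (u₀ : H1Zero) (u₁ : L2),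
        MemLp A ∞ (volume.restrict (cylinder T)) →
        MemLp B 1 (leb 0 T) →
        MemLp v 2 (leb 0 T) →
        ∃ y : ℝ → H1Zero,
          IsWeakSolution 1 T A B v u₀ u₁ y ∧
          (MemLp B 2 (leb 0 T) → IsWeakSolution 2 T A B v u₀ u₁ y) ∧
          (∀ w : ℝ → H1Zero, IsWeakSolution 1 T A B v u₀ u₁ w → w =ᵐ[leb 0 T] y) ∧
          ContinuousOn y (Icc 0 T) ∧
          (∃ yt : ℝ → L2, ContinuousOn yt (Icc 0 T) ∧
            (∀ t ∈ Icc 0 T, HasDerivWithinAt (fun s => (y s).toL2) (yt t) (Icc 0 T) t) ∧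
            ∀ t ∈ Icc 0 T, ‖y t‖ + ‖yt t‖ ≤ dataBound C T A B v u₀ u₁ t) ∧
          MemLp (fun t => (y t).rep 1) 2 (leb 0 T) ∧
          ∃ g : ℝ → ℝ, MemLp g 2 (leb 0 T) ∧
            IsWeakDeriv 0 T (fun t => (y t).rep 1) g ∧
            ∀ t ∈ Icc 0 T, lpNorm 2 0 t g ≤ dataBound C T A B v u₀ u₁ t := by
  obtain ⟨N, hN⟩ := exists_nat_ge T
  have hTN : T ≤ 2 * N := by linarith
  have hκ : (0 : ℝ) ≤ 2 * (N + 1) := by positivity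
  refine ⟨_, dataConst_pos hκ hT.le, fun A B v u₀ u₁ hA hB hv => ?_⟩
  obtain ⟨M, hM, hMm, hMA⟩ := exists_potential_operator hA
  have ha : 0 ≤ supNorm T A := ENNReal.toReal_nonneg
  have hBint := memLp_one_iff_integrable.1 hB
  set h₀ := LineL2.profile N u₀ u₁ (control hv)
  obtain ⟨F, hF, hFB⟩ := LineL2.exists_source_fixed_point (N := N) (h₀ := h₀) hT ha hM hMm hBint
  have hsol := isWeakSolution_displacement le_rfl (by norm_num) hT.le hTN hM hMm hMA hB hv hF hFB
  have hy := LineL2.continuous_displacement (N := N) (h₀ := h₀) hF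
  have henergy := fun t ht => norm_past_history_le_data ha hM hBint hv hF hFB rfl (t := t) ht
  refine ⟨_, hsol, fun hB2 =>
    isWeakSolution_displacement (by norm_num) le_rfl hT.le hTN hM hMm hMA hB2 hv hF hFB,
    fun w hw => hw.ae_eq hT hA hsol, hy.continuousOn,
    ⟨_, (LineL2.continuous_velocity hF).continuousOn,
      fun t ht => hasDerivWithinAt_displacement hF ht,
      fun t ht => le_dataBound hκ hT.le (henergy t ht) ?_⟩,
    memLp_of_continuous (H1Zero.continuous_rep_one.comp hy) 2 0 T, _,
    hv.sub ((Lp.memLp _).restrict _), isWeakDeriv_rep_one_displacement hT.le hTN hF hv,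
    fun t ht => le_dataBound hκ hT.le (henergy t ht) ?_⟩
  · exact (norm_displacement_add_norm_velocity_le t).trans
      (le_add_of_nonneg_left ENNReal.toReal_nonneg)
  · exact (lpNorm_sub_shift_history_le hF hv ht.2).trans
      (add_le_add_right (le_mul_of_one_le_left (norm_nonneg _) one_le_two) _)
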